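/- **Theorem 1.1.** Let $\mathbb{H}=\{(z_1,z_2)\in\mathbb{C}^2 : |z_1|<|z_2|<1\}$ be the Hartogs triangle. For $s'\in\mathbb{R}$ and $1\le p<\infty$ let $L^p(\mathbb{H},|z_2|^{s'})$ be the space of measurable functions $f$ on $\mathbb{H}$ with $\|f\|_p=\big(\int_{\mathbb{H}}|f(z)|^p|z_2|^{s'}\,dV(z)\big)^{1/p}<\infty$, where $dV$ is Lebesgue measure. Let $\mathcal{B}_{\mathbb{H},s'}$ be the weighted Bergman projection, that is, the orthogonal projection of $L^2(\mathbb{H},|z_2|^{s'})$ onto its closed subspace of holomorphic functions. We call $\mathcal{B}_{\mathbb{H},s'}$ *$L^p$ bounded* if there is a constant $C<\infty$ such that $\|\mathcal{B}_{\mathbb{H},s'}f\|_p\le C\|f\|_p$ for all $f\in L^2(\mathbb{H},|z_2|^{s'})\cap L^p(\mathbb{H},|z_2|^{s'})$. Every $s'\in\mathbb{R}$ has a unique expression $s'=s+2k$ with $k\in\mathbb{Z}$ and $s\in(0,2]$. With this $s$ and $k$, and for $1\le p<\infty$: 1. If $s'\in(-2,\infty)$, then $\mathcal{B}_{\mathbb{H},s'}$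 is $L^p$ bounded if and only if $p\in\left(\frac{s+2k+4}{s+k+2},\frac{s+2k+4}{k+2}\right)$. 2. If $s'\in[-5,-2]$, then $\mathcal{B}_{\mathbb{H},s'}$ is $L^p$ bounded if and only if $p\in(1,\infty)$. 3. If $s'\in(-6,-5)$, then $k=-3$, $s\in(0,1)$, and $\mathcal{B}_{\mathbb{H},s'}$ is $L^p$ bounded if and only if $p\in\left(2-s,\frac{2-s}{1-s}\right)$. 4. If $s'=-6$, then $\mathcal{B}_{\mathbb{H},s'}$ is $L^p$ bounded if and only if $p\in(1,\infty)$. 5. If $s'\in(-\infty,-6)$, then $\mathcal{B}_{\mathbb{H},s'}$ is $L^p$ bounded if and only if $p\in\left(\frac{s+2k+4}{k+2},\frac{s+2k+4}{s+k+2}\right)$. -/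

import Mathlib

namespace HartogsBergman

open MeasureTheory Set Metric Filter Topology
open scoped ENNReal NNReal

/-- The measure `μ dV` on `Ω ⊆ ℂ²`, where `dV` is Lebesgue measure; thus `L^p(Ω, μ)` is
`Lp ℂ p (weightedVolume Ω μ)`. -/
noncomputable def weightedVolume (Ω : Set (ℂ × ℂ)) (μ : ℂ × ℂ → ℝ) : Measure (ℂ × ℂ) :=
  (volume.restrict Ω).withDensity fun z => ENNReal.ofReal (μ z)

/-- The weighted Bergman space `A²(Ω, μ) = L²(Ω, μ) ∩ 𝒪(Ω)`: the classes in `L²(Ω, μ)` that have a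
representative which is holomorphic on `Ω`. -/
def bergmanSpace (Ω : Set (ℂ × ℂ)) (μ : ℂ × ℂ → ℝ) :
    Submodule ℂ (Lp ℂ 2 (weightedVolume Ω μ)) where
  carrier := {F | ∃ f : ℂ × ℂ → ℂ, DifferentiableOn ℂ f Ω ∧ F =ᵐ[weightedVolume Ω μ] f}
  add_mem' := by
    rintro F G ⟨f, hf, hFf⟩ ⟨g, hg, hGg⟩
    exact ⟨f + g, hf.add hg, (Lp.coeFn_add F G).trans (hFf.add hGg)⟩
  zero_mem' := ⟨0, differentiableOn_const 0, Lp.coeFn_zero _ _ _⟩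
  smul_mem' := by
    rintro c F ⟨f, hf, hFf⟩
    exact ⟨c • f, hf.const_smul c, (Lp.coeFn_smul c F).trans (hFf.const_smul c)⟩

/-! The closedness of `A²(Ω, μ)` for a positive continuous weight on an open set, which is what makes
the orthogonal projection onto it exist. -/

theorem measurePreserving_smul_circleMap (θ : ℝ) :
    MeasurePreserving (fun v : ℂ × ℂ => circleMap 0 1 θ • v) volume volume := by
  have h : MeasurePreserving (fun z : ℂ => circleMap 0 1 θ * z) volume volume := by
    have := (rotation (Circle.exp θ)).measurePreserving
    have e : (fun z : ℂ => circleMap 0 1 θ * z) = rotation (Circle.exp θ) := by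
      ext z
      simp [circleMap, rotation_apply]
    rw [e]
    exact this
  exact h.prod h

theorem enorm_le_circle_lintegral {f : ℂ × ℂ → ℂ} {r : ℝ}
    (hf : DifferentiableOn ℂ f (ball 0 r)) {v : ℂ × ℂ} (hv : v ∈ ball (0 : ℂ × ℂ) r) :
    ENNReal.ofReal (2 * Real.pi) * ‖f 0‖ₑ
      ≤ ∫⁻ θ in Ioc 0 (2 * Real.pi), ‖f (circleMap 0 1 θ • v)‖ₑ := by
  have hd : DifferentiableOn ℂ (fun t : ℂ => f (t • v)) (closedBall 0 1) := by
    refine hf.comp (by fun_prop) ?_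
    intro t ht
    simp only [mem_ball, mem_closedBall, dist_zero_right] at *
    rw [norm_smul]
    nlinarith [norm_nonneg v, norm_nonneg t]
  have hd' : DiffContOnCl ℂ (fun t : ℂ => f (t • v)) (ball 0 |1|) := by
    refine DifferentiableOn.diffContOnCl ?_
    rw [abs_one, closure_ball _ one_ne_zero]
    exact hd
  have h := hd'.circleAverage
  rw [Real.circleAverage_def] at h
  have hpi : (0 : ℝ) < 2 * Real.pi := by positivity
  simp only [zero_smul] at h
  rw [← h, enorm_smul, ← mul_assoc, intervalIntegral.integral_of_le hpi.le]
  have : ENNReal.ofReal (2 * Real.pi) * ‖(2 * Real.pi)⁻¹‖ₑ = 1 := by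
    rw [Real.enorm_eq_ofReal (by positivity), ← ENNReal.ofReal_mul hpi.le,
      mul_inv_cancel₀ hpi.ne', ENNReal.ofReal_one]
  rw [this, one_mul]
  exact enorm_integral_le_lintegral_enorm _

theorem volume_mul_enorm_le_lintegral_zero {f : ℂ × ℂ → ℂ} {r : ℝ}
    (hf : DifferentiableOn ℂ f (ball 0 r)) :
    volume (ball (0 : ℂ × ℂ) r) * ‖f 0‖ₑ ≤ ∫⁻ w in ball 0 r, ‖f w‖ₑ := by
  classical
  have hm : Measurable ((ball (0 : ℂ × ℂ) r).indicator f) := by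
    have := hf.continuousOn.measurable_piecewise
      (continuousOn_const (c := (0 : ℂ)) (s := (ball (0 : ℂ × ℂ) r)ᶜ)) measurableSet_ball
    rw [← Set.piecewise_eq_indicator]
    exact this
  have hpi : (0 : ℝ) < 2 * Real.pi := by positivity
  have hmem : ∀ θ (v : ℂ × ℂ), circleMap 0 1 θ • v ∈ ball (0 : ℂ × ℂ) r ↔ v ∈ ball (0 : ℂ × ℂ) r := by
    intro θ v
    simp [norm_smul]
  set g := (ball (0 : ℂ × ℂ) r).indicator f with hg
  have hgm : Measurable fun p : (ℂ × ℂ) × ℝ => ‖g (circleMap 0 1 p.2 • p.1)‖ₑ := by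
    refine (hm.comp ?_).enorm
    have : Continuous fun p : (ℂ × ℂ) × ℝ => circleMap 0 1 p.2 • p.1 :=
      ((continuous_circleMap 0 1).comp continuous_snd).smul continuous_fst
    exact this.measurable
  have key : ENNReal.ofReal (2 * Real.pi) * (volume (ball (0 : ℂ × ℂ) r) * ‖f 0‖ₑ)
      ≤ ENNReal.ofReal (2 * Real.pi) * ∫⁻ w in ball 0 r, ‖f w‖ₑ := by
    calc ENNReal.ofReal (2 * Real.pi) * (volume (ball (0 : ℂ × ℂ) r) * ‖f 0‖ₑ)
        = ∫⁻ v in ball (0 : ℂ × ℂ) r, ENNReal.ofReal (2 * Real.pi) * ‖f 0‖ₑ := by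
          rw [setLIntegral_const]; ring
      _ ≤ ∫⁻ v in ball (0 : ℂ × ℂ) r,
            ∫⁻ θ in Ioc 0 (2 * Real.pi), ‖g (circleMap 0 1 θ • v)‖ₑ := by
          refine setLIntegral_mono' measurableSet_ball fun v hv => ?_
          refine (enorm_le_circle_lintegral hf hv).trans (le_of_eq ?_)
          refine lintegral_congr fun θ => ?_
          rw [hg, indicator_of_mem ((hmem θ v).2 hv)]
      _ = ∫⁻ v : ℂ × ℂ, ∫⁻ θ in Ioc 0 (2 * Real.pi), ‖g (circleMap 0 1 θ • v)‖ₑ := by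
          refine setLIntegral_eq_of_support_subset ?_
          intro v hv
          by_contra hv'
          refine hv ?_
          have : ∀ θ, g (circleMap 0 1 θ • v) = 0 := fun θ =>
            indicator_of_notMem (fun h => hv' ((hmem θ v).1 h)) _
          simp [this]
      _ = ∫⁻ θ in Ioc 0 (2 * Real.pi), ∫⁻ v : ℂ × ℂ, ‖g (circleMap 0 1 θ • v)‖ₑ :=
          lintegral_lintegral_swap hgm.aemeasurable
      _ = ∫⁻ θ in Ioc 0 (2 * Real.pi), ∫⁻ v : ℂ × ℂ, ‖g v‖ₑ := by
          refine lintegral_congr fun θ => ?_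
          exact (measurePreserving_smul_circleMap θ).lintegral_comp (f := fun v => ‖g v‖ₑ) hm.enorm
      _ = ENNReal.ofReal (2 * Real.pi) * ∫⁻ w in ball 0 r, ‖f w‖ₑ := by
          rw [setLIntegral_const, Real.volume_Ioc, sub_zero, mul_comm,
            ← lintegral_indicator measurableSet_ball]
          congr 1
          refine lintegral_congr fun w => ?_
          rw [hg, enorm_indicator_eq_indicator_enorm]
  exact (ENNReal.mul_le_mul_iff_right (by simpa using hpi) ENNReal.ofReal_ne_top).1 key

theorem volume_mul_enorm_le_lintegral {f : ℂ × ℂ → ℂ} {z : ℂ × ℂ} {r : ℝ}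
    (hf : DifferentiableOn ℂ f (ball z r)) :
    volume (ball (0 : ℂ × ℂ) r) * ‖f z‖ₑ ≤ ∫⁻ w in ball z r, ‖f w‖ₑ := by
  have h := volume_mul_enorm_le_lintegral_zero (f := fun v => f (z + v))
    (hf.comp (by fun_prop) (by intro v hv; simpa using hv))
  simp only [add_zero] at h
  refine h.trans (le_of_eq ?_)
  have : (volume : Measure (ℂ × ℂ)).IsAddLeftInvariant :=
    inferInstanceAs ((volume : Measure ℂ).prod (volume : Measure ℂ)).IsAddLeftInvariant
  have := (measurePreserving_add_left (volume : Measure (ℂ × ℂ)) z).setLIntegral_comp_preimage_emb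
    (MeasurableEquiv.addLeft z).measurableEmbedding (fun w => ‖f w‖ₑ) (ball z r)
  rw [← this]
  congr 2
  ext v; simp

theorem exists_ball_enorm_sq_le {Ω : Set (ℂ × ℂ)} {μ : ℂ × ℂ → ℝ} (hΩ : IsOpen Ω)
    (hμ : ContinuousOn μ Ω) (hpos : ∀ z ∈ Ω, 0 < μ z) {z₀ : ℂ × ℂ} (hz₀ : z₀ ∈ Ω) :
    ∃ r > 0, ball z₀ r ⊆ Ω ∧ ∃ C : ℝ≥0, ∀ f : ℂ × ℂ → ℂ, DifferentiableOn ℂ f Ω →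
      ∀ z ∈ ball z₀ r, ‖f z‖ₑ ^ 2 ≤ C * ∫⁻ w, ‖f w‖ₑ ^ 2 ∂(weightedVolume Ω μ) := by
  have h1 : ∀ᶠ z in 𝓝 z₀, z ∈ Ω ∧ μ z₀ / 2 < μ z := by
    refine Filter.Eventually.and (hΩ.mem_nhds hz₀) ?_
    exact (hμ.continuousAt (hΩ.mem_nhds hz₀)).eventually_const_lt (half_lt_self (hpos z₀ hz₀))
  obtain ⟨R, hR, hb⟩ := Metric.eventually_nhds_iff_ball.1 h1
  have hc : 0 < μ z₀ / 2 := half_pos (hpos z₀ hz₀)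
  set c := μ z₀ / 2
  set V := volume (ball (0 : ℂ × ℂ) (R / 2)) with hV
  have hV0 : V ≠ 0 := (measure_ball_pos volume _ (half_pos hR)).ne'
  have hVt : V ≠ ∞ := measure_ball_lt_top.ne
  refine ⟨R / 2, half_pos hR, fun z hz => (hb z (ball_subset_ball (by linarith) hz)).1,
    (V⁻¹ * (ENNReal.ofReal c)⁻¹).toNNReal, fun f hf z hz => ?_⟩
  have hc0 : ENNReal.ofReal c ≠ 0 := by simpa using hc
  have hct : ENNReal.ofReal c ≠ ∞ := ENNReal.ofReal_ne_top
  rw [ENNReal.coe_toNNReal (ENNReal.mul_ne_top (ENNReal.inv_ne_top.2 hV0) (ENNReal.inv_ne_top.2 hc0))]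
  have hsub : ball z (R / 2) ⊆ ball z₀ R := by
    intro w hw
    rw [mem_ball] at *
    linarith [dist_triangle w z z₀]
  have h2 := volume_mul_enorm_le_lintegral (f := fun w => f w ^ 2)
    ((hf.pow 2).mono fun w hw => (hb w (hsub hw)).1)
  simp only [enorm_pow] at h2
  have h3 : ENNReal.ofReal c * ∫⁻ w in ball z (R / 2), ‖f w‖ₑ ^ 2
      ≤ ∫⁻ w, ‖f w‖ₑ ^ 2 ∂(weightedVolume Ω μ) := by
    rw [weightedVolume, ← lintegral_const_mul' _ _ hct]
    calc ∫⁻ w in ball z (R / 2), ENNReal.ofReal c * ‖f w‖ₑ ^ 2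
        ≤ ∫⁻ w in ball z (R / 2), ENNReal.ofReal (μ w) * ‖f w‖ₑ ^ 2 := by
          refine setLIntegral_mono' measurableSet_ball fun w hw => ?_
          gcongr
          exact (hb w (hsub hw)).2.le
      _ ≤ ∫⁻ w in Ω, ENNReal.ofReal (μ w) * ‖f w‖ₑ ^ 2 :=
          lintegral_mono_set fun w hw => (hb w (hsub hw)).1
      _ = _ := by
          rw [lintegral_withDensity_eq_lintegral_mul₀]
          · rfl
          · exact (hμ.aemeasurable hΩ.measurableSet).ennreal_ofReal
          · exact ((hf.continuousOn.aemeasurable hΩ.measurableSet).enorm).pow_const 2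
  calc ‖f z‖ₑ ^ 2 = V⁻¹ * (ENNReal.ofReal c)⁻¹ * (ENNReal.ofReal c * (V * ‖f z‖ₑ ^ 2)) := by
        have e1 : (ENNReal.ofReal c)⁻¹ * ENNReal.ofReal c = 1 := ENNReal.inv_mul_cancel hc0 hct
        have e2 : V⁻¹ * V = 1 := ENNReal.inv_mul_cancel hV0 hVt
        calc ‖f z‖ₑ ^ 2 = (V⁻¹ * V) * ((ENNReal.ofReal c)⁻¹ * ENNReal.ofReal c) * ‖f z‖ₑ ^ 2 := by
              rw [e1, e2, one_mul, one_mul]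
          _ = _ := by ring
    _ ≤ _ := by
        gcongr
        exact (mul_le_mul_right h2 _).trans h3

theorem isClosed_bergmanSpace {Ω : Set (ℂ × ℂ)} {μ : ℂ × ℂ → ℝ} (hΩ : IsOpen Ω)
    (hμ : ContinuousOn μ Ω) (hpos : ∀ z ∈ Ω, 0 < μ z) :
    IsClosed (bergmanSpace Ω μ : Set (Lp ℂ 2 (weightedVolume Ω μ))) := by
  refine IsSeqClosed.isClosed fun F G hF hG => ?_
  choose f hf hFf using hF
  have hL2 : ∀ n m, ∫⁻ w, ‖f n w - f m w‖ₑ ^ 2 ∂(weightedVolume Ω μ)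
      = ENNReal.ofReal (‖F n - F m‖ ^ 2) := by
    intro n m
    have e : eLpNorm (⇑(F n - F m)) 2 (weightedVolume Ω μ)
        = eLpNorm (fun w => f n w - f m w) 2 (weightedVolume Ω μ) :=
      eLpNorm_congr_ae ((Lp.coeFn_sub _ _).trans ((hFf n).sub (hFf m)))
    rw [ENNReal.ofReal_pow (norm_nonneg _), Lp.norm_def, ENNReal.ofReal_toReal (Lp.eLpNorm_ne_top _),
      e, eLpNorm_eq_lintegral_rpow_enorm_toReal (by norm_num) (by norm_num),
      ← ENNReal.rpow_natCast, ← ENNReal.rpow_mul]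
    norm_num
  have hcau := hG.cauchySeq
  -- local uniform control of the differences
  have hloc : ∀ z₀ ∈ Ω, ∃ r > 0, ball z₀ r ⊆ Ω ∧ ∃ C : ℝ, 0 ≤ C ∧ ∀ n m, ∀ z ∈ ball z₀ r,
      ‖f n z - f m z‖ ≤ C * ‖F n - F m‖ := by
    intro z₀ hz₀
    obtain ⟨r, hr, hb, C, hC⟩ := exists_ball_enorm_sq_le hΩ hμ hpos hz₀
    refine ⟨r, hr, hb, Real.sqrt C, Real.sqrt_nonneg _, fun n m z hz => ?_⟩
    have h := hC (fun w => f n w - f m w) ((hf n).sub (hf m)) z hz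
    rw [hL2, ← ofReal_norm, ← ENNReal.ofReal_pow (norm_nonneg _),
      ← ENNReal.ofReal_coe_nnreal, ← ENNReal.ofReal_mul C.coe_nonneg,
      ENNReal.ofReal_le_ofReal_iff (by positivity)] at h
    refine abs_le_of_sq_le_sq' ?_ (by positivity) |>.2
    rwa [mul_pow, Real.sq_sqrt C.coe_nonneg]
  have hcz : ∀ z ∈ Ω, CauchySeq fun n => f n z := by
    intro z hz
    obtain ⟨r, hr, hb, C, hC0, hC⟩ := hloc z hz
    rw [Metric.cauchySeq_iff] at hcau ⊢
    intro ε hε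
    obtain ⟨N, hN⟩ := hcau (ε / (C + 1)) (by positivity)
    refine ⟨N, fun n hn m hm => ?_⟩
    rw [dist_eq_norm]
    have h1 := hN n hn m hm
    rw [dist_eq_norm, lt_div_iff₀ (by positivity)] at h1
    nlinarith [hC n m z (mem_ball_self hr), norm_nonneg (F n - F m)]
  choose! g hg using fun z hz => cauchySeq_tendsto_of_complete (hcz z hz)
  have hdiff : DifferentiableOn ℂ g Ω := by
    intro z₀ hz₀
    obtain ⟨r, hr, hb, C, hC0, hC⟩ := hloc z₀ hz₀
    have hat : ∀ n, ∀ z ∈ Ω, DifferentiableAt ℂ (f n) z := fun n z hz =>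
      (hf n).differentiableAt (hΩ.mem_nhds hz)
    have hsub : ball z₀ (r / 2) ⊆ Ω := (ball_subset_ball (by linarith)).trans hb
    have hfd : ∀ n m, ∀ z ∈ ball z₀ (r / 2),
        ‖fderiv ℂ (f n) z - fderiv ℂ (f m) z‖ ≤ (2 * C * ‖F n - F m‖) / (r / 2) := by
      intro n m z hz
      have hzb : ball z (r / 2) ⊆ ball z₀ r := by
        intro w hw
        rw [mem_ball] at *
        linarith [dist_triangle w z z₀]
      rw [← fderiv_fun_sub (hat n z (hsub hz)) (hat m z (hsub hz))]
      refine Complex.norm_fderiv_le_div_of_mapsTo_ball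
        (((hf n).sub (hf m)).mono (hzb.trans hb)) ?_ (half_pos hr)
      intro w hw
      rw [mem_closedBall, dist_eq_norm]
      have h1 := hC n m w (hzb hw)
      have h2 := hC n m z (hzb (mem_ball_self (half_pos hr)))
      refine (norm_sub_le _ _).trans ?_
      linarith
    have huc : UniformCauchySeqOn (fun n => fderiv ℂ (f n)) atTop (ball z₀ (r / 2)) := by
      rw [Metric.uniformCauchySeqOn_iff]
      intro ε hε
      rw [Metric.cauchySeq_iff] at hcau
      obtain ⟨N, hN⟩ := hcau (ε * (r / 2) / (2 * C + 1)) (by positivity)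
      refine ⟨N, fun n hn m hm z hz => ?_⟩
      rw [dist_eq_norm]
      refine (hfd n m z hz).trans_lt ?_
      have h1 := hN n hn m hm
      rw [dist_eq_norm, lt_div_iff₀ (by positivity)] at h1
      rw [div_lt_iff₀ (by positivity)]
      nlinarith [norm_nonneg (F n - F m)]
    choose! g' hg' using fun z (hz : z ∈ ball z₀ (r / 2)) =>
      cauchySeq_tendsto_of_complete (huc.cauchySeq hz)
    have := hasFDerivAt_of_tendstoUniformlyOn isOpen_ball
      (huc.tendstoUniformlyOn_of_tendsto hg')
      (fun n z hz => (hat n z (hsub hz)).hasFDerivAt) (fun z hz => hg z (hsub hz))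
      (mem_ball_self (half_pos hr))
    exact this.differentiableAt.differentiableWithinAt
  refine ⟨g, hdiff, ?_⟩
  obtain ⟨φ, hφ, hae⟩ := (tendstoInMeasure_of_tendsto_Lp hG).exists_seq_tendsto_ae
  have hΩae : ∀ᵐ z ∂(weightedVolume Ω μ), z ∈ Ω :=
    (withDensity_absolutelyContinuous _ _).ae_le (ae_restrict_mem hΩ.measurableSet)
  filter_upwards [hae, ae_all_iff.2 hFf, hΩae] with z h1 h2 h3
  refine tendsto_nhds_unique h1 ?_
  simp only [h2]
  exact (hg z h3).comp hφ.tendsto_atTop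

/-- The weighted Bergman projection `𝓑_{Ω,μ}`: the orthogonal projection of `L²(Ω, μ)` onto the
closed subspace `A²(Ω, μ)`. -/
noncomputable def bergmanProjection (Ω : Set (ℂ × ℂ)) (μ : ℂ × ℂ → ℝ)
    [(bergmanSpace Ω μ).HasOrthogonalProjection] :
    Lp ℂ 2 (weightedVolume Ω μ) →L[ℂ] Lp ℂ 2 (weightedVolume Ω μ) :=
  (bergmanSpace Ω μ).starProjection

/-- `𝓑_{Ω,μ}` is `L^p(Ω, μ)` bounded: there is a finite constant `C` with
`‖𝓑 f‖_{L^p(Ω,μ)} ≤ C ‖f‖_{L^p(Ω,μ)}` for all `f ∈ L²(Ω, μ) ∩ L^p(Ω, μ)`. -/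
def BergmanProjectionLpBounded (Ω : Set (ℂ × ℂ)) (μ : ℂ × ℂ → ℝ)
    [(bergmanSpace Ω μ).HasOrthogonalProjection] (p : ℝ) : Prop :=
  ∃ C : ℝ≥0, ∀ f : Lp ℂ 2 (weightedVolume Ω μ),
    MemLp f (ENNReal.ofReal p) (weightedVolume Ω μ) →
      eLpNorm (bergmanProjection Ω μ f) (ENNReal.ofReal p) (weightedVolume Ω μ)
        ≤ C * eLpNorm f (ENNReal.ofReal p) (weightedVolume Ω μ)

/-- The Hartogs triangle `{(z₁, z₂) ∈ ℂ² : |z₁| < |z₂| < 1}`. -/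
def hartogsTriangle : Set (ℂ × ℂ) := {z | ‖z.1‖ < ‖z.2‖ ∧ ‖z.2‖ < 1}

/-- The weight `|z₂|^{s'}`. -/
noncomputable def hartogsWeight (s' : ℝ) (z : ℂ × ℂ) : ℝ := ‖z.2‖ ^ s'

theorem isOpen_hartogsTriangle : IsOpen hartogsTriangle :=
  (isOpen_lt continuous_fst.norm continuous_snd.norm).inter
    (isOpen_lt continuous_snd.norm continuous_const)

instance instHasOrthogonalProjectionHartogs (s' : ℝ) :
    (bergmanSpace hartogsTriangle (hartogsWeight s')).HasOrthogonalProjection := by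
  have hpos : ∀ z ∈ hartogsTriangle, 0 < ‖z.2‖ := fun z hz => (norm_nonneg _).trans_lt hz.1
  have hc : IsClosed (bergmanSpace hartogsTriangle (hartogsWeight s') :
      Set (Lp ℂ 2 (weightedVolume hartogsTriangle (hartogsWeight s')))) := by
    refine isClosed_bergmanSpace isOpen_hartogsTriangle ?_ fun z hz => Real.rpow_pos_of_pos (hpos z hz) _
    exact ContinuousOn.rpow_const (by fun_prop) fun z hz => Or.inl (hpos z hz).ne'
  have : CompleteSpace (bergmanSpace hartogsTriangle (hartogsWeight s')) :=
    hc.isComplete.completeSpace_coe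
  infer_instance

end HartogsBergman

namespace HartogsBergman

open MeasureTheory Set Metric Filter Topology
open scoped ENNReal NNReal ComplexConjugate Real

/-! The map (w₁, w₂) ↦ (w₁w₂, w₂) carries 𝔻 × (𝔻∖{0}) onto the Hartogs triangle with Jacobian |w₂|²,
so the weighted volume becomes dA × |w|^(s'+2) dA. Write s' + 2 = 2c - 2 - 2m with 0 < c ≤ 1 and m
an integer; in the notation of the theorem c = s/2 and m = -k-2. The square-integrable holomorphic
functions on the punctured disk with this weight have the orthogonal basis w^(j+m), j ≥ 0, and
w^(j+m) has squared norm π/(j+c). With x = wζ̄, the kernel is therefore x^m (c + (1-c)x) /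
(π(1-x)²). The kernel of the Hartogs triangle is the product of this one and the unweighted disk
kernel, and the projection is integration against it (`bergmanProjection_ae_eq`).

The boundary behaviour is that of the ordinary Bergman kernel, which requires exactly p > 1. The
extra restrictions come from w₂ = 0, where the kernel behaves like (wζ̄)^m. Boundedness requires w^m
to lie in L^p, since it occurs in the range, and in the dual space L^q, since one integrates against
it. In the weight |w|^(2c-2-2m) these conditions read mp + (2c-2m) > 0 and mp + (2c-2m)(p-1) > 0.

Sufficiency (`bergmanProjectionLpBounded_of_lt`) is a Schur test with test functions
(1-|w|)^(-ε)|w|^(-b) in each factor, based on a radial Forelli–Rudin estimate. For necessity the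
operator is tested on tensor products (`eLpNorm_diskOperator_mul_le`). Truncated powers ζ^m|ζ|^τ are
sent to multiples of w^m and yield both integrability conditions. For p = 1, normalised indicators
of disks approaching the boundary have images whose L¹ norms grow logarithmically
(`not_bounded_one`).

The five ranges of s' then follow from the signs of k+2 and s+k+2 in p(k+2) < s+2k+4 < p(s+k+2). -/

/-! ### Power weights on the disk in polar coordinates. -/

/-- The measure `|w|^t dA` on the unit disk. -/
noncomputable def diskMeasure (t : ℝ) : Measure ℂ :=
  (volume.restrict (ball 0 1)).withDensity fun w => ENNReal.ofReal (‖w‖ ^ t)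

/-- The measure `r^(t+1) dr` on `(0, 1)`, the radial part of `diskMeasure t`. -/
noncomputable def radialMeasure (t : ℝ) : Measure ℝ :=
  (volume.restrict (Ioo 0 1)).withDensity fun r => ENNReal.ofReal (r ^ (t + 1))

instance (t : ℝ) : SFinite (diskMeasure t) := by unfold diskMeasure; infer_instance

instance (t : ℝ) : SFinite (radialMeasure t) := by unfold radialMeasure; infer_instance

theorem lintegral_diskMeasure (t : ℝ) (F : ℂ → ℝ≥0∞) :
    ∫⁻ w, F w ∂(diskMeasure t) = ∫⁻ w in ball 0 1, ENNReal.ofReal (‖w‖ ^ t) * F w := by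
  rw [diskMeasure, lintegral_withDensity_eq_lintegral_mul_non_measurable _ (by fun_prop)
    (by simp)]
  rfl

theorem lintegral_radialMeasure (t : ℝ) (F : ℝ → ℝ≥0∞) :
    ∫⁻ r, F r ∂(radialMeasure t) = ∫⁻ r in Ioo 0 1, ENNReal.ofReal (r ^ (t + 1)) * F r := by
  rw [radialMeasure, lintegral_withDensity_eq_lintegral_mul_non_measurable _ (by fun_prop)
    (by simp)]
  rfl

theorem integral_radialMeasure {E : Type*} [NormedAddCommGroup E] [NormedSpace ℝ E] (t : ℝ)
    (F : ℝ → E) :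
    ∫ r, F r ∂(radialMeasure t) = ∫ r in Ioo 0 1, r ^ (t + 1) • F r := by
  rw [radialMeasure, integral_withDensity_eq_integral_toReal_smul (by fun_prop) (by simp)]
  refine setIntegral_congr_fun measurableSet_Ioo fun r hr => ?_
  rw [ENNReal.toReal_ofReal (Real.rpow_nonneg hr.1.le _)]

theorem ae_diskMeasure_mem (t : ℝ) : ∀ᵐ w ∂(diskMeasure t), w ∈ ball (0 : ℂ) 1 ∧ w ≠ 0 := by
  refine (withDensity_absolutelyContinuous _ _).ae_le ?_
  refine (ae_restrict_mem measurableSet_ball).and ?_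
  exact ae_restrict_of_ae (Measure.ae_ne volume 0)

theorem ae_radialMeasure_mem (t : ℝ) : ∀ᵐ r ∂(radialMeasure t), r ∈ Ioo (0 : ℝ) 1 :=
  (withDensity_absolutelyContinuous _ _).ae_le (ae_restrict_mem measurableSet_Ioo)

theorem lintegral_diskMeasure_polar (t : ℝ) {F : ℂ → ℝ≥0∞} (hF : Measurable F) :
    ∫⁻ w, F w ∂(diskMeasure t)
      = ∫⁻ r, ∫⁻ θ in Ioo (-π) π, F (circleMap 0 r θ) ∂volume ∂(radialMeasure t) := by
  have hc : Measurable fun p : ℝ × ℝ => circleMap 0 p.1 p.2 := by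
    unfold circleMap; fun_prop
  have hsymm : ∀ p : ℝ × ℝ, Complex.polarCoord.symm p = circleMap 0 p.1 p.2 := fun p => by
    simp [circleMap, Complex.exp_mul_I]
  rw [lintegral_diskMeasure, ← lintegral_indicator measurableSet_ball,
    ← Complex.lintegral_comp_polarCoord_symm, lintegral_radialMeasure]
  have : polarCoord.target = Ioi (0 : ℝ) ×ˢ Ioo (-π) π := rfl
  rw [this, Measure.volume_eq_prod, ← Measure.prod_restrict, lintegral_prod]
  · rw [← lintegral_indicator measurableSet_Ioo, ← lintegral_indicator measurableSet_Ioi]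
    refine lintegral_congr fun r => ?_
    by_cases h0 : 0 < r
    · by_cases h1 : r < 1
      · rw [indicator_of_mem (by exact h0), indicator_of_mem (by exact ⟨h0, h1⟩),
          ← lintegral_const_mul' _ _ ENNReal.ofReal_ne_top]
        refine lintegral_congr fun θ => ?_
        have hn : ‖circleMap 0 r θ‖ = r := by simp [abs_of_pos h0]
        rw [hsymm, indicator_of_mem (by simpa [abs_of_pos h0] using h1), hn, smul_eq_mul,
          ← mul_assoc, ← ENNReal.ofReal_mul h0.le, Real.rpow_add h0, Real.rpow_one, mul_comm r]
      · rw [indicator_of_mem (by exact h0), indicator_of_notMem (by simp [h1])]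
        simp only [hsymm]
        refine (lintegral_congr fun θ => ?_).trans lintegral_zero
        rw [indicator_of_notMem (by simpa [abs_of_pos h0] using h1), smul_zero]
    · rw [indicator_of_notMem (by simpa using h0), indicator_of_notMem (by simp [h0])]
  · refine Measurable.aemeasurable ?_
    simp only [hsymm]
    have hm : Measurable ((ball (0 : ℂ) 1).indicator fun a => ENNReal.ofReal (‖a‖ ^ t) * F a) :=
      Measurable.indicator (by fun_prop) measurableSet_ball
    exact (by fun_prop : Measurable fun p : ℝ × ℝ => ENNReal.ofReal p.1).smul (hm.comp hc)

/-- In this form polar coordinates also transfer integrability and Bochner integrals, not only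
integrals of nonnegative functions. -/
theorem measurePreserving_circleMap (t : ℝ) :
    MeasurePreserving (fun p : ℝ × ℝ => circleMap 0 p.1 p.2)
      ((radialMeasure t).prod (volume.restrict (Ioo (-π) π))) (diskMeasure t) := by
  have hc : Measurable fun p : ℝ × ℝ => circleMap 0 p.1 p.2 := by
    unfold circleMap; fun_prop
  refine ⟨hc, Measure.ext fun s hs => ?_⟩
  rw [← lintegral_indicator_one hs, ← lintegral_indicator_one hs, lintegral_map
    (measurable_one.indicator hs) hc, lintegral_prod (fun p : ℝ × ℝ => s.indicator 1 (circleMap 0 p.1 p.2))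
    ((measurable_one.indicator hs).comp hc).aemeasurable,
    lintegral_diskMeasure_polar _ (measurable_one.indicator hs)]

theorem integral_Ioo_circleMap (f : ℂ → ℂ) (r : ℝ) :
    ∫ θ in Ioo (-π) π, f (circleMap 0 r θ) = (2 * π) * Real.circleAverage f 0 r := by
  have hp : (fun θ => f (circleMap 0 r θ)).Periodic (2 * π) := fun x => by
    simp [periodic_circleMap 0 r x]
  have := hp.intervalIntegral_add_eq (-π) 0
  rw [Real.circleAverage_def, ← integral_Ioc_eq_integral_Ioo,
    ← intervalIntegral.integral_of_le (by linarith [Real.pi_pos])]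
  rw [zero_add, show -π + 2 * π = π by ring] at this
  rw [this, Complex.real_smul]
  have := Real.pi_ne_zero
  push_cast
  field_simp

theorem integral_diskMeasure_polar {t : ℝ} {f : ℂ → ℂ} (hf : Integrable f (diskMeasure t)) :
    ∫ w, f w ∂(diskMeasure t)
      = ∫ r in Ioo 0 1, r ^ (t + 1) • ((2 * π) * Real.circleAverage f 0 r) := by
  have h := measurePreserving_circleMap t
  rw [← h.map_eq, integral_map h.measurable.aemeasurable (by rw [h.map_eq]; exact hf.1),
    integral_prod (fun p : ℝ × ℝ => f (circleMap 0 p.1 p.2))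
      ((h.integrable_comp hf.1).2 hf), integral_radialMeasure]
  simp only [integral_Ioo_circleMap]

/-- Up to the factor 1 - |w|²r², the integrand is a Poisson kernel: it is the real part of
(1+x)/(1-x) with x = w̄z. This function is holomorphic on the closed disk of radius r and equals 1
at the centre, so its circle average is 1. -/
theorem lintegral_circle_kernel {w : ℂ} {r : ℝ} (hr : 0 ≤ r) (hw : ‖w‖ * r < 1) :
    ∫⁻ θ in Ioo (-π) π, ‖1 - w * conj (circleMap 0 r θ)‖ₑ⁻¹ ^ 2
      = ENNReal.ofReal (2 * π / (1 - ‖w‖ ^ 2 * r ^ 2)) := by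
  have hlt : ∀ z : ℂ, ‖z‖ ≤ r → ‖conj w * z‖ < 1 := fun z hz => by
    rw [norm_mul, RCLike.norm_conj]
    exact (mul_le_mul_of_nonneg_left hz (norm_nonneg _)).trans_lt hw
  have hne : ∀ z : ℂ, ‖z‖ < 1 → 1 - z ≠ 0 := fun z hz h => by
    rw [sub_eq_zero] at h; rw [← h] at hz; simp at hz
  set h : ℂ → ℂ := fun z => (1 + conj w * z) / (1 - conj w * z) with hh
  have hd : DifferentiableOn ℂ h (closedBall 0 r) := by
    refine DifferentiableOn.div (by fun_prop) (by fun_prop) fun z hz => hne _ (hlt z ?_)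
    simpa using hz
  have hav : Real.circleAverage h 0 r = 1 := by
    rcases hr.eq_or_lt with rfl | hr0
    · simp [hh]
    have hd' : DiffContOnCl ℂ h (ball 0 |r|) := by
      refine DifferentiableOn.diffContOnCl ?_
      rw [abs_of_nonneg hr, closure_ball _ hr0.ne']
      exact hd
    rw [hd'.circleAverage]; simp [hh]
  have hx : 0 < 1 - ‖w‖ ^ 2 * r ^ 2 := by
    have : 0 ≤ ‖w‖ * r := by positivity
    nlinarith
  have hcont : Continuous fun θ => h (circleMap 0 r θ) := by
    refine hd.continuousOn.comp_continuous (continuous_circleMap 0 r) fun θ => ?_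
    simp [abs_of_nonneg hr]
  have hre : ∀ θ, (h (circleMap 0 r θ)).re
      = (1 - ‖w‖ ^ 2 * r ^ 2) * (‖1 - w * conj (circleMap 0 r θ)‖⁻¹ ^ 2) := fun θ => by
    set z := circleMap 0 r θ
    have hz : ‖z‖ = r := by simp [z, abs_of_nonneg hr]
    have e : ‖1 - w * conj z‖ = ‖1 - conj w * z‖ := by
      rw [← RCLike.norm_conj (1 - w * conj z)]; simp
    have hn : ‖w‖ ^ 2 * r ^ 2 = Complex.normSq (conj w * z) := by
      rw [Complex.normSq_eq_norm_sq, norm_mul, RCLike.norm_conj, hz]; ring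
    rw [e, hn, inv_pow, ← Complex.normSq_eq_norm_sq, hh]
    simp only [Complex.div_re, Complex.add_re, Complex.sub_re, Complex.one_re, Complex.add_im,
      Complex.sub_im, Complex.one_im, Complex.normSq_apply (conj w * z)]
    ring
  have key : ∫ θ in Ioo (-π) π, ‖1 - w * conj (circleMap 0 r θ)‖⁻¹ ^ 2
      = 2 * π / (1 - ‖w‖ ^ 2 * r ^ 2) := by
    have h1 := integral_Ioo_circleMap h r
    rw [hav] at h1
    have hi : Integrable (fun θ => h (circleMap 0 r θ)) (volume.restrict (Ioo (-π) π)) :=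
      (hcont.integrableOn_Icc (a := -π) (b := π)).mono_set Ioo_subset_Icc_self
    have h2 := congrArg Complex.re h1
    rw [← RCLike.re_eq_complex_re, ← integral_re hi] at h2
    simp only [RCLike.re_eq_complex_re, hre, integral_const_mul] at h2
    rw [eq_div_iff hx.ne', mul_comm, h2]
    simp
  rw [← key, ofReal_integral_eq_lintegral_ofReal]
  · refine lintegral_congr fun θ => ?_
    have hz : 1 - w * conj (circleMap 0 r θ) ≠ 0 := by
      refine hne _ ?_
      simpa [abs_of_nonneg hr] using hw
    rw [ENNReal.ofReal_pow (by positivity), ENNReal.ofReal_inv_of_pos (by simpa using hz),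
      ofReal_norm]
  · have : ∀ θ, ‖1 - w * conj (circleMap 0 r θ)‖⁻¹ ^ 2
        = (1 - ‖w‖ ^ 2 * r ^ 2)⁻¹ * (h (circleMap 0 r θ)).re := fun θ => by
      rw [hre, inv_mul_cancel_left₀ hx.ne']
    simp only [this]
    refine Integrable.const_mul ?_ _
    exact ((Complex.continuous_re.comp hcont).integrableOn_Icc (a := -π) (b := π)).mono_set
      Ioo_subset_Icc_self
  · exact Eventually.of_forall fun θ => by positivity

theorem lintegral_radial_mul_kernel (t : ℝ) {φ : ℝ → ℝ≥0∞} (hφ : Measurable φ) {w : ℂ}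
    (hw : ‖w‖ ≤ 1) :
    ∫⁻ ζ, φ ‖ζ‖ * ‖1 - w * conj ζ‖ₑ⁻¹ ^ 2 ∂(diskMeasure t)
      = ∫⁻ r, φ r * ENNReal.ofReal (2 * π / (1 - ‖w‖ ^ 2 * r ^ 2)) ∂(radialMeasure t) := by
  have hconj : Measurable (fun z : ℂ => conj z) := Complex.continuous_conj.measurable
  rw [lintegral_diskMeasure_polar _ (by fun_prop)]
  refine lintegral_congr_ae ?_
  filter_upwards [ae_radialMeasure_mem t] with r hr
  have : ∀ θ, ‖circleMap 0 r θ‖ = r := fun θ => by simp [abs_of_pos hr.1]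
  simp only [this]
  rw [lintegral_const_mul _ (by unfold circleMap; fun_prop), lintegral_circle_kernel hr.1.le]
  nlinarith [hr.1, hr.2, norm_nonneg w]

theorem lintegral_radial (t : ℝ) {φ : ℝ → ℝ≥0∞} (hφ : Measurable φ) :
    ∫⁻ ζ, φ ‖ζ‖ ∂(diskMeasure t)
      = ENNReal.ofReal (2 * π) * ∫⁻ r in Ioo 0 1, ENNReal.ofReal (r ^ (t + 1)) * φ r := by
  have := lintegral_radial_mul_kernel t hφ (w := 0) (by simp)
  simp only [zero_mul, sub_zero, enorm_one, inv_one, one_pow, mul_one, norm_zero, ne_eq,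
    OfNat.ofNat_ne_zero, not_false_eq_true, zero_pow, div_one] at this
  rw [this, lintegral_mul_const _ hφ, mul_comm, lintegral_radialMeasure]

theorem lintegral_norm_rpow_lt_top_iff {t a : ℝ} :
    ∫⁻ ζ, ENNReal.ofReal (‖ζ‖ ^ a) ∂(diskMeasure t) < ∞ ↔ -2 < t + a := by
  rw [lintegral_radial t (φ := fun r => ENNReal.ofReal (r ^ a)) (by fun_prop)]
  have e : ∫⁻ r in Ioo (0 : ℝ) 1, ENNReal.ofReal (r ^ (t + 1)) * ENNReal.ofReal (r ^ a)
      = ∫⁻ r in Ioo (0 : ℝ) 1, ‖r ^ (t + 1 + a)‖ₑ := by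
    refine setLIntegral_congr_fun measurableSet_Ioo fun r hr => ?_
    rw [← ENNReal.ofReal_mul (Real.rpow_nonneg hr.1.le _), ← Real.rpow_add hr.1,
      Real.enorm_of_nonneg (Real.rpow_nonneg hr.1.le _)]
  rw [e]
  have h1 : IntegrableOn (fun r : ℝ => r ^ (t + 1 + a)) (Ioo 0 1) ↔ -1 < t + 1 + a :=
    intervalIntegral.integrableOn_Ioo_rpow_iff one_pos
  have h2 : IntegrableOn (fun r : ℝ => r ^ (t + 1 + a)) (Ioo 0 1) ↔
      ∫⁻ r in Ioo (0 : ℝ) 1, ‖r ^ (t + 1 + a)‖ₑ < ∞ :=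
    ⟨fun h => h.2, fun h => ⟨by fun_prop, h⟩⟩
  have hpi : ENNReal.ofReal (2 * π) ≠ 0 := by simp [Real.pi_pos]
  refine Iff.trans ⟨fun h => ?_, fun h => ENNReal.mul_lt_top ENNReal.ofReal_lt_top h⟩
    (h2.symm.trans (h1.trans ⟨fun h => by linarith, fun h => by linarith⟩))
  exact ENNReal.lt_top_of_mul_ne_top_right h.ne hpi

theorem integral_diskMeasure {E : Type*} [NormedAddCommGroup E] [NormedSpace ℝ E] (t : ℝ)
    (F : ℂ → E) : ∫ w, F w ∂(diskMeasure t) = ∫ w in ball 0 1, ‖w‖ ^ t • F w := by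
  rw [diskMeasure, integral_withDensity_eq_integral_toReal_smul (by fun_prop) (by simp)]
  refine setIntegral_congr_fun measurableSet_ball fun r hr => ?_
  simp only [ENNReal.toReal_ofReal (Real.rpow_nonneg (norm_nonneg r) _)]

theorem isFiniteMeasure_diskMeasure {t : ℝ} (ht : -2 < t) : IsFiniteMeasure (diskMeasure t) := by
  refine ⟨?_⟩
  have := (lintegral_norm_rpow_lt_top_iff (t := t) (a := 0)).2 (by simpa using ht)
  simpa using this

/-! ### The reproducing kernel of the weighted punctured disk. -/

/-- The function `Σ (j + c) x^j`, in closed form. -/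
noncomputable def symbol (c : ℝ) (x : ℂ) : ℂ := (c + (1 - c) * x) / (1 - x) ^ 2

/-- The Bergman kernel of the punctured disk with weight `|w|^(2c-2-2m)`, for `0 < c ≤ 1`. -/
noncomputable def diskKernel (c : ℝ) (m : ℤ) (w ζ : ℂ) : ℂ :=
  (π : ℂ)⁻¹ * (w * conj ζ) ^ m * symbol c (w * conj ζ)

theorem one_sub_ne_zero {z : ℂ} (hz : ‖z‖ < 1) : 1 - z ≠ 0 := fun h => by
  rw [sub_eq_zero] at h; rw [← h] at hz; simp at hz

theorem norm_mul_conj_lt {w ζ : ℂ} (hw : w ∈ ball (0 : ℂ) 1) (hζ : ζ ∈ ball (0 : ℂ) 1) :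
    ‖w * conj ζ‖ < 1 := by
  simp only [mem_ball, dist_zero_right] at hw hζ
  rw [norm_mul, RCLike.norm_conj]
  nlinarith [norm_nonneg w, norm_nonneg ζ]

/-- The numerator is a convex combination of 1 and x, hence bounded by 1. -/
theorem norm_symbol_le {c : ℝ} (h0 : 0 ≤ c) (h1 : c ≤ 1) {x : ℂ} (hx : ‖x‖ ≤ 1) :
    ‖symbol c x‖ ≤ ‖1 - x‖⁻¹ ^ 2 := by
  have : ‖(c + (1 - c) * x : ℂ)‖ ≤ 1 := by
    calc ‖(c + (1 - c) * x : ℂ)‖ ≤ ‖(c : ℂ)‖ + ‖((1 - c : ℝ) : ℂ) * x‖ := by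
          push_cast; exact norm_add_le _ _
      _ ≤ c + (1 - c) * 1 := by
          rw [norm_mul, Complex.norm_of_nonneg h0, Complex.norm_of_nonneg (by linarith)]
          gcongr
      _ = 1 := by ring
  rw [symbol, norm_div, norm_pow, inv_pow, div_eq_mul_inv]
  exact mul_le_of_le_one_left (by positivity) this

theorem norm_symbol_le_of_norm_le {c : ℝ} (h0 : 0 ≤ c) (h1 : c ≤ 1) {x : ℂ} {ρ : ℝ}
    (hx : ‖x‖ ≤ ρ) (hρ : ρ < 1) : ‖symbol c x‖ ≤ (1 - ρ)⁻¹ ^ 2 := by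
  refine (norm_symbol_le h0 h1 (hx.trans hρ.le)).trans ?_
  have : 1 - ρ ≤ ‖1 - x‖ := by
    have := norm_sub_norm_le (1 : ℂ) x
    rw [norm_one] at this
    linarith
  have h2 : 0 < 1 - ρ := by linarith
  gcongr

theorem measurable_conj : Measurable (fun z : ℂ => conj z) := Complex.continuous_conj.measurable

@[fun_prop]
theorem measurable_symbol (c : ℝ) : Measurable (symbol c) := by unfold symbol; fun_prop

theorem measurable_diskKernel (c : ℝ) (m : ℤ) :
    Measurable fun p : ℂ × ℂ => diskKernel c m p.1 p.2 := by
  have h : Measurable fun p : ℂ × ℂ => p.1 * conj p.2 :=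
    measurable_fst.mul (measurable_conj.comp measurable_snd)
  unfold diskKernel
  exact ((h.pow_const m).const_mul _).mul ((measurable_symbol c).comp h)

theorem differentiableAt_symbol (c : ℝ) {x : ℂ} (hx : ‖x‖ < 1) :
    DifferentiableAt ℂ (symbol c) x := by
  unfold symbol
  exact DifferentiableAt.div (by fun_prop) (by fun_prop) (pow_ne_zero _ (one_sub_ne_zero hx))

/-- On |ζ| = r one has ζ̄ = r²/ζ, so wζ̄ = v/ζ with v = r²w and the symbol becomes ζ(cζ +
(1-c)v)/(ζ-v)². The average is then Cauchy's formula for the derivative at v of g(ζ)(cζ + (1-c)v).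
-/
theorem circleAverage_symbol_mul {c : ℝ} {g : ℂ → ℂ} (hg : DifferentiableOn ℂ g (ball 0 1))
    {w : ℂ} (hw : w ∈ ball (0 : ℂ) 1) {r : ℝ} (hr : r ∈ Ioo (0 : ℝ) 1) :
    Real.circleAverage (fun ζ => symbol c (w * conj ζ) * g ζ) 0 r
      = deriv g (r ^ 2 * w) * (r ^ 2 * w) + c * g (r ^ 2 * w) := by
  have hw' : ‖w‖ < 1 := by simpa using hw
  set v : ℂ := r ^ 2 * w with hv
  have hvn : ‖v‖ < r := by
    rw [hv, norm_mul, norm_pow, Complex.norm_of_nonneg hr.1.le]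
    nlinarith [norm_nonneg w, hr.1, hr.2, mul_pos hr.1 hr.1]
  have hvb : v ∈ ball (0 : ℂ) r := by simpa using hvn
  have hg1 : DifferentiableAt ℂ g v :=
    hg.differentiableAt (isOpen_ball.mem_nhds (by simpa using hvn.trans hr.2))
  have hH : DifferentiableOn ℂ (fun ζ => g ζ * (c * ζ + (1 - c) * v)) (ball 0 1) :=
    hg.mul (by fun_prop)
  have h := Complex.two_pi_I_inv_smul_circleIntegral_sub_sq_inv_smul_of_differentiable isOpen_ball
    (closedBall_subset_ball hr.2) hH hvb
  have hder : deriv (fun ζ => g ζ * (c * ζ + (1 - c) * v)) v = deriv g v * v + c * g v := by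
    have h1 : HasDerivAt (fun ζ : ℂ => c * ζ + (1 - c) * v) (c : ℂ) v := by
      simpa using ((hasDerivAt_id v).const_mul (c : ℂ)).add_const ((1 - c) * v)
    exact (hg1.hasDerivAt.mul h1).deriv.trans (by ring)
  rw [hder] at h
  rw [← h, Real.circleAverage_eq_circleIntegral hr.1.ne']
  congr 1
  refine circleIntegral.integral_congr hr.1.le fun ζ hζ => ?_
  have hζn : ‖ζ‖ = r := by simpa using hζ
  have hζ0 : ζ ≠ 0 := by rw [← norm_pos_iff, hζn]; exact hr.1
  have hc : conj ζ = r ^ 2 / ζ := by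
    rw [eq_div_iff hζ0, mul_comm, Complex.mul_conj, Complex.normSq_eq_norm_sq, hζn]; simp
  have hne : ζ - v ≠ 0 := fun h0 => by
    rw [sub_eq_zero] at h0; rw [← h0, hζn] at hvn; exact lt_irrefl _ hvn
  have e : w * conj ζ = v / ζ := by rw [hc, hv]; ring
  simp only [smul_eq_mul, symbol, e, sub_zero]
  have : 1 - v / ζ ≠ 0 := by
    rw [one_sub_div hζ0]; exact div_ne_zero hne hζ0
  rw [one_sub_div hζ0]
  field_simp

theorem integrable_symbol_mul {c : ℝ} (h0 : 0 ≤ c) (h1 : c ≤ 1) {t : ℝ} {g : ℂ → ℂ}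
    (hg : Integrable g (diskMeasure t)) {w : ℂ} (hw : w ∈ ball (0 : ℂ) 1) :
    Integrable (fun ζ => symbol c (w * conj ζ) * g ζ) (diskMeasure t) := by
  have hw' : ‖w‖ < 1 := by simpa using hw
  refine hg.bdd_mul (c := (1 - ‖w‖)⁻¹ ^ 2)
    ((measurable_symbol c).comp (measurable_conj.const_mul w)).aestronglyMeasurable ?_
  filter_upwards [ae_diskMeasure_mem t] with ζ hζ
  refine norm_symbol_le_of_norm_le h0 h1 ?_ hw'
  rw [norm_mul, RCLike.norm_conj]
  have : ‖ζ‖ < 1 := by simpa using hζ.1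
  exact mul_le_of_le_one_right (norm_nonneg _) this.le

/-- By the circle averages, the radial integrand is π times the derivative of r^(2c) g(r²w). The
fundamental theorem of calculus on [0, 1] leaves π g(w); the boundary term at 0 vanishes because c >
0. -/
theorem integral_symbol_mul {c : ℝ} (h0 : 0 < c) (h1 : c ≤ 1) {g : ℂ → ℂ}
    (hg : DifferentiableOn ℂ g (ball 0 1)) (hgi : Integrable g (diskMeasure (2 * c - 2)))
    {w : ℂ} (hw : w ∈ ball (0 : ℂ) 1) :
    ∫ ζ, symbol c (w * conj ζ) * g ζ ∂(diskMeasure (2 * c - 2)) = π * g w := by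
  have hw' : ‖w‖ < 1 := by simpa using hw
  rw [integral_diskMeasure_polar (integrable_symbol_mul h0.le h1 hgi hw)]
  have hmem : ∀ r ∈ Icc (0 : ℝ) 1, (r ^ 2 * w : ℂ) ∈ ball (0 : ℂ) 1 := fun r hr => by
    have : ‖(r ^ 2 * w : ℂ)‖ ≤ ‖w‖ := by
      rw [norm_mul, norm_pow, Complex.norm_of_nonneg hr.1]
      exact mul_le_of_le_one_left (norm_nonneg _) (pow_le_one₀ hr.1 hr.2)
    simpa using this.trans_lt hw'
  have hcg : ContinuousOn (fun r : ℝ => g (r ^ 2 * w)) (Icc 0 1) :=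
    hg.continuousOn.comp (by fun_prop) hmem
  have hcd : ContinuousOn (fun r : ℝ => deriv g (r ^ 2 * w)) (Icc 0 1) :=
    (hg.deriv isOpen_ball).continuousOn.comp (by fun_prop) hmem
  set F' : ℝ → ℂ := fun r => r ^ (2 * c - 1) •
    (2 * (deriv g (r ^ 2 * w) * (r ^ 2 * w) + c * g (r ^ 2 * w))) with hF'
  have hint : IntervalIntegrable F' volume 0 1 := by
    refine (intervalIntegral.intervalIntegrable_rpow' (by linarith)).smul_continuousOn ?_
    rw [uIcc_of_le zero_le_one]
    exact continuousOn_const.mul ((hcd.mul (by fun_prop)).add (continuousOn_const.mul hcg))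
  have hftc : ∫ r in (0 : ℝ)..1, F' r = (1 : ℝ) ^ (2 * c) • g ((1 : ℝ) ^ 2 * w)
      - (0 : ℝ) ^ (2 * c) • g ((0 : ℝ) ^ 2 * w) := by
    refine intervalIntegral.integral_eq_sub_of_hasDerivAt_of_le
      (f := fun r : ℝ => r ^ (2 * c) • g (r ^ 2 * w)) zero_le_one ?_ ?_ hint
    · exact (Real.continuous_rpow_const (by linarith)).continuousOn.smul hcg
    · intro r hr
      have hgd : HasDerivAt g (deriv g (r ^ 2 * w)) (r ^ 2 * w) :=
        (hg.differentiableAt (isOpen_ball.mem_nhds (hmem r ⟨hr.1.le, hr.2.le⟩))).hasDerivAt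
      have hi : HasDerivAt (fun r : ℝ => ((r : ℂ) ^ 2 * w)) (2 * r * w) r := by
        have := ((hasDerivAt_id (r : ℂ)).pow 2).mul_const w
        simpa using this.comp_ofReal
      have hd : HasDerivAt (fun r : ℝ => r ^ (2 * c) • g (r ^ 2 * w)) _ r :=
        (Real.hasDerivAt_rpow_const (x := r) (p := 2 * c) (Or.inl hr.1.ne')).smul
          (hgd.scomp r hi)
      refine hd.congr_deriv ?_
      have e : r ^ (2 * c) = r ^ (2 * c - 1) * r := by
        rw [← Real.rpow_add_one hr.1.ne']; ring_nf
      simp only [hF', Complex.real_smul, smul_eq_mul, e]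
      push_cast
      ring
  rw [intervalIntegral.integral_of_le zero_le_one, integral_Ioc_eq_integral_Ioo] at hftc
  have hπ : ∫ r in Ioo (0 : ℝ) 1, r ^ (2 * c - 2 + 1) •
      ((2 * π : ℂ) * Real.circleAverage (fun ζ => symbol c (w * conj ζ) * g ζ) 0 r)
      = ∫ r in Ioo (0 : ℝ) 1, (π : ℂ) * F' r := by
    refine setIntegral_congr_fun measurableSet_Ioo fun r hr => ?_
    simp only [hF']
    rw [circleAverage_symbol_mul hg hw hr, show 2 * c - 2 + 1 = 2 * c - 1 by ring,
      Complex.real_smul, Complex.real_smul]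
    ring
  rw [hπ, integral_const_mul, hftc, Real.zero_rpow (by linarith)]
  simp

/-- This follows from the two-variable inequality applied to a function of the first coordinate
alone: balls of ℂ × ℂ in the sup norm are products, so the area of the second disk cancels. -/
theorem volume_mul_enorm_le_setLIntegral_ball {g : ℂ → ℂ} {z : ℂ} {r : ℝ} (hr : 0 < r)
    (hg : DifferentiableOn ℂ g (ball z r)) :
    volume (ball (0 : ℂ) r) * ‖g z‖ₑ ≤ ∫⁻ w in ball z r, ‖g w‖ₑ := by
  have hV0 : volume (ball (0 : ℂ) r) ≠ 0 := (measure_ball_pos volume _ hr).ne'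
  have hVt : volume (ball (0 : ℂ) r) ≠ ∞ := measure_ball_lt_top.ne
  have hm : AEMeasurable (fun p : ℂ × ℂ => ‖g p.1‖ₑ)
      ((volume.restrict (ball z r)).prod (volume.restrict (ball (0 : ℂ) r))) :=
    (hg.continuousOn.aemeasurable measurableSet_ball).enorm.comp_fst
  have h := volume_mul_enorm_le_lintegral (f := fun p : ℂ × ℂ => g p.1) (z := (z, 0)) (r := r)
    (hg.comp (by fun_prop) fun p hp => by
      rw [← ball_prod_same] at hp; exact hp.1)
  rw [← ball_prod_same, show (0 : ℂ × ℂ) = (0, 0) from rfl, ← ball_prod_same,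
    Measure.volume_eq_prod, Measure.prod_prod, ← Measure.prod_restrict,
    lintegral_prod _ hm] at h
  simp only [lintegral_const, Measure.restrict_apply_univ] at h
  rw [lintegral_mul_const' _ _ hVt, mul_comm (∫⁻ w in ball z r, ‖g w‖ₑ), mul_assoc] at h
  exact (ENNReal.mul_le_mul_iff_right hV0 hVt).1 h

/-- The submean inequality for g² on the disk of radius |z|/2 about z bounds |z|²|g(z)|² by a
multiple of the integral of |g|² near the origin, which tends to 0 by absolute continuity. Hence z
g(z) → 0, and Riemann's theorem removes the singularity. -/
theorem exists_differentiableOn_ball_of_lintegral_lt_top {g : ℂ → ℂ}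
    (hg : DifferentiableOn ℂ g (ball 0 1 \ {0})) (hi : ∫⁻ w in ball 0 1, ‖g w‖ₑ ^ 2 ≠ ∞) :
    ∃ h : ℂ → ℂ, DifferentiableOn ℂ h (ball 0 1) ∧ ∀ w ≠ 0, h w = g w := by
  refine ⟨_, Complex.differentiableOn_update_limUnder_of_isLittleO
    (isOpen_ball.mem_nhds (mem_ball_self one_pos)) hg ?_, fun w hw => Function.update_of_ne hw _ _⟩
  have hlim : Tendsto (fun z : ℂ => ∫⁻ w in ball 0 (2 * ‖z‖), ‖g w‖ₑ ^ 2
      ∂(volume.restrict (ball 0 1))) (𝓝[≠] 0) (𝓝 0) := by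
    refine tendsto_setLIntegral_zero hi ?_
    have h1 : Tendsto (fun z : ℂ => ENNReal.ofReal (2 * ‖z‖) ^ 2 * NNReal.pi) (𝓝[≠] 0) (𝓝 0) := by
      have : Continuous fun z : ℂ => ENNReal.ofReal (2 * ‖z‖) ^ 2 * NNReal.pi :=
        ENNReal.continuous_mul_const ENNReal.coe_ne_top |>.comp
          ((ENNReal.continuous_pow 2).comp (ENNReal.continuous_ofReal.comp (by fun_prop)))
      have := this.tendsto 0
      simp only [norm_zero, mul_zero, ENNReal.ofReal_zero, ne_eq, OfNat.ofNat_ne_zero,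
        not_false_eq_true, zero_pow, zero_mul] at this
      exact this.mono_left nhdsWithin_le_nhds
    refine tendsto_of_tendsto_of_tendsto_of_le_of_le tendsto_const_nhds h1 (fun _ => zero_le) ?_
    intro z
    simp only [Function.comp_apply]
    refine (Measure.restrict_apply_le _ _).trans ?_
    rw [Complex.volume_ball]
  have hb : ∀ z : ℂ, z ≠ 0 → ‖z‖ < 1 / 2 → ENNReal.ofReal (‖z‖ / 2) ^ 2 * NNReal.pi * ‖g z‖ₑ ^ 2
      ≤ ∫⁻ w in ball 0 (2 * ‖z‖), ‖g w‖ₑ ^ 2 ∂(volume.restrict (ball 0 1)) := by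
    intro z hz hz2
    have hz0 : 0 < ‖z‖ := norm_pos_iff.2 hz
    have hsub : ball z (‖z‖ / 2) ⊆ ball 0 1 \ {0} := fun w hw => by
      rw [mem_ball, dist_eq_norm] at hw
      refine ⟨?_, ?_⟩
      · rw [mem_ball_zero_iff]
        linarith [norm_sub_norm_le w z]
      · rintro rfl
        simp at hw
        linarith
    have hsub2 : ball z (‖z‖ / 2) ⊆ ball 0 (2 * ‖z‖) := fun w hw => by
      rw [mem_ball, dist_eq_norm] at hw
      rw [mem_ball_zero_iff]
      linarith [norm_sub_norm_le w z]
    have h := volume_mul_enorm_le_setLIntegral_ball (half_pos hz0)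
      (g := fun w => g w ^ 2) ((hg.mono hsub).pow 2)
    simp only [enorm_pow, Complex.volume_ball] at h
    refine h.trans ?_
    rw [Measure.restrict_restrict measurableSet_ball]
    exact lintegral_mono_set fun w hw => ⟨hsub2 hw, (hsub hw).1⟩
  have hsq : Tendsto (fun z : ℂ => ‖z‖ₑ ^ 2 * ‖g z‖ₑ ^ 2) (𝓝[≠] 0) (𝓝 0) := by
    -- The disk of radius |z|/2 has area π|z|²/4: the factor 4 clears the denominator, and π ≥ 1 is
    -- discarded.
    have h4 := ENNReal.Tendsto.const_mul hlim (a := 4) (Or.inr (by simp))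
    rw [mul_zero] at h4
    refine tendsto_of_tendsto_of_tendsto_of_le_of_le' tendsto_const_nhds h4
      (Eventually.of_forall fun _ => zero_le) ?_
    have hev : ∀ᶠ z : ℂ in 𝓝[≠] 0, z ≠ 0 ∧ ‖z‖ < 1 / 2 := by
      refine eventually_mem_nhdsWithin.and (nhdsWithin_le_nhds ?_)
      exact (continuous_norm.tendsto (0 : ℂ)).eventually_lt_const (by simp)
    filter_upwards [hev] with z hz
    refine le_trans ?_ (mul_le_mul_right (hb z hz.1 hz.2) 4)
    have e : (4 : ℝ≥0∞) * ENNReal.ofReal (‖z‖ / 2) ^ 2 = ‖z‖ₑ ^ 2 := by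
      rw [← ofReal_norm, ← ENNReal.ofReal_pow (by positivity), ← ENNReal.ofReal_pow (by positivity),
        show (4 : ℝ≥0∞) = ENNReal.ofReal 4 by simp, ← ENNReal.ofReal_mul (by norm_num)]
      ring_nf
    rw [← mul_assoc, ← mul_assoc, e, mul_assoc]
    refine mul_le_mul_right (le_mul_of_one_le_left' ?_) _
    have : (1 : ℝ≥0) ≤ NNReal.pi := by
      rw [← NNReal.coe_le_coe]; simp; linarith [Real.pi_gt_three]
    exact_mod_cast this
  have hmul : Tendsto (fun z : ℂ => z * g z) (𝓝[≠] 0) (𝓝 0) := by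
    rw [tendsto_zero_iff_norm_tendsto_zero]
    have h1 := (ENNReal.tendsto_toReal ENNReal.zero_ne_top).comp hsq
    have h2 := (Real.continuous_sqrt.tendsto _).comp h1
    simp only [ENNReal.toReal_zero, Real.sqrt_zero] at h2
    refine h2.congr fun z => ?_
    simp only [Function.comp_apply, ENNReal.toReal_mul, ENNReal.toReal_pow, toReal_enorm]
    rw [← mul_pow, Real.sqrt_sq (by positivity), norm_mul]
  -- The removability criterion is stated for g - g(0); the value g(0) is arbitrary here and
  -- harmless.
  have hmul2 : Tendsto (fun z : ℂ => z * (g z - g 0)) (𝓝[≠] 0) (𝓝 0) := by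
    have h2 : Tendsto (fun z : ℂ => z * g 0) (𝓝[≠] 0) (𝓝 0) := by
      have : Continuous fun z : ℂ => z * g 0 := by fun_prop
      simpa using (this.tendsto 0).mono_left nhdsWithin_le_nhds
    simpa [mul_sub] using hmul.sub h2
  refine (Asymptotics.isLittleO_iff_tendsto' ?_).2 (hmul2.congr fun z => ?_)
  · filter_upwards [eventually_mem_nhdsWithin] with z hz h
    simp at h
    exact absurd h hz
  · rw [sub_zero, div_inv_eq_mul, mul_comm]

theorem isFiniteMeasure_diskMeasure_two_mul_sub {c : ℝ} (h0 : 0 < c) :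
    IsFiniteMeasure (diskMeasure (2 * c - 2)) :=
  isFiniteMeasure_diskMeasure (by linarith)

/-- Multiplication by ζ^(-m) is an isometry onto the weight |ζ|^(2c-2). Since c ≤ 1, that weight is
at least 1 on the punctured disk, so ζ^(-m) g is square integrable without weight and extends
holomorphically over 0. The identity then reduces to `integral_symbol_mul`. -/
theorem integral_diskKernel_mul {c : ℝ} (h0 : 0 < c) (h1 : c ≤ 1) (m : ℤ) {g : ℂ → ℂ}
    (hg : DifferentiableOn ℂ g (ball 0 1 \ {0}))
    (hgi : ∫⁻ ζ, ‖g ζ‖ₑ ^ 2 ∂(diskMeasure (2 * c - 2 - 2 * m)) ≠ ∞)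
    {w : ℂ} (hw : w ∈ ball (0 : ℂ) 1) (hw0 : w ≠ 0) :
    ∫ ζ, diskKernel c m w ζ * g ζ ∂(diskMeasure (2 * c - 2 - 2 * m)) = g w := by
  have := isFiniteMeasure_diskMeasure_two_mul_sub h0
  have hpow : ∀ ζ : ℂ, ζ ≠ 0 →
      ‖ζ‖ ^ (2 * c - 2 - 2 * m) = ‖ζ‖ ^ (2 * c - 2) * (‖ζ‖ ^ m)⁻¹ ^ 2 := fun ζ hζ => by
    have hp : 0 < ‖ζ‖ := norm_pos_iff.2 hζ
    rw [Real.rpow_sub hp, mul_comm (2 : ℝ) m, Real.rpow_mul hp.le, Real.rpow_intCast,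
      Real.rpow_two, div_eq_mul_inv, inv_pow]
  have hd : DifferentiableOn ℂ (fun ζ => ζ ^ (-m) * g ζ) (ball 0 1 \ {0}) := by
    refine DifferentiableOn.mul (fun ζ hζ => ?_) hg
    exact (differentiableAt_zpow.2 (Or.inl hζ.2)).differentiableWithinAt
  have hi : ∫⁻ ζ, ‖ζ ^ (-m) * g ζ‖ₑ ^ 2 ∂(diskMeasure (2 * c - 2))
      = ∫⁻ ζ, ‖g ζ‖ₑ ^ 2 ∂(diskMeasure (2 * c - 2 - 2 * m)) := by
    rw [lintegral_diskMeasure, lintegral_diskMeasure]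
    refine lintegral_congr_ae (ae_restrict_of_ae ?_)
    filter_upwards [Measure.ae_ne volume (0 : ℂ)] with ζ hζ
    rw [hpow ζ hζ, ENNReal.ofReal_mul (Real.rpow_nonneg (norm_nonneg _) _), mul_assoc]
    congr 1
    rw [enorm_mul, mul_pow, ← ofReal_norm (ζ ^ (-m)), norm_zpow, zpow_neg,
      ENNReal.ofReal_pow (by positivity)]
  have hi2 : ∫⁻ ζ in ball 0 1, ‖ζ ^ (-m) * g ζ‖ₑ ^ 2 ≠ ∞ := by
    refine ne_top_of_le_ne_top (hi ▸ hgi) ?_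
    rw [lintegral_diskMeasure]
    refine lintegral_mono_ae ?_
    filter_upwards [ae_restrict_mem measurableSet_ball,
      ae_restrict_of_ae (Measure.ae_ne volume (0 : ℂ))] with ζ hζ hζ0
    refine le_mul_of_one_le_left' ?_
    rw [ENNReal.one_le_ofReal]
    exact Real.one_le_rpow_of_pos_of_le_one_of_nonpos (norm_pos_iff.2 hζ0)
      (mem_ball_zero_iff.1 hζ).le (by linarith)
  obtain ⟨h, hh, hhg⟩ := exists_differentiableOn_ball_of_lintegral_lt_top hd hi2
  have hhm : AEStronglyMeasurable h (diskMeasure (2 * c - 2)) :=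
    (hh.continuousOn.aestronglyMeasurable measurableSet_ball).mono_ac
      (withDensity_absolutelyContinuous _ _)
  have hh2 : MemLp h 2 (diskMeasure (2 * c - 2)) := by
    refine ⟨hhm, ?_⟩
    rw [eLpNorm_lt_top_iff_lintegral_rpow_enorm_lt_top (by norm_num) (by norm_num)]
    refine lt_of_eq_of_lt ?_ ((hi ▸ hgi).lt_top)
    refine lintegral_congr_ae ?_
    filter_upwards [ae_diskMeasure_mem (2 * c - 2)] with ζ hζ
    rw [hhg ζ hζ.2]
    simp
  have hrep := integral_symbol_mul h0 h1 hh (hh2.integrable (by norm_num)) hw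
  have hkey : ∫ ζ, diskKernel c m w ζ * g ζ ∂(diskMeasure (2 * c - 2 - 2 * m))
      = (π : ℂ)⁻¹ * w ^ m * ∫ ζ, symbol c (w * conj ζ) * h ζ ∂(diskMeasure (2 * c - 2)) := by
    rw [integral_diskMeasure, integral_diskMeasure, ← integral_const_mul]
    refine integral_congr_ae (ae_restrict_of_ae ?_)
    filter_upwards [Measure.ae_ne volume (0 : ℂ)] with ζ hζ
    have hn : (‖ζ‖ : ℂ) ^ m * (‖ζ‖ : ℂ) ^ m = conj ζ ^ m * ζ ^ m := by
      rw [← mul_zpow, ← mul_zpow, mul_comm (conj ζ), Complex.mul_conj, Complex.normSq_eq_norm_sq]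
      rw [Complex.ofReal_pow, sq]
    have hn0 : (‖ζ‖ : ℂ) ^ m ≠ 0 := zpow_ne_zero _ (by simpa using hζ)
    have hz0 : ζ ^ m ≠ 0 := zpow_ne_zero _ hζ
    rw [hpow ζ hζ, hhg ζ hζ, diskKernel, Complex.real_smul, Complex.real_smul, mul_zpow, zpow_neg]
    push_cast
    have hc : conj ζ ^ m = (‖ζ‖ : ℂ) ^ m * (‖ζ‖ : ℂ) ^ m * (ζ ^ m)⁻¹ := by
      rw [hn, mul_inv_cancel_right₀ hz0]
    rw [hc]
    field_simp
  rw [hkey, hrep, hhg w hw0, zpow_neg]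
  have hz0 : w ^ m ≠ 0 := zpow_ne_zero _ hw0
  have := Real.pi_ne_zero
  field_simp

theorem integral_diskKernel_one_zero_mul {g : ℂ → ℂ} (hg : DifferentiableOn ℂ g (ball 0 1))
    (hgi : Integrable g (diskMeasure 0)) {w : ℂ} (hw : w ∈ ball (0 : ℂ) 1) :
    ∫ ζ, diskKernel 1 0 w ζ * g ζ ∂(diskMeasure 0) = g w := by
  have := integral_symbol_mul one_pos le_rfl hg (by norm_num; exact hgi) hw
  norm_num at this
  simp only [diskKernel, zpow_zero, mul_one, mul_assoc, integral_const_mul, this]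
  have := Real.pi_ne_zero
  field_simp

/-! ### The Hartogs triangle as a product of two disks. -/

/-- Multiplication by a is the dilation by |a|, which contributes |a|², followed by a rotation,
which preserves area. -/
theorem lintegral_comp_mul_right_eq {a : ℂ} (ha : a ≠ 0) {F : ℂ → ℝ≥0∞} (hF : Measurable F) :
    ∫⁻ z, F z = ENNReal.ofReal (‖a‖ ^ 2) * ∫⁻ w, F (w * a) := by
  have hr : 0 < ‖a‖ := norm_pos_iff.2 ha
  have hu : ‖a / ‖a‖‖ = 1 := by
    rw [norm_div, Complex.norm_real, norm_norm, div_self hr.ne']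
  set u : Circle := ⟨a / ‖a‖, by simpa [Submonoid.unitSphere] using hu⟩ with hu_def
  have h1 : ∫⁻ w, F (w * a) = ∫⁻ w : ℂ, F (u * w) ∂(Measure.map (‖a‖ • ·) volume) := by
    rw [lintegral_map (by fun_prop) (by fun_prop)]
    refine lintegral_congr fun w => ?_
    congr 1
    rw [hu_def, Complex.real_smul]
    have : (‖a‖ : ℂ) ≠ 0 := by exact_mod_cast hr.ne'
    simp only
    field_simp
  have h2 : ∫⁻ w : ℂ, F (u * w) = ∫⁻ w, F w :=
    (rotation u).measurePreserving.lintegral_comp hF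
  rw [h1, Measure.map_addHaar_smul _ hr.ne', lintegral_smul_measure, h2, smul_eq_mul, ← mul_assoc,
    Complex.finrank_real_complex, ← ENNReal.ofReal_mul (by positivity), abs_of_nonneg (by positivity),
    mul_inv_cancel₀ (by positivity), ENNReal.ofReal_one, one_mul]

theorem setLIntegral_ball_eq {a : ℂ} (ha : a ≠ 0) {F : ℂ → ℝ≥0∞} (hF : Measurable F) :
    ∫⁻ z in ball 0 ‖a‖, F z = ENNReal.ofReal (‖a‖ ^ 2) * ∫⁻ w in ball 0 1, F (w * a) := by
  rw [← lintegral_indicator measurableSet_ball,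
    lintegral_comp_mul_right_eq ha (hF.indicator measurableSet_ball),
    ← lintegral_indicator measurableSet_ball]
  congr 1
  refine lintegral_congr fun w => ?_
  have hr : 0 < ‖a‖ := norm_pos_iff.2 ha
  have : w * a ∈ ball 0 ‖a‖ ↔ w ∈ ball (0 : ℂ) 1 := by
    simp only [mem_ball_zero_iff, norm_mul]
    exact ⟨fun h => by by_contra! h'; nlinarith, fun h => by nlinarith⟩
  by_cases h : w ∈ ball (0 : ℂ) 1
  · rw [indicator_of_mem h, indicator_of_mem (this.2 h)]
  · rw [indicator_of_notMem h, indicator_of_notMem (fun h' => h (this.1 h'))]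

/-- The weighted measure on the Hartogs triangle. -/
noncomputable abbrev hartogsMeasure (s' : ℝ) : Measure (ℂ × ℂ) :=
  weightedVolume hartogsTriangle (hartogsWeight s')

/-- The biholomorphism from `𝔻 × 𝔻∖{0}` to the Hartogs triangle. -/
def hartogsMap (w : ℂ × ℂ) : ℂ × ℂ := (w.1 * w.2, w.2)

/-- The inverse of `hartogsMap`. -/
noncomputable def hartogsCoord (z : ℂ × ℂ) : ℂ × ℂ := (z.1 / z.2, z.2)

@[fun_prop]
theorem measurable_hartogsMap : Measurable hartogsMap := by unfold hartogsMap; fun_prop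

@[fun_prop]
theorem measurable_hartogsCoord : Measurable hartogsCoord := by unfold hartogsCoord; fun_prop

theorem hartogsCoord_hartogsMap {w : ℂ × ℂ} (hw : w.2 ≠ 0) : hartogsCoord (hartogsMap w) = w := by
  simp [hartogsCoord, hartogsMap, hw]

theorem hartogsMap_hartogsCoord {z : ℂ × ℂ} (hz : z.2 ≠ 0) : hartogsMap (hartogsCoord z) = z := by
  simp [hartogsCoord, hartogsMap, hz]

theorem snd_ne_zero_of_mem {z : ℂ × ℂ} (hz : z ∈ hartogsTriangle) : z.2 ≠ 0 :=
  norm_pos_iff.1 ((norm_nonneg _).trans_lt hz.1)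

theorem hartogsCoord_mem {z : ℂ × ℂ} (hz : z ∈ hartogsTriangle) :
    (hartogsCoord z).1 ∈ ball (0 : ℂ) 1 ∧ (hartogsCoord z).2 ∈ ball (0 : ℂ) 1 := by
  have h0 : 0 < ‖z.2‖ := (norm_nonneg _).trans_lt hz.1
  simp only [hartogsCoord, mem_ball_zero_iff, norm_div]
  exact ⟨(div_lt_one h0).2 hz.1, hz.2⟩

theorem hartogsMap_mem {w : ℂ × ℂ} (h1 : w.1 ∈ ball (0 : ℂ) 1) (h2 : w.2 ∈ ball (0 : ℂ) 1)
    (h0 : w.2 ≠ 0) : hartogsMap w ∈ hartogsTriangle := by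
  rw [mem_ball_zero_iff] at h1 h2
  refine ⟨?_, h2⟩
  simp only [hartogsMap, norm_mul]
  have := norm_pos_iff.2 h0
  nlinarith

theorem ae_hartogsMeasure_mem (s' : ℝ) : ∀ᵐ z ∂(hartogsMeasure s'), z ∈ hartogsTriangle :=
  (withDensity_absolutelyContinuous _ _).ae_le
    (ae_restrict_mem isOpen_hartogsTriangle.measurableSet)

theorem ae_prod_diskMeasure_mem (a t : ℝ) : ∀ᵐ w ∂((diskMeasure a).prod (diskMeasure t)),
    (w.1 ∈ ball (0 : ℂ) 1 ∧ w.1 ≠ 0) ∧ (w.2 ∈ ball (0 : ℂ) 1 ∧ w.2 ≠ 0) :=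
  (Measure.quasiMeasurePreserving_fst.ae (ae_diskMeasure_mem a)).and
    (Measure.quasiMeasurePreserving_snd.ae (ae_diskMeasure_mem t))

/-- The slice z₂ = b is the disk of radius |b|. Rescaling it to the unit disk produces |b|², which
raises the exponent of the weight from s' to s' + 2. -/
theorem lintegral_hartogsMeasure (s' : ℝ) {F : ℂ × ℂ → ℝ≥0∞} (hF : Measurable F) :
    ∫⁻ z, F z ∂(hartogsMeasure s')
      = ∫⁻ b, ∫⁻ a, F (hartogsMap (a, b)) ∂(diskMeasure 0) ∂(diskMeasure (s' + 2)) := by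
  have hw : Measurable fun z : ℂ × ℂ => ENNReal.ofReal (hartogsWeight s' z) := by
    unfold hartogsWeight; fun_prop
  have hms := isOpen_hartogsTriangle.measurableSet
  have e0 : ∀ b, ∫⁻ a, F (hartogsMap (a, b)) ∂(diskMeasure 0)
      = ∫⁻ a in ball 0 1, F (a * b, b) := fun b => by
    rw [lintegral_diskMeasure]
    simp [hartogsMap]
  simp only [e0]
  rw [hartogsMeasure, weightedVolume, lintegral_withDensity_eq_lintegral_mul _ hw hF,
    ← lintegral_indicator hms, Measure.volume_eq_prod,
    lintegral_prod_symm' _ ((hw.mul hF).indicator hms), lintegral_diskMeasure,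
    ← lintegral_indicator measurableSet_ball]
  refine lintegral_congr_ae ?_
  filter_upwards [Measure.ae_ne volume (0 : ℂ)] with b hb
  have hb0 : 0 < ‖b‖ := norm_pos_iff.2 hb
  by_cases h : b ∈ ball (0 : ℂ) 1
  · have hb1 : ‖b‖ < 1 := by simpa using h
    rw [indicator_of_mem h, Real.rpow_add hb0, Real.rpow_two,
      ENNReal.ofReal_mul (Real.rpow_nonneg hb0.le _), mul_assoc,
      ← setLIntegral_ball_eq hb (F := fun z => F (z, b)) (by fun_prop),
      ← lintegral_const_mul' _ _ ENNReal.ofReal_ne_top, ← lintegral_indicator measurableSet_ball]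
    refine lintegral_congr fun a => ?_
    by_cases ha : a ∈ ball (0 : ℂ) ‖b‖
    · rw [indicator_of_mem ha, indicator_of_mem]
      · rfl
      · exact ⟨by simpa using ha, hb1⟩
    · rw [indicator_of_notMem ha, indicator_of_notMem]
      exact fun h' => ha (by simpa using h'.1)
  · rw [indicator_of_notMem h]
    refine (lintegral_congr fun a => ?_).trans lintegral_zero
    rw [indicator_of_notMem]
    exact fun h' => h (by simpa using h'.2)

theorem measurePreserving_hartogsMap (s' : ℝ) :
    MeasurePreserving hartogsMap ((diskMeasure 0).prod (diskMeasure (s' + 2)))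
      (hartogsMeasure s') := by
  refine ⟨measurable_hartogsMap, Measure.ext fun s hs => ?_⟩
  have h1 : Measurable (s.indicator (1 : ℂ × ℂ → ℝ≥0∞)) := measurable_one.indicator hs
  rw [← lintegral_indicator_one hs, ← lintegral_indicator_one hs,
    lintegral_map h1 measurable_hartogsMap, lintegral_hartogsMeasure _ h1,
    lintegral_prod_symm' (fun w => s.indicator 1 (hartogsMap w)) (h1.comp measurable_hartogsMap)]

theorem measurePreserving_hartogsCoord (s' : ℝ) :
    MeasurePreserving hartogsCoord (hartogsMeasure s')
      ((diskMeasure 0).prod (diskMeasure (s' + 2))) := by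
  refine ⟨measurable_hartogsCoord, ?_⟩
  rw [← (measurePreserving_hartogsMap s').map_eq,
    Measure.map_map measurable_hartogsCoord measurable_hartogsMap]
  have : hartogsCoord ∘ hartogsMap =ᵐ[(diskMeasure 0).prod (diskMeasure (s' + 2))] id := by
    filter_upwards [ae_prod_diskMeasure_mem 0 (s' + 2)] with w hw
    exact hartogsCoord_hartogsMap hw.2.2
  rw [Measure.map_congr this, Measure.map_id]

/-! ### Tensor products and the integral formula for the Bergman projection. -/

theorem eLpNorm_prod_mul {α β : Type*} [MeasurableSpace α] [MeasurableSpace β] {μ : Measure α}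
    {ν : Measure β} [SFinite μ] [SFinite ν] {f : α → ℂ} {g : β → ℂ} (hf : AEStronglyMeasurable f μ)
    (hg : AEStronglyMeasurable g ν) {p : ℝ≥0∞} (hp0 : p ≠ 0) (hpt : p ≠ ∞) :
    eLpNorm (fun z : α × β => f z.1 * g z.2) p (μ.prod ν) = eLpNorm f p μ * eLpNorm g p ν := by
  simp only [eLpNorm_eq_lintegral_rpow_enorm_toReal hp0 hpt, enorm_mul,
    ENNReal.mul_rpow_of_nonneg _ _ ENNReal.toReal_nonneg]
  rw [lintegral_prod_mul (hf.enorm.pow_const _) (hg.enorm.pow_const _),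
    ENNReal.mul_rpow_of_nonneg _ _ (by positivity)]

theorem aestronglyMeasurable_prod_mul {α β : Type*} [MeasurableSpace α] [MeasurableSpace β]
    {μ : Measure α} {ν : Measure β} [SFinite μ] [SFinite ν] {f : α → ℂ} {g : β → ℂ}
    (hf : AEStronglyMeasurable f μ) (hg : AEStronglyMeasurable g ν) :
    AEStronglyMeasurable (fun z : α × β => f z.1 * g z.2) (μ.prod ν) :=
  (hf.comp_quasiMeasurePreserving Measure.quasiMeasurePreserving_fst).mul
    (hg.comp_quasiMeasurePreserving Measure.quasiMeasurePreserving_snd)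

theorem memLp_prod_mul {α β : Type*} [MeasurableSpace α] [MeasurableSpace β] {μ : Measure α}
    {ν : Measure β} [SFinite μ] [SFinite ν] {f : α → ℂ} {g : β → ℂ} {p : ℝ≥0∞} (hp0 : p ≠ 0)
    (hpt : p ≠ ∞) (hf : MemLp f p μ) (hg : MemLp g p ν) :
    MemLp (fun z : α × β => f z.1 * g z.2) p (μ.prod ν) := by
  refine ⟨aestronglyMeasurable_prod_mul hf.1 hg.1, ?_⟩
  rw [eLpNorm_prod_mul hf.1 hg.1 hp0 hpt]
  exact ENNReal.mul_lt_top hf.2 hg.2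

theorem memLp_zpow {m : ℤ} {t p : ℝ} (hp : 0 < p) (h : -2 < t + p * m) :
    MemLp (fun ζ : ℂ => ζ ^ m) (ENNReal.ofReal p) (diskMeasure t) := by
  have hp0 : ENNReal.ofReal p ≠ 0 := by simpa using hp
  refine ⟨(measurable_id.pow_const m).aestronglyMeasurable, ?_⟩
  rw [eLpNorm_lt_top_iff_lintegral_rpow_enorm_lt_top hp0 ENNReal.ofReal_ne_top,
    ENNReal.toReal_ofReal hp.le]
  refine lt_of_eq_of_lt ?_ (lintegral_norm_rpow_lt_top_iff.2 h)
  refine lintegral_congr fun ζ => ?_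
  rw [← ofReal_norm, ENNReal.ofReal_rpow_of_nonneg (norm_nonneg _) hp.le, norm_zpow,
    ← Real.rpow_intCast, ← Real.rpow_mul (norm_nonneg _), mul_comm]

/-- For fixed w the symbol is bounded in ζ, so the kernel is dominated by a multiple of |ζ|^m. The
exponent of |ζ|^(2m) against the weight is 2c - 2 > -2. -/
theorem memLp_diskKernel {c : ℝ} (h0 : 0 < c) (h1 : c ≤ 1) (m : ℤ) {w : ℂ}
    (hw : w ∈ ball (0 : ℂ) 1) :
    MemLp (diskKernel c m w) 2 (diskMeasure (2 * c - 2 - 2 * m)) := by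
  have hw' : ‖w‖ < 1 := by simpa using hw
  have hz := memLp_zpow (m := m) (t := 2 * c - 2 - 2 * m) two_pos (by linarith)
  rw [show ENNReal.ofReal 2 = 2 by simp] at hz
  refine MemLp.of_le_mul (c := ‖w ^ m‖ * (1 - ‖w‖)⁻¹ ^ 2) hz
    ((measurable_diskKernel c m).comp (measurable_const.prodMk measurable_id)).aestronglyMeasurable ?_
  filter_upwards [ae_diskMeasure_mem (2 * c - 2 - 2 * m)] with ζ hζ
  have hζ' : ‖ζ‖ < 1 := by simpa using hζ.1
  have hs : ‖symbol c (w * conj ζ)‖ ≤ (1 - ‖w‖)⁻¹ ^ 2 := by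
    refine norm_symbol_le_of_norm_le h0.le h1 ?_ hw'
    rw [norm_mul, RCLike.norm_conj]
    exact mul_le_of_le_one_right (norm_nonneg _) hζ'.le
  have hpi : ‖(π : ℂ)⁻¹‖ ≤ 1 := by
    rw [norm_inv, Complex.norm_of_nonneg Real.pi_pos.le]
    exact inv_le_one_of_one_le₀ (by linarith [Real.pi_gt_three])
  rw [diskKernel, norm_mul, norm_mul, mul_zpow, norm_mul, norm_zpow (conj ζ), RCLike.norm_conj,
    ← norm_zpow ζ]
  calc _ ≤ 1 * (‖w ^ m‖ * ‖ζ ^ m‖) * (1 - ‖w‖)⁻¹ ^ 2 := by gcongr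
    _ = _ := by ring

theorem memLp_diskKernel_one_zero {w : ℂ} (hw : w ∈ ball (0 : ℂ) 1) :
    MemLp (diskKernel 1 0 w) 2 (diskMeasure 0) := by
  have := memLp_diskKernel one_pos le_rfl 0 hw
  norm_num at this
  exact this

/-- The Bergman kernel of the Hartogs triangle with weight `|z₂|^(2c-4-2m)`. -/
noncomputable def hartogsKernel (c : ℝ) (m : ℤ) (z ζ : ℂ × ℂ) : ℂ :=
  diskKernel 1 0 (hartogsCoord z).1 (hartogsCoord ζ).1 *
    diskKernel c m (hartogsCoord z).2 (hartogsCoord ζ).2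

theorem measurable_hartogsKernel (c : ℝ) (m : ℤ) :
    Measurable fun p : (ℂ × ℂ) × (ℂ × ℂ) => hartogsKernel c m p.1 p.2 := by
  have h1 : Measurable fun p : (ℂ × ℂ) × (ℂ × ℂ) => ((hartogsCoord p.1).1, (hartogsCoord p.2).1) :=
    by fun_prop
  have h2 : Measurable fun p : (ℂ × ℂ) × (ℂ × ℂ) => ((hartogsCoord p.1).2, (hartogsCoord p.2).2) :=
    by fun_prop
  have h3 := (measurable_diskKernel 1 0).comp h1
  have h4 := (measurable_diskKernel c m).comp h2
  exact h3.mul h4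

theorem memLp_hartogsKernel {c : ℝ} (h0 : 0 < c) (h1 : c ≤ 1) {m : ℤ} {s' : ℝ}
    (hs : s' + 2 = 2 * c - 2 - 2 * m) {z : ℂ × ℂ} (hz : z ∈ hartogsTriangle) :
    MemLp (hartogsKernel c m z) 2 (hartogsMeasure s') := by
  have h := memLp_prod_mul two_ne_zero ENNReal.ofNat_ne_top
    (memLp_diskKernel_one_zero (hartogsCoord_mem hz).1)
    (memLp_diskKernel h0 h1 m (hartogsCoord_mem hz).2)
  rw [← hs] at h
  exact h.comp_measurePreserving (measurePreserving_hartogsCoord s')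

theorem conj_diskKernel (c : ℝ) (m : ℤ) (w ζ : ℂ) :
    conj (diskKernel c m w ζ) = (π : ℂ)⁻¹ * (conj w * ζ) ^ m * symbol c (conj w * ζ) := by
  simp [diskKernel, symbol]

theorem differentiableAt_conj_diskKernel (c : ℝ) {m : ℤ} {w ζ : ℂ} (hw : w ∈ ball (0 : ℂ) 1)
    (hζ : ζ ∈ ball (0 : ℂ) 1) (h : 0 ≤ m ∨ w ≠ 0 ∧ ζ ≠ 0) :
    DifferentiableAt ℂ (fun ζ => conj (diskKernel c m w ζ)) ζ := by
  have hlt : ‖conj w * ζ‖ < 1 := by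
    have := norm_mul_conj_lt hw hζ
    simpa [norm_mul] using this
  simp only [conj_diskKernel]
  refine DifferentiableAt.mul (DifferentiableAt.const_mul ?_ _) ?_
  · refine DifferentiableAt.zpow (by fun_prop) ?_
    rcases h with h | h
    · exact Or.inr h
    · exact Or.inl (mul_ne_zero ((map_ne_zero _).2 h.1) h.2)
  · exact (differentiableAt_symbol c hlt).comp ζ (by fun_prop)

theorem differentiableOn_conj_hartogsKernel (c : ℝ) (m : ℤ) {z : ℂ × ℂ}
    (hz : z ∈ hartogsTriangle) :
    DifferentiableOn ℂ (fun ζ => conj (hartogsKernel c m z ζ)) hartogsTriangle := by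
  intro ζ hζ
  refine DifferentiableAt.differentiableWithinAt ?_
  simp only [hartogsKernel, map_mul]
  have hne := snd_ne_zero_of_mem hζ
  refine DifferentiableAt.mul ?_ ?_
  · refine (differentiableAt_conj_diskKernel 1 (hartogsCoord_mem hz).1 (hartogsCoord_mem hζ).1
      (Or.inl le_rfl)).comp (f := fun ζ : ℂ × ℂ => (hartogsCoord ζ).1) ζ ?_
    simp only [hartogsCoord, div_eq_mul_inv]
    exact differentiableAt_fst.mul (differentiableAt_snd.inv hne)
  · exact (differentiableAt_conj_diskKernel c (hartogsCoord_mem hz).2 (hartogsCoord_mem hζ).2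
      (Or.inr ⟨show z.2 ≠ 0 from snd_ne_zero_of_mem hz, hne⟩)).comp (f := fun ζ : ℂ × ℂ => (hartogsCoord ζ).2) ζ
      differentiableAt_snd

theorem enorm_integral_mul_sq_le {α : Type*} [MeasurableSpace α] {μ : Measure α} {f g : α → ℂ}
    (hf : AEStronglyMeasurable f μ) (hg : AEStronglyMeasurable g μ) :
    ‖∫ x, f x * g x ∂μ‖ₑ ^ 2 ≤ (∫⁻ x, ‖f x‖ₑ ^ 2 ∂μ) * ∫⁻ x, ‖g x‖ₑ ^ 2 ∂μ := by
  have h1 := ENNReal.lintegral_mul_le_Lp_mul_Lq μ Real.HolderConjugate.two_two hf.enorm hg.enorm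
  have h2 : ‖∫ x, f x * g x ∂μ‖ₑ ≤ ∫⁻ x, ‖f x‖ₑ * ‖g x‖ₑ ∂μ := by
    refine (enorm_integral_le_lintegral_enorm _).trans (le_of_eq ?_)
    simp only [enorm_mul]
  simp only [ENNReal.rpow_two] at h1
  calc ‖∫ x, f x * g x ∂μ‖ₑ ^ 2 ≤ _ := pow_le_pow_left' (h2.trans h1) 2
    _ = _ := by
      rw [mul_pow, ← ENNReal.rpow_two, ← ENNReal.rpow_two, ← ENNReal.rpow_mul, ← ENNReal.rpow_mul]
      norm_num

theorem memLp_two_iff {α : Type*} [MeasurableSpace α] {μ : Measure α} {f : α → ℂ}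
    (hf : AEStronglyMeasurable f μ) : MemLp f 2 μ ↔ ∫⁻ x, ‖f x‖ₑ ^ 2 ∂μ ≠ ∞ := by
  rw [← lt_top_iff_ne_top]
  have := eLpNorm_lt_top_iff_lintegral_rpow_enorm_lt_top (f := f) (p := 2) (μ := μ)
    (by norm_num) (by norm_num)
  simp only [ENNReal.toReal_ofNat, ENNReal.rpow_two] at this
  exact ⟨fun h => this.1 h.2, fun h => ⟨hf, this.2 h⟩⟩

/-- By Fubini the two disk formulas apply one after the other. Almost every slice in the first
coordinate is square integrable, so the unweighted kernel reproduces it. The remaining function of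
the second coordinate is then reproduced by the weighted kernel. -/
theorem integral_hartogsKernel_mul {c : ℝ} (h0 : 0 < c) (h1 : c ≤ 1) {m : ℤ} {s' : ℝ}
    (hs : s' + 2 = 2 * c - 2 - 2 * m) {F : ℂ × ℂ → ℂ} (hF : DifferentiableOn ℂ F hartogsTriangle)
    (hF2 : MemLp F 2 (hartogsMeasure s')) {z : ℂ × ℂ} (hz : z ∈ hartogsTriangle) :
    ∫ ζ, hartogsKernel c m z ζ * F ζ ∂(hartogsMeasure s') = F z := by
  have hΦ := measurePreserving_hartogsMap s'
  have := isFiniteMeasure_diskMeasure (t := 0) (by norm_num)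
  obtain ⟨hw1, hw2⟩ := hartogsCoord_mem hz
  have hint : Integrable (fun ζ => hartogsKernel c m z ζ * F ζ) (hartogsMeasure s') :=
    (memLp_hartogsKernel h0 h1 hs hz).integrable_mul hF2
  have hG : MemLp (F ∘ hartogsMap) 2 ((diskMeasure 0).prod (diskMeasure (s' + 2))) :=
    hF2.comp_measurePreserving hΦ
  have hG2 := (memLp_two_iff hG.1).1 hG
  have hGm : AEMeasurable (fun w => ‖(F ∘ hartogsMap) w‖ₑ ^ 2)
    ((diskMeasure 0).prod (diskMeasure (s' + 2))) := hG.1.enorm.pow_const 2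
  rw [lintegral_prod_symm _ hGm] at hG2
  have hfin := ae_lt_top' hGm.prod_swap.lintegral_prod_right' hG2
  have hd1 : ∀ b ∈ ball (0 : ℂ) 1, b ≠ 0 →
      DifferentiableOn ℂ (fun a => F (hartogsMap (a, b))) (ball 0 1) := fun b hb hb0 =>
    hF.comp (by unfold hartogsMap; fun_prop) fun a ha => hartogsMap_mem ha hb hb0
  have hd2 : DifferentiableOn ℂ (fun b => F (hartogsMap ((hartogsCoord z).1, b)))
      (ball 0 1 \ {0}) :=
    hF.comp (by unfold hartogsMap; fun_prop) fun b hb => hartogsMap_mem hw1 hb.1 hb.2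
  have hslice : ∀ᵐ b ∂(diskMeasure (s' + 2)),
      (b ∈ ball (0 : ℂ) 1 ∧ b ≠ 0) ∧ MemLp (fun a => F (hartogsMap (a, b))) 2 (diskMeasure 0) := by
    filter_upwards [hfin, ae_diskMeasure_mem (s' + 2)] with b hb hbm
    refine ⟨hbm, (memLp_two_iff ?_).2 hb.ne⟩
    exact ((hd1 b hbm.1 hbm.2).continuousOn.aestronglyMeasurable measurableSet_ball).mono_ac
      (withDensity_absolutelyContinuous _ _)
  have hrep : ∀ᵐ b ∂(diskMeasure (s' + 2)), (MemLp (fun a => F (hartogsMap (a, b))) 2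
      (diskMeasure 0)) ∧ ∫ a, diskKernel 1 0 (hartogsCoord z).1 a * F (hartogsMap (a, b))
        ∂(diskMeasure 0) = F (hartogsMap ((hartogsCoord z).1, b)) := by
    filter_upwards [hslice] with b hb
    exact ⟨hb.2, integral_diskKernel_one_zero_mul (hd1 b hb.1.1 hb.1.2)
      (hb.2.integrable (by norm_num)) hw1⟩
  have hK1 := memLp_diskKernel_one_zero hw1
  -- Fubini gives no information about this one particular slice. The reproducing formula and
  -- Cauchy–Schwarz bound its value at b by the L² norm of the slice at height b, and these norms
  -- are square integrable in b.
  have hL2 : ∫⁻ b, ‖F (hartogsMap ((hartogsCoord z).1, b))‖ₑ ^ 2 ∂(diskMeasure (s' + 2)) ≠ ∞ := by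
    refine ne_top_of_le_ne_top (ENNReal.mul_ne_top ((memLp_two_iff hK1.1).1 hK1) hG2) ?_
    rw [← lintegral_const_mul' _ _ ((memLp_two_iff hK1.1).1 hK1)]
    refine lintegral_mono_ae ?_
    filter_upwards [hrep] with b hb
    rw [← hb.2]
    exact enorm_integral_mul_sq_le hK1.1 hb.1.1
  have hw0 : (hartogsCoord z).2 ≠ 0 := show z.2 ≠ 0 from snd_ne_zero_of_mem hz
  rw [hs] at hL2
  have hlast := integral_diskKernel_mul h0 h1 m hd2 hL2 hw2 hw0
  rw [← hs] at hlast
  have hzz : hartogsMap ((hartogsCoord z).1, (hartogsCoord z).2) = z :=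
    hartogsMap_hartogsCoord (snd_ne_zero_of_mem hz)
  rw [hzz] at hlast
  rw [← hlast, ← hΦ.map_eq, integral_map hΦ.measurable.aemeasurable (by rw [hΦ.map_eq]; exact hint.1),
    integral_prod_symm (fun w => hartogsKernel c m z (hartogsMap w) * F (hartogsMap w))
      ((hΦ.integrable_comp hint.1).2 hint)]
  refine integral_congr_ae ?_
  filter_upwards [hrep, ae_diskMeasure_mem (s' + 2)] with b hb hbm
  rw [← hb.2, ← integral_const_mul]
  refine integral_congr_ae (Eventually.of_forall fun a => ?_)
  simp only [hartogsKernel]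
  rw [hartogsCoord_hartogsMap (w := (a, b)) hbm.2]
  ring

/-- For fixed z, the conjugate of K(z, ·) belongs to the Bergman space, hence is orthogonal to f -
Pf. So K(z, ·) integrates f and Pf to the same value, and the latter value is Pf(z) by the
reproducing property. -/
theorem bergmanProjection_ae_eq {c : ℝ} (h0 : 0 < c) (h1 : c ≤ 1) {m : ℤ} {s' : ℝ}
    (hs : s' + 2 = 2 * c - 2 - 2 * m) (f : Lp ℂ 2 (hartogsMeasure s')) :
    bergmanProjection hartogsTriangle (hartogsWeight s') f =ᵐ[hartogsMeasure s']
      fun z => ∫ ζ, hartogsKernel c m z ζ * f ζ ∂(hartogsMeasure s') := by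
  set P := bergmanProjection hartogsTriangle (hartogsWeight s') f with hP
  have hmem : P ∈ bergmanSpace hartogsTriangle (hartogsWeight s') :=
    Submodule.starProjection_apply_mem _ _
  have horth : f - P ∈ (bergmanSpace hartogsTriangle (hartogsWeight s'))ᗮ :=
    Submodule.sub_starProjection_mem_orthogonal _
  obtain ⟨h, hh, hPh⟩ := hmem
  have hP2 := Lp.memLp P
  have hh2 : MemLp h 2 (hartogsMeasure s') := (memLp_congr_ae hPh).1 hP2
  filter_upwards [hPh, ae_hartogsMeasure_mem s'] with z hz hzm
  have hK := memLp_hartogsKernel h0 h1 hs hzm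
  have hKc : MemLp (fun ζ => conj (hartogsKernel c m z ζ)) 2 (hartogsMeasure s') := hK.star
  have hKmem : hKc.toLp _ ∈ bergmanSpace hartogsTriangle (hartogsWeight s') :=
    ⟨_, differentiableOn_conj_hartogsKernel c m hzm, hKc.coeFn_toLp⟩
  have hin := horth _ hKmem
  rw [L2.inner_def] at hin
  have e : ∫ ζ, inner ℂ (hKc.toLp _ ζ) ((f - P : Lp ℂ 2 (hartogsMeasure s')) ζ) ∂(hartogsMeasure s')
      = ∫ ζ, (hartogsKernel c m z ζ * f ζ - hartogsKernel c m z ζ * P ζ) ∂(hartogsMeasure s') := by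
    refine integral_congr_ae ?_
    filter_upwards [hKc.coeFn_toLp, Lp.coeFn_sub f P] with ζ h3 h4
    rw [h3, h4]
    simp only [RCLike.inner_apply, RingHomCompTriple.comp_apply, RingHom.id_apply, Pi.sub_apply]
    ring
  have hi1 : Integrable (fun ζ => hartogsKernel c m z ζ * f ζ) (hartogsMeasure s') :=
    hK.integrable_mul (Lp.memLp f)
  have hi2 : Integrable (fun ζ => hartogsKernel c m z ζ * P ζ) (hartogsMeasure s') :=
    hK.integrable_mul hP2
  rw [e, integral_sub hi1 hi2, sub_eq_zero] at hin
  rw [hz, hin, ← integral_hartogsKernel_mul h0 h1 hs hh hh2 hzm]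
  refine integral_congr_ae ?_
  filter_upwards [hPh] with ζ hζ
  rw [hζ]

/-! ### Sufficiency: Schur test and Forelli–Rudin estimate. -/

/-- **Schur test** for a symmetric nonnegative kernel. -/
theorem lintegral_rpow_le_of_schur {α : Type*} [MeasurableSpace α] {μ : Measure α} [SFinite μ]
    {k : α → α → ℝ≥0∞} (hk : Measurable fun x : α × α => k x.1 x.2) (hsymm : ∀ x y, k x y = k y x)
    {h : α → ℝ≥0∞} (hh : Measurable h) (hpos : ∀ᵐ x ∂μ, h x ≠ 0 ∧ h x ≠ ∞) {p q : ℝ}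
    (hpq : p.HolderConjugate q) {C D : ℝ≥0∞}
    (hC : ∀ᵐ x ∂μ, ∫⁻ y, k x y * h y ^ q ∂μ ≤ C * h x ^ q)
    (hD : ∀ᵐ x ∂μ, ∫⁻ y, k x y * h y ^ p ∂μ ≤ D * h x ^ p) {f : α → ℝ≥0∞} (hf : Measurable f) :
    ∫⁻ x, (∫⁻ y, k x y * f y ∂μ) ^ p ∂μ ≤ C ^ (p / q) * D * ∫⁻ x, f x ^ p ∂μ := by
  have hp := hpq.pos
  have hq := hpq.symm.pos
  have hkx : ∀ x, Measurable (k x) := fun x => hk.comp (measurable_const.prodMk measurable_id)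
  have hpt : ∀ᵐ x ∂μ, (∫⁻ y, k x y * f y ∂μ) ^ p
      ≤ C ^ (p / q) * (h x ^ p * ∫⁻ y, k x y * (f y * (h y)⁻¹) ^ p ∂μ) := by
    filter_upwards [hC] with x hx
    -- Hölder is applied to the splitting k f = (k^(1/p) f/h)(k^(1/q) h). The second factor is
    -- controlled by `hC`; the first is integrated in x by Tonelli, where symmetry brings in `hD`.
    have e : ∫⁻ y, k x y * f y ∂μ
        = ∫⁻ y, ((fun y => k x y ^ (1 / p) * (f y * (h y)⁻¹)) * fun y => k x y ^ (1 / q) * h y) y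
            ∂μ := by
      refine lintegral_congr_ae ?_
      filter_upwards [hpos] with y hy
      simp only [Pi.mul_apply]
      have e1 : k x y ^ (1 / p) * k x y ^ (1 / q) = k x y := by
        rw [← ENNReal.rpow_add_of_nonneg _ _ (by positivity) (by positivity), one_div, one_div,
          hpq.inv_add_inv_eq_one, ENNReal.rpow_one]
      calc k x y * f y = (k x y ^ (1 / p) * k x y ^ (1 / q)) * f y * ((h y)⁻¹ * h y) := by
            rw [e1, ENNReal.inv_mul_cancel hy.1 hy.2, mul_one]
        _ = _ := by ring
    have hol := ENNReal.lintegral_mul_le_Lp_mul_Lq μ hpq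
      (f := fun y => k x y ^ (1 / p) * (f y * (h y)⁻¹)) (g := fun y => k x y ^ (1 / q) * h y)
      (((hkx x).pow_const _).mul (hf.mul hh.inv)).aemeasurable
      (((hkx x).pow_const _).mul hh).aemeasurable
    rw [← e] at hol
    have hsimp : ∀ (r : ℝ) (_ : 0 < r) (a b : ℝ≥0∞), (a ^ (1 / r) * b) ^ r = a * b ^ r :=
      fun r hr a b => by
        rw [ENNReal.mul_rpow_of_nonneg _ _ hr.le, ← ENNReal.rpow_mul, one_div_mul_cancel hr.ne',
          ENNReal.rpow_one]
    simp only [hsimp p hp, hsimp q hq] at hol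
    calc (∫⁻ y, k x y * f y ∂μ) ^ p
        ≤ ((∫⁻ y, k x y * (f y * (h y)⁻¹) ^ p ∂μ) ^ (1 / p)
            * (∫⁻ y, k x y * h y ^ q ∂μ) ^ (1 / q)) ^ p := by gcongr
      _ ≤ ((∫⁻ y, k x y * (f y * (h y)⁻¹) ^ p ∂μ) ^ (1 / p) * (C * h x ^ q) ^ (1 / q)) ^ p := by
          gcongr
      _ = C ^ (p / q) * (h x ^ p * ∫⁻ y, k x y * (f y * (h y)⁻¹) ^ p ∂μ) := by
          rw [ENNReal.mul_rpow_of_nonneg _ _ hp.le, ← ENNReal.rpow_mul, ← ENNReal.rpow_mul,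
            one_div_mul_cancel hp.ne', ENNReal.rpow_one,
            ENNReal.mul_rpow_of_nonneg _ _ (by positivity), ← ENNReal.rpow_mul,
            show 1 / q * p = p / q by ring, show q * (p / q) = p by field_simp]
          ring
  have hFm : Measurable fun y => (f y * (h y)⁻¹) ^ p := (hf.mul hh.inv).pow_const p
  calc ∫⁻ x, (∫⁻ y, k x y * f y ∂μ) ^ p ∂μ
      ≤ ∫⁻ x, C ^ (p / q) * (h x ^ p * ∫⁻ y, k x y * (f y * (h y)⁻¹) ^ p ∂μ) ∂μ :=
        lintegral_mono_ae hpt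
    _ = C ^ (p / q) * ∫⁻ x, ∫⁻ y, h x ^ p * (k x y * (f y * (h y)⁻¹) ^ p) ∂μ ∂μ := by
        have hm : Measurable fun x => ∫⁻ y, k x y * (f y * (h y)⁻¹) ^ p ∂μ :=
          (hk.mul (hFm.comp measurable_snd)).lintegral_prod_right'
        have hm2 : Measurable fun x => h x ^ p * ∫⁻ y, k x y * (f y * (h y)⁻¹) ^ p ∂μ :=
          (hh.pow_const p).mul hm
        rw [lintegral_const_mul _ hm2]
        congr 1
        refine lintegral_congr fun x => ?_
        exact (lintegral_const_mul (f := fun y => k x y * (f y * (h y)⁻¹) ^ p) _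
          ((hkx x).mul hFm)).symm
    _ = C ^ (p / q) * ∫⁻ y, ∫⁻ x, h x ^ p * (k x y * (f y * (h y)⁻¹) ^ p) ∂μ ∂μ := by
        congr 1
        refine lintegral_lintegral_swap (Measurable.aemeasurable ?_)
        exact ((hh.pow_const p).comp measurable_fst).mul (hk.mul (hFm.comp measurable_snd))
    _ ≤ C ^ (p / q) * ∫⁻ y, D * f y ^ p ∂μ := by
        refine mul_le_mul_right (lintegral_mono_ae ?_) _
        filter_upwards [hD, hpos] with y hy hy0
        have e : ∫⁻ x, h x ^ p * (k x y * (f y * (h y)⁻¹) ^ p) ∂μ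
            = (∫⁻ x, k y x * h x ^ p ∂μ) * (f y * (h y)⁻¹) ^ p := by
          rw [← lintegral_mul_const (f := fun x => k y x * h x ^ p) _
            ((hkx y).mul (hh.pow_const p))]
          refine lintegral_congr fun x => ?_
          rw [hsymm x y]; ring
        rw [e]
        calc _ ≤ D * h y ^ p * (f y * (h y)⁻¹) ^ p := by gcongr
          _ = D * ((h y)⁻¹ * h y * f y) ^ p := by
            rw [mul_assoc, ← ENNReal.mul_rpow_of_nonneg _ _ hp.le]
            congr 2; ring
          _ = _ := by rw [ENNReal.inv_mul_cancel hy0.1 hy0.2, one_mul]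
    _ = C ^ (p / q) * D * ∫⁻ x, f x ^ p ∂μ := by
        rw [lintegral_const_mul _ (hf.pow_const p), mul_assoc]

theorem setLIntegral_Ioo_one_sub (f : ℝ → ℝ≥0∞) :
    ∫⁻ r in Ioo (0 : ℝ) 1, f (1 - r) = ∫⁻ x in Ioo (0 : ℝ) 1, f x := by
  rw [← lintegral_indicator measurableSet_Ioo, ← lintegral_indicator measurableSet_Ioo,
    ← lintegral_sub_left_eq_self _ (1 : ℝ)]
  refine lintegral_congr fun r => ?_
  by_cases h : r ∈ Ioo (0 : ℝ) 1
  · rw [indicator_of_mem h, indicator_of_mem (by constructor <;> linarith [h.1, h.2]),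
      sub_sub_cancel]
  · rw [indicator_of_notMem h, indicator_of_notMem]
    exact fun h' => h (by constructor <;> linarith [h'.1, h'.2])

/-- The integral is split at x = δ. Below δ the integrand is x^(-ε)/δ, integrable at 0 because ε <
1; above δ it is x^(-ε-1), integrable at infinity because ε > 0. Both parts scale as δ^(-ε). -/
theorem lintegral_rpow_div_max_le {ε δ : ℝ} (h0 : 0 < ε) (h1 : ε < 1) (hδ : 0 < δ) :
    ∫⁻ x in Ioo (0 : ℝ) 1, ENNReal.ofReal (x ^ (-ε) / max δ x)
      ≤ ENNReal.ofReal ((1 / (1 - ε) + 1 / ε) * δ ^ (-ε)) := by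
  have hA : ∫⁻ x in Ioc 0 δ, ENNReal.ofReal (x ^ (-ε) / max δ x)
      ≤ ENNReal.ofReal (1 / (1 - ε) * δ ^ (-ε)) := by
    have e : ∫ x in Ioc 0 δ, δ⁻¹ * x ^ (-ε) = 1 / (1 - ε) * δ ^ (-ε) := by
      rw [integral_const_mul, ← intervalIntegral.integral_of_le hδ.le,
        integral_rpow (Or.inl (by linarith)), Real.zero_rpow (by linarith), sub_zero,
        Real.rpow_add_one hδ.ne']
      have : 1 - ε ≠ 0 := by linarith
      have : -ε + 1 ≠ 0 := by linarith
      field_simp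
      ring
    rw [← e, ofReal_integral_eq_lintegral_ofReal]
    · refine setLIntegral_mono' measurableSet_Ioc fun x hx => ENNReal.ofReal_le_ofReal ?_
      have := Real.rpow_nonneg hx.1.le (-ε)
      rw [div_eq_inv_mul]
      gcongr
      exact le_max_left _ _
    · have := (intervalIntegral.intervalIntegrable_rpow' (a := 0) (b := δ) (r := -ε)
        (by linarith)).1
      exact this.const_mul _
    · filter_upwards [ae_restrict_mem measurableSet_Ioc] with x hx
      have := Real.rpow_nonneg hx.1.le (-ε)
      positivity
  have hB : ∫⁻ x in Ioi δ, ENNReal.ofReal (x ^ (-ε) / max δ x)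
      ≤ ENNReal.ofReal (1 / ε * δ ^ (-ε)) := by
    have e : ∫ x in Ioi δ, x ^ (-ε - 1) = 1 / ε * δ ^ (-ε) := by
      rw [integral_Ioi_rpow_of_lt (by linarith) hδ]
      ring_nf
    rw [← e, ofReal_integral_eq_lintegral_ofReal]
    · refine setLIntegral_mono' measurableSet_Ioi fun x hx => ENNReal.ofReal_le_ofReal ?_
      have hx0 : 0 < x := hδ.trans hx
      rw [Real.rpow_sub_one hx0.ne', max_eq_right (le_of_lt hx)]
    · exact integrableOn_Ioi_rpow_of_lt (by linarith) hδ
    · filter_upwards [ae_restrict_mem measurableSet_Ioi] with x hx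
      exact Real.rpow_nonneg (hδ.trans hx).le _
  calc ∫⁻ x in Ioo (0 : ℝ) 1, ENNReal.ofReal (x ^ (-ε) / max δ x)
      ≤ ∫⁻ x in Ioc 0 δ ∪ Ioi δ, ENNReal.ofReal (x ^ (-ε) / max δ x) := by
        refine lintegral_mono_set fun x hx => ?_
        rw [Ioc_union_Ioi_eq_Ioi hδ.le]
        exact hx.1
    _ ≤ _ := (lintegral_union_le _ _ _).trans (add_le_add hA hB)
    _ = _ := by
        have : 0 < 1 - ε := by linarith
        rw [← ENNReal.ofReal_add (by positivity) (by positivity), add_mul]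

/-- The radial Forelli–Rudin estimate. -/
theorem lintegral_forelliRudin_le {u ε : ℝ} (hu : 0 < u) (h0 : 0 < ε) (h1 : ε < 1) {ρ : ℝ}
    (hρ0 : 0 ≤ ρ) (hρ : ρ < 1) :
    ∫⁻ r in Ioo (0 : ℝ) 1, ENNReal.ofReal (r ^ (u - 1) * (1 - r) ^ (-ε) / (1 - ρ ^ 2 * r ^ 2))
      ≤ ENNReal.ofReal (4 / u + 2 * (1 / (1 - ε) + 1 / ε)) * ENNReal.ofReal ((1 - ρ) ^ (-ε)) := by
  have hδ : 0 < 1 - ρ := by linarith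
  -- The singularities at r = 0 and r = 1 are separated at 1/2. For r ≤ 1/2 the factor (1-r)^(-ε) is
  -- at most 2 and the denominator at least 1/2, whence the 4. For r ≥ 1/2 one has r^(u-1) ≤ 2 for
  -- every u > 0, and the denominator is at least max(1-ρ, 1-r).
  have hpt : ∀ r ∈ Ioo (0 : ℝ) 1, r ^ (u - 1) * (1 - r) ^ (-ε) / (1 - ρ ^ 2 * r ^ 2)
      ≤ 4 * r ^ (u - 1) + 2 * ((1 - r) ^ (-ε) / max (1 - ρ) (1 - r)) := fun r hr => by
    have hr1 : 0 < 1 - r := by linarith [hr.2]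
    have ha : 0 ≤ r ^ (u - 1) := Real.rpow_nonneg hr.1.le _
    have hb : 0 ≤ (1 - r) ^ (-ε) := Real.rpow_nonneg hr1.le _
    have hρr : ρ * r ≤ ρ := mul_le_of_le_one_right hρ0 hr.2.le
    have hρr2 : ρ * r ≤ r := mul_le_of_le_one_left hr.1.le hρ.le
    have hρr0 : 0 ≤ ρ * r := mul_nonneg hρ0 hr.1.le
    have hden : max (1 - ρ) (1 - r) ≤ 1 - ρ ^ 2 * r ^ 2 := by
      refine max_le ?_ ?_ <;> nlinarith
    have hmax : 0 < max (1 - ρ) (1 - r) := lt_max_of_lt_left hδ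
    rcases le_total r (1 / 2) with h | h
    · have e1 : (1 - r) ^ (-ε) ≤ 2 := by
        calc (1 - r) ^ (-ε) ≤ (1 - r) ^ (-1 : ℝ) :=
              Real.rpow_le_rpow_of_exponent_ge hr1 (by linarith [hr.1]) (by linarith)
          _ ≤ 2 := by
              rw [Real.rpow_neg_one, inv_le_comm₀ hr1 two_pos]; linarith
      have e2 : (1 / 2 : ℝ) ≤ 1 - ρ ^ 2 * r ^ 2 := le_trans (by linarith [le_max_right (1 - ρ) (1 - r)])
        hden
      have : r ^ (u - 1) * (1 - r) ^ (-ε) / (1 - ρ ^ 2 * r ^ 2) ≤ r ^ (u - 1) * 2 / (1 / 2) := by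
        gcongr
      have h3 : 0 ≤ 2 * ((1 - r) ^ (-ε) / max (1 - ρ) (1 - r)) := by positivity
      linarith
    · have e1 : r ^ (u - 1) ≤ 2 := by
        calc r ^ (u - 1) ≤ r ^ (-1 : ℝ) :=
              Real.rpow_le_rpow_of_exponent_ge hr.1 hr.2.le (by linarith)
          _ ≤ 2 := by
              rw [Real.rpow_neg_one, inv_le_comm₀ hr.1 two_pos]; linarith
      have : r ^ (u - 1) * (1 - r) ^ (-ε) / (1 - ρ ^ 2 * r ^ 2)
          ≤ 2 * (1 - r) ^ (-ε) / max (1 - ρ) (1 - r) := by gcongr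
      rw [mul_div_assoc 2] at this
      linarith
  have hA : ∫⁻ r in Ioo (0 : ℝ) 1, ENNReal.ofReal (4 * r ^ (u - 1)) = ENNReal.ofReal (4 / u) := by
    have e : ∫ r in Ioo (0 : ℝ) 1, 4 * r ^ (u - 1) = 4 / u := by
      rw [integral_const_mul, ← integral_Ioc_eq_integral_Ioo,
        ← intervalIntegral.integral_of_le zero_le_one, integral_rpow (Or.inl (by linarith)),
        Real.zero_rpow (by linarith)]
      simp [div_eq_mul_inv]
    rw [← e, ofReal_integral_eq_lintegral_ofReal]
    · have : IntegrableOn (fun r : ℝ => r ^ (u - 1)) (Ioo 0 1) :=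
        (intervalIntegral.integrableOn_Ioo_rpow_iff one_pos).2 (by linarith)
      exact this.const_mul _
    · filter_upwards [ae_restrict_mem measurableSet_Ioo] with r hr
      have := Real.rpow_nonneg hr.1.le (u - 1)
      positivity
  have hB := lintegral_rpow_div_max_le h0 h1 hδ
  rw [← setLIntegral_Ioo_one_sub] at hB
  have hδ1 : 1 ≤ (1 - ρ) ^ (-ε) :=
    Real.one_le_rpow_of_pos_of_le_one_of_nonpos hδ (by linarith) (by linarith)
  have h1ε : 0 < 1 - ε := by linarith
  calc _ ≤ ∫⁻ r in Ioo (0 : ℝ) 1, (ENNReal.ofReal (4 * r ^ (u - 1))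
        + ENNReal.ofReal 2 * ENNReal.ofReal ((1 - r) ^ (-ε) / max (1 - ρ) (1 - r))) := by
        refine setLIntegral_mono' measurableSet_Ioo fun r hr => ?_
        rw [← ENNReal.ofReal_mul two_pos.le]
        exact (ENNReal.ofReal_le_ofReal (hpt r hr)).trans ENNReal.ofReal_add_le
    _ = ENNReal.ofReal (4 / u) + ENNReal.ofReal 2 *
        ∫⁻ r in Ioo (0 : ℝ) 1, ENNReal.ofReal ((1 - r) ^ (-ε) / max (1 - ρ) (1 - r)) := by
        rw [lintegral_add_left (by fun_prop), hA, lintegral_const_mul' _ _ ENNReal.ofReal_ne_top]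
    _ ≤ ENNReal.ofReal (4 / u) + ENNReal.ofReal 2 *
        ENNReal.ofReal ((1 / (1 - ε) + 1 / ε) * (1 - ρ) ^ (-ε)) := by gcongr
    _ = ENNReal.ofReal (4 / u + 2 * ((1 / (1 - ε) + 1 / ε) * (1 - ρ) ^ (-ε))) := by
        rw [← ENNReal.ofReal_mul two_pos.le, ← ENNReal.ofReal_add (by positivity) (by positivity)]
    _ ≤ _ := by
        rw [← ENNReal.ofReal_mul (by positivity)]
        refine ENNReal.ofReal_le_ofReal ?_
        have : 4 / u ≤ 4 / u * (1 - ρ) ^ (-ε) := le_mul_of_one_le_right (by positivity) hδ1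
        linarith

/-- The test functions for the Schur test on the disk. -/
noncomputable def schurWeight (ε b : ℝ) (w : ℂ) : ℝ≥0∞ :=
  ENNReal.ofReal ((1 - ‖w‖) ^ (-ε) * ‖w‖ ^ (-b))

@[fun_prop]
theorem measurable_schurWeight (ε b : ℝ) : Measurable (schurWeight ε b) := by
  unfold schurWeight
  have h1 : Measurable fun w : ℂ => (1 - ‖w‖) ^ (-ε) := (by fun_prop : Measurable fun w : ℂ =>
    1 - ‖w‖).pow_const _
  have h2 : Measurable fun w : ℂ => ‖w‖ ^ (-b) := measurable_norm.pow_const _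
  exact (h1.mul h2).ennreal_ofReal

theorem schurWeight_rpow (ε b : ℝ) {q : ℝ} (hq : 0 < q) {w : ℂ} (hw : w ∈ ball (0 : ℂ) 1) :
    schurWeight ε b w ^ q = schurWeight (ε * q) (b * q) w := by
  have h : 0 ≤ 1 - ‖w‖ := by rw [mem_ball_zero_iff] at hw; linarith
  have h1 := Real.rpow_nonneg h (-ε)
  have h2 := Real.rpow_nonneg (norm_nonneg w) (-b)
  rw [schurWeight, schurWeight, ENNReal.ofReal_rpow_of_nonneg (mul_nonneg h1 h2) hq.le,
    Real.mul_rpow h1 h2, ← Real.rpow_mul h, ← Real.rpow_mul (norm_nonneg w), neg_mul, neg_mul]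

theorem schurWeight_ne_zero (ε b : ℝ) {w : ℂ} (hw : w ∈ ball (0 : ℂ) 1) (hw0 : w ≠ 0) :
    schurWeight ε b w ≠ 0 := by
  have h : 0 < 1 - ‖w‖ := by rw [mem_ball_zero_iff] at hw; linarith
  have := norm_pos_iff.2 hw0
  rw [schurWeight, Ne, ENNReal.ofReal_eq_zero, not_le]
  positivity

/-- The condition -m ≤ b permits replacing |w|^m by the larger |w|^(-b), the power wanted on the
right. The radial density in ζ is then r^(u-1) with u = 2c - m - b, and b < 2c - m makes it
integrable at 0. -/
theorem lintegral_diskKernel_mul_schurWeight_le {c : ℝ} (h0 : 0 < c) (h1 : c ≤ 1) {m : ℤ}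
    {ε b : ℝ} (hε0 : 0 < ε) (hε1 : ε < 1) (hb : -m ≤ b) (hb' : b < 2 * c - m) :
    ∃ C : ℝ≥0∞, C ≠ ∞ ∧ ∀ w ∈ ball (0 : ℂ) 1, w ≠ 0 →
      ∫⁻ ζ, ‖diskKernel c m w ζ‖ₑ * schurWeight ε b ζ ∂(diskMeasure (2 * c - 2 - 2 * m))
        ≤ C * schurWeight ε b w := by
  set u := 2 * c - m - b with hu
  have hu0 : 0 < u := by linarith
  refine ⟨ENNReal.ofReal (2 * π) * ENNReal.ofReal (4 / u + 2 * (1 / (1 - ε) + 1 / ε)),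
    ENNReal.mul_ne_top ENNReal.ofReal_ne_top ENNReal.ofReal_ne_top, fun w hw hw0 => ?_⟩
  have hw' : ‖w‖ < 1 := by simpa using hw
  have hwp : 0 < ‖w‖ := norm_pos_iff.2 hw0
  set φ : ℝ → ℝ≥0∞ := fun r => ENNReal.ofReal (r ^ (m - b) * (1 - r) ^ (-ε)) with hφ
  have hφm : Measurable φ := by
    have e1 : Measurable fun r : ℝ => (1 - r) ^ (-ε) :=
      (by fun_prop : Measurable fun r : ℝ => 1 - r).pow_const _
    exact ((measurable_id.pow_const _).mul e1).ennreal_ofReal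
  calc ∫⁻ ζ, ‖diskKernel c m w ζ‖ₑ * schurWeight ε b ζ ∂(diskMeasure (2 * c - 2 - 2 * m))
      ≤ ∫⁻ ζ, ENNReal.ofReal (‖w‖ ^ (-b)) * (φ ‖ζ‖ * ‖1 - w * conj ζ‖ₑ⁻¹ ^ 2)
          ∂(diskMeasure (2 * c - 2 - 2 * m)) := by
        refine lintegral_mono_ae ?_
        filter_upwards [ae_diskMeasure_mem (2 * c - 2 - 2 * m)] with ζ hζ
        have hζ' : ‖ζ‖ < 1 := by simpa using hζ.1
        have hζp : 0 < ‖ζ‖ := norm_pos_iff.2 hζ.2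
        have hlt := norm_mul_conj_lt hw hζ.1
        have hpi : ‖(π : ℂ)⁻¹‖ ≤ 1 := by
          rw [norm_inv, Complex.norm_of_nonneg Real.pi_pos.le]
          exact inv_le_one_of_one_le₀ (by linarith [Real.pi_gt_three])
        have hK : ‖diskKernel c m w ζ‖
            ≤ ‖w‖ ^ (-b) * ‖ζ‖ ^ (m : ℝ) * ‖1 - w * conj ζ‖⁻¹ ^ 2 := by
          rw [diskKernel, norm_mul, norm_mul, mul_zpow, norm_mul, norm_zpow, norm_zpow,
            RCLike.norm_conj, Real.rpow_intCast]
          have e1 : ‖w‖ ^ m ≤ ‖w‖ ^ (-b) := by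
            rw [← Real.rpow_intCast]
            exact Real.rpow_le_rpow_of_exponent_ge hwp hw'.le (by linarith)
          calc _ ≤ 1 * (‖w‖ ^ (-b) * ‖ζ‖ ^ m) * ‖1 - w * conj ζ‖⁻¹ ^ 2 := by
                gcongr
                exact norm_symbol_le h0.le h1 hlt.le
            _ = _ := by ring
        have hn : 0 < ‖1 - w * conj ζ‖ := norm_pos_iff.2 (one_sub_ne_zero hlt)
        have h1ζ : 0 ≤ (1 - ‖ζ‖) ^ (-ε) := Real.rpow_nonneg (by linarith) _
        have e3 : ‖1 - w * conj ζ‖ₑ⁻¹ ^ 2 = ENNReal.ofReal (‖1 - w * conj ζ‖⁻¹ ^ 2) := by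
          rw [ENNReal.ofReal_pow (by positivity), ENNReal.ofReal_inv_of_pos hn, ofReal_norm]
        rw [← ofReal_norm (diskKernel c m w ζ), schurWeight, hφ, e3,
          ← ENNReal.ofReal_mul (norm_nonneg _), ← ENNReal.ofReal_mul (by positivity),
          ← ENNReal.ofReal_mul (by positivity)]
        refine ENNReal.ofReal_le_ofReal ?_
        calc _ ≤ ‖w‖ ^ (-b) * ‖ζ‖ ^ (m : ℝ) * ‖1 - w * conj ζ‖⁻¹ ^ 2
              * ((1 - ‖ζ‖) ^ (-ε) * ‖ζ‖ ^ (-b)) := by gcongr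
          _ = _ := by
            rw [sub_eq_add_neg (m : ℝ) b, Real.rpow_add hζp]; ring
    _ = ENNReal.ofReal (‖w‖ ^ (-b)) * (ENNReal.ofReal (2 * π) * ∫⁻ r in Ioo (0 : ℝ) 1,
          ENNReal.ofReal (r ^ (u - 1) * (1 - r) ^ (-ε) / (1 - ‖w‖ ^ 2 * r ^ 2))) := by
        rw [lintegral_const_mul' _ _ ENNReal.ofReal_ne_top,
          lintegral_radial_mul_kernel _ hφm hw'.le, lintegral_radialMeasure]
        congr 1
        rw [← lintegral_const_mul' _ _ ENNReal.ofReal_ne_top]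
        refine setLIntegral_congr_fun measurableSet_Ioo fun r hr => ?_
        have h2 : 0 ≤ (1 - r) ^ (-ε) := Real.rpow_nonneg (by linarith [hr.2]) _
        have h3 := Real.rpow_nonneg hr.1.le (m - b)
        simp only [hφ]
        rw [← ENNReal.ofReal_mul (mul_nonneg h3 h2),
          ← ENNReal.ofReal_mul (Real.rpow_nonneg hr.1.le _), ← ENNReal.ofReal_mul (by positivity)]
        congr 1
        rw [show u - 1 = (2 * c - 2 - 2 * m + 1) + (m - b) by rw [hu]; ring,
          Real.rpow_add hr.1 (2 * c - 2 - 2 * m + 1)]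
        ring
    _ ≤ ENNReal.ofReal (‖w‖ ^ (-b)) * (ENNReal.ofReal (2 * π) *
          (ENNReal.ofReal (4 / u + 2 * (1 / (1 - ε) + 1 / ε))
            * ENNReal.ofReal ((1 - ‖w‖) ^ (-ε)))) := by
        gcongr
        exact lintegral_forelliRudin_le hu0 hε0 hε1 hwp.le hw'
    _ = _ := by
        have h2 : 0 ≤ (1 - ‖w‖) ^ (-ε) := Real.rpow_nonneg (by linarith) _
        rw [schurWeight, ENNReal.ofReal_mul h2]
        ring

theorem enorm_diskKernel_comm (c : ℝ) (m : ℤ) (w ζ : ℂ) :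
    ‖diskKernel c m w ζ‖ₑ = ‖diskKernel c m ζ w‖ₑ := by
  have : diskKernel c m ζ w = conj (diskKernel c m w ζ) := by
    rw [conj_diskKernel, diskKernel, mul_comm ζ]
  rw [this, RCLike.enorm_conj]

theorem enorm_hartogsKernel_comm (c : ℝ) (m : ℤ) (z ζ : ℂ × ℂ) :
    ‖hartogsKernel c m z ζ‖ₑ = ‖hartogsKernel c m ζ z‖ₑ := by
  rw [hartogsKernel, hartogsKernel, enorm_mul, enorm_mul, enorm_diskKernel_comm 1 0,
    enorm_diskKernel_comm c m]

instance (s' : ℝ) : SFinite (hartogsMeasure s') := by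
  rw [← (measurePreserving_hartogsMap s').map_eq]
  infer_instance

/-- The test functions for the Schur test on the Hartogs triangle. -/
noncomputable def hartogsSchurWeight (ε b : ℝ) (z : ℂ × ℂ) : ℝ≥0∞ :=
  schurWeight ε 0 (hartogsCoord z).1 * schurWeight ε b (hartogsCoord z).2

@[fun_prop]
theorem measurable_hartogsSchurWeight (ε b : ℝ) : Measurable (hartogsSchurWeight ε b) := by
  unfold hartogsSchurWeight; fun_prop

theorem ae_hartogsCoord_mem (s' : ℝ) : ∀ᵐ z ∂(hartogsMeasure s'),
    ((hartogsCoord z).1 ∈ ball (0 : ℂ) 1 ∧ (hartogsCoord z).1 ≠ 0) ∧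
      ((hartogsCoord z).2 ∈ ball (0 : ℂ) 1 ∧ (hartogsCoord z).2 ≠ 0) :=
  (measurePreserving_hartogsCoord s').quasiMeasurePreserving.ae (ae_prod_diskMeasure_mem 0 (s' + 2))

/-- Kernel, measure and test function all factor in the product coordinates, so the disk estimate is
used twice, the first factor being the case c = 1, m = b = 0. -/
theorem lintegral_hartogsKernel_mul_schurWeight_le {c : ℝ} (h0 : 0 < c) (h1 : c ≤ 1) {m : ℤ}
    {s' : ℝ} (hs : s' + 2 = 2 * c - 2 - 2 * m) {ε b r : ℝ} (hr : 0 < r) (hε0 : 0 < ε * r)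
    (hε1 : ε * r < 1) (hb : -m ≤ b * r) (hb' : b * r < 2 * c - m) :
    ∃ C : ℝ≥0∞, C ≠ ∞ ∧ ∀ᵐ z ∂(hartogsMeasure s'),
      ∫⁻ ζ, ‖hartogsKernel c m z ζ‖ₑ * hartogsSchurWeight ε b ζ ^ r ∂(hartogsMeasure s')
        ≤ C * hartogsSchurWeight ε b z ^ r := by
  obtain ⟨C, hC, hCle⟩ := lintegral_diskKernel_mul_schurWeight_le h0 h1 hε0 hε1 hb hb'
  obtain ⟨D, hD, hDle⟩ := lintegral_diskKernel_mul_schurWeight_le one_pos le_rfl (m := 0)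
    hε0 hε1 (b := 0) (by norm_num) (by norm_num)
  norm_num at hDle
  refine ⟨D * C, ENNReal.mul_ne_top hD hC, ?_⟩
  have hpow : ∀ z : ℂ × ℂ, (hartogsCoord z).1 ∈ ball (0 : ℂ) 1 →
      (hartogsCoord z).2 ∈ ball (0 : ℂ) 1 → hartogsSchurWeight ε b z ^ r
        = schurWeight (ε * r) 0 (hartogsCoord z).1 * schurWeight (ε * r) (b * r) (hartogsCoord z).2 :=
    fun z hz1 hz2 => by
      rw [hartogsSchurWeight, ENNReal.mul_rpow_of_nonneg _ _ hr.le, schurWeight_rpow _ _ hr hz1,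
        schurWeight_rpow _ _ hr hz2, zero_mul]
  filter_upwards [ae_hartogsCoord_mem s'] with z hz
  set k₁ : ℂ → ℝ≥0∞ := fun a => ‖diskKernel 1 0 (hartogsCoord z).1 a‖ₑ * schurWeight (ε * r) 0 a
  set k₂ : ℂ → ℝ≥0∞ := fun a =>
    ‖diskKernel c m (hartogsCoord z).2 a‖ₑ * schurWeight (ε * r) (b * r) a
  have hk₁ : Measurable k₁ := ((measurable_diskKernel 1 0).comp
    (measurable_const.prodMk measurable_id)).enorm.mul (measurable_schurWeight _ _)
  have hk₂ : Measurable k₂ := ((measurable_diskKernel c m).comp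
    (measurable_const.prodMk measurable_id)).enorm.mul (measurable_schurWeight _ _)
  calc ∫⁻ ζ, ‖hartogsKernel c m z ζ‖ₑ * hartogsSchurWeight ε b ζ ^ r ∂(hartogsMeasure s')
      = ∫⁻ ζ, k₁ (hartogsCoord ζ).1 * k₂ (hartogsCoord ζ).2 ∂(hartogsMeasure s') := by
        refine lintegral_congr_ae ?_
        filter_upwards [ae_hartogsCoord_mem s'] with ζ hζ
        rw [hpow ζ hζ.1.1 hζ.2.1, hartogsKernel, enorm_mul]
        simp only [k₁, k₂]
        ring
    _ = (∫⁻ a, k₁ a ∂(diskMeasure 0)) * ∫⁻ a, k₂ a ∂(diskMeasure (s' + 2)) := by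
        rw [(measurePreserving_hartogsCoord s').lintegral_comp
          (f := fun w : ℂ × ℂ => k₁ w.1 * k₂ w.2) (by fun_prop),
          lintegral_prod_mul hk₁.aemeasurable hk₂.aemeasurable]
    _ ≤ (D * schurWeight (ε * r) 0 (hartogsCoord z).1)
          * (C * schurWeight (ε * r) (b * r) (hartogsCoord z).2) := by
        rw [hs]
        exact mul_le_mul' (hDle _ (by simpa using hz.1.1) hz.1.2) (hCle _ hz.2.1 hz.2.2)
    _ = _ := by
        rw [hpow z hz.1.1 hz.2.1]; ring

theorem bergmanProjectionLpBounded_of_lt {c : ℝ} (h0 : 0 < c) (h1 : c ≤ 1) {m : ℤ} {s' : ℝ}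
    (hs : s' + 2 = 2 * c - 2 - 2 * m) {p : ℝ} (hp : 1 < p) (hp1 : 0 < m * p + (2 * c - 2 * m))
    (hp2 : 0 < m * p + (2 * c - 2 * m) * (p - 1)) :
    BergmanProjectionLpBounded hartogsTriangle (hartogsWeight s') p := by
  have hpq := Real.HolderConjugate.conjExponent hp
  set q := Real.conjExponent p with hq_def
  have hp0 : 0 < p := hpq.pos
  have hq0 : 0 < q := hpq.symm.pos
  have hq1 : 1 < q := hpq.symm.lt
  have hqp : q * (p - 1) = p := by
    rw [hq_def, Real.conjExponent, div_mul_cancel₀]; linarith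
  -- With this choice εp = 1/q and εq = 1/p, both in (0, 1).
  set ε := 1 / (p * q) with hε
  -- This is the least b with -m ≤ bp and -m ≤ bq. The upper bounds bp < 2c - m and bq < 2c - m then
  -- amount to the hypotheses `hp1` and `hp2` respectively, the other entry of each maximum being
  -- -m.
  set b := max (-m / p) (-m / q) with hb
  have hεp : ε * p = 1 / q := by rw [hε]; field_simp
  have hεq : ε * q = 1 / p := by rw [hε]; field_simp
  have hmp : -m / p * q * (p - 1) = -m := by
    rw [mul_assoc, hqp]; field_simp
  have hmq : -m / q * p = -m * (p - 1) := by
    rw [div_mul_eq_mul_div, div_eq_iff hq0.ne', mul_assoc, mul_comm (p - 1), hqp]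
  have hbp : -m ≤ b * p := by
    have h3 : -m / p ≤ b := le_max_left _ _
    calc (-m : ℝ) = -m / p * p := by field_simp
      _ ≤ b * p := by gcongr
  have hbq : -m ≤ b * q := by
    have h3 : -m / q ≤ b := le_max_right _ _
    calc (-m : ℝ) = -m / q * q := by field_simp
      _ ≤ b * q := by gcongr
  have hbp' : b * p < 2 * c - m := by
    rw [hb, max_mul_of_nonneg _ _ hp0.le, hmq, div_mul_cancel₀ _ hp0.ne', max_lt_iff]
    constructor <;> linarith
  have hbq' : b * q < 2 * c - m := by
    rw [hb, max_mul_of_nonneg _ _ hq0.le, div_mul_cancel₀ _ hq0.ne', max_lt_iff]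
    refine ⟨?_, by linarith⟩
    have : 0 < p - 1 := by linarith
    refine lt_of_mul_lt_mul_right ?_ this.le
    rw [hmp]
    linarith
  obtain ⟨C, hC, hCle⟩ := lintegral_hartogsKernel_mul_schurWeight_le h0 h1 hs (ε := ε) (b := b)
    hq0 (by rw [hεq]; positivity) (by rw [hεq, div_lt_one hp0]; exact hp) hbq hbq'
  obtain ⟨D, hD, hDle⟩ := lintegral_hartogsKernel_mul_schurWeight_le h0 h1 hs (ε := ε) (b := b)
    hp0 (by rw [hεp]; positivity) (by rw [hεp, div_lt_one hq0]; exact hq1) hbp hbp'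
  have hA : (C ^ (p / q) * D) ^ (1 / p) ≠ ∞ := by
    refine ENNReal.rpow_ne_top_of_nonneg (by positivity) (ENNReal.mul_ne_top ?_ hD)
    exact ENNReal.rpow_ne_top_of_nonneg (by positivity) hC
  refine ⟨((C ^ (p / q) * D) ^ (1 / p)).toNNReal, fun f _ => ?_⟩
  rw [ENNReal.coe_toNNReal hA, eLpNorm_congr_ae (bergmanProjection_ae_eq h0 h1 hs f),
    eLpNorm_eq_lintegral_rpow_enorm_toReal (by simpa using hp0) ENNReal.ofReal_ne_top,
    eLpNorm_eq_lintegral_rpow_enorm_toReal (by simpa using hp0) ENNReal.ofReal_ne_top,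
    ENNReal.toReal_ofReal hp0.le, ← ENNReal.mul_rpow_of_nonneg _ _ (by positivity)]
  have hpos : ∀ᵐ z ∂(hartogsMeasure s'),
      hartogsSchurWeight ε b z ≠ 0 ∧ hartogsSchurWeight ε b z ≠ ∞ := by
    filter_upwards [ae_hartogsCoord_mem s'] with z hz
    exact ⟨mul_ne_zero (schurWeight_ne_zero _ _ hz.1.1 hz.1.2)
      (schurWeight_ne_zero _ _ hz.2.1 hz.2.2),
      ENNReal.mul_ne_top ENNReal.ofReal_ne_top ENNReal.ofReal_ne_top⟩
  have hschur := lintegral_rpow_le_of_schur (k := fun z ζ => ‖hartogsKernel c m z ζ‖ₑ)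
    (measurable_hartogsKernel c m).enorm (enorm_hartogsKernel_comm c m)
    (measurable_hartogsSchurWeight ε b) hpos hpq hCle hDle
    (Lp.stronglyMeasurable f).measurable.enorm
  gcongr ?_ ^ (1 / p)
  refine le_trans (lintegral_mono fun z => ?_) hschur
  gcongr
  refine (enorm_integral_le_lintegral_enorm _).trans (le_of_eq ?_)
  simp only [enorm_mul]

/-! ### Necessity: tensor products and truncated powers. -/

/-- The integral operator on the disk with kernel `diskKernel c m`. -/
noncomputable def diskOperator (c : ℝ) (m : ℤ) (t : ℝ) (F : ℂ → ℂ) (w : ℂ) : ℂ :=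
  ∫ ζ, diskKernel c m w ζ * F ζ ∂(diskMeasure t)

theorem stronglyMeasurable_diskOperator (c : ℝ) (m : ℤ) (t : ℝ) {F : ℂ → ℂ} (hF : Measurable F) :
    StronglyMeasurable (diskOperator c m t F) := by
  have : Measurable fun p : ℂ × ℂ => diskKernel c m p.1 p.2 * F p.2 :=
    (measurable_diskKernel c m).mul (hF.comp measurable_snd)
  exact this.stronglyMeasurable.integral_prod_right'

theorem measurable_diskKernel_right (c : ℝ) (m : ℤ) (w : ℂ) : Measurable (diskKernel c m w) :=
  Measurable.of_uncurry_left (f := diskKernel c m) (measurable_diskKernel c m)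

theorem integral_mul_comp_hartogsCoord (s' : ℝ) {f g : ℂ → ℂ} (hf : Measurable f)
    (hg : Measurable g) :
    ∫ ζ, f (hartogsCoord ζ).1 * g (hartogsCoord ζ).2 ∂(hartogsMeasure s')
      = (∫ a, f a ∂(diskMeasure 0)) * ∫ b, g b ∂(diskMeasure (s' + 2)) := by
  have hΨ := measurePreserving_hartogsCoord s'
  have hm : Measurable fun w : ℂ × ℂ => f w.1 * g w.2 := by fun_prop
  rw [← integral_prod_mul, ← hΨ.map_eq,
    integral_map hΨ.measurable.aemeasurable hm.aestronglyMeasurable]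

/-- On a tensor product the projection acts factor by factor and the norms multiply. Fixing one
factor turns boundedness into an inequality on a single disk. -/
theorem eLpNorm_diskOperator_mul_le {c : ℝ} (h0 : 0 < c) (h1 : c ≤ 1) {m : ℤ} {s' : ℝ}
    (hs : s' + 2 = 2 * c - 2 - 2 * m) {p : ℝ} (hp : 0 < p)
    (hB : BergmanProjectionLpBounded hartogsTriangle (hartogsWeight s') p) :
    ∃ C : ℝ≥0, ∀ F G : ℂ → ℂ, Measurable F → Measurable G → MemLp F 2 (diskMeasure 0) →
      MemLp G 2 (diskMeasure (s' + 2)) → MemLp F (ENNReal.ofReal p) (diskMeasure 0) →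
      MemLp G (ENNReal.ofReal p) (diskMeasure (s' + 2)) →
      eLpNorm (diskOperator 1 0 0 F) (ENNReal.ofReal p) (diskMeasure 0)
        * eLpNorm (diskOperator c m (s' + 2) G) (ENNReal.ofReal p) (diskMeasure (s' + 2))
        ≤ C * (eLpNorm F (ENNReal.ofReal p) (diskMeasure 0)
          * eLpNorm G (ENNReal.ofReal p) (diskMeasure (s' + 2))) := by
  obtain ⟨C, hC⟩ := hB
  refine ⟨C, fun F G hF hG hF2 hG2 hFp hGp => ?_⟩
  have hΨ := measurePreserving_hartogsCoord s'
  have hp0 : ENNReal.ofReal p ≠ 0 := by simpa using hp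
  have hpt : ENNReal.ofReal p ≠ ∞ := ENNReal.ofReal_ne_top
  have hTF := (stronglyMeasurable_diskOperator 1 0 0 hF).aestronglyMeasurable (μ := diskMeasure 0)
  have hTG := (stronglyMeasurable_diskOperator c m (s' + 2) hG).aestronglyMeasurable
    (μ := diskMeasure (s' + 2))
  have hprod : Measurable fun w : ℂ × ℂ => F w.1 * G w.2 := by fun_prop
  have hf2 : MemLp (fun z => F (hartogsCoord z).1 * G (hartogsCoord z).2) 2 (hartogsMeasure s') :=
    (memLp_prod_mul two_ne_zero ENNReal.ofNat_ne_top hF2 hG2).comp_measurePreserving hΨ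
  have hfp : MemLp (fun z => F (hartogsCoord z).1 * G (hartogsCoord z).2) (ENNReal.ofReal p)
      (hartogsMeasure s') := (memLp_prod_mul hp0 hpt hFp hGp).comp_measurePreserving hΨ
  have h := hC (hf2.toLp _) ((memLp_congr_ae hf2.coeFn_toLp).2 hfp)
  rw [eLpNorm_congr_ae (bergmanProjection_ae_eq h0 h1 hs _), eLpNorm_congr_ae hf2.coeFn_toLp] at h
  have e1 : (fun z => ∫ ζ, hartogsKernel c m z ζ * hf2.toLp _ ζ ∂(hartogsMeasure s'))
      = (fun w : ℂ × ℂ => diskOperator 1 0 0 F w.1 * diskOperator c m (s' + 2) G w.2)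
          ∘ hartogsCoord := by
    funext z
    refine Eq.trans (integral_congr_ae ?_)
      (integral_mul_comp_hartogsCoord s' ((measurable_diskKernel_right 1 0 _).mul hF)
        ((measurable_diskKernel_right c m _).mul hG))
    filter_upwards [hf2.coeFn_toLp] with ζ hζ
    rw [hζ, hartogsKernel]
    ring
  have e3 : (fun z => F (hartogsCoord z).1 * G (hartogsCoord z).2)
      = (fun w : ℂ × ℂ => F w.1 * G w.2) ∘ hartogsCoord := rfl
  rw [e1, e3, eLpNorm_comp_measurePreserving (aestronglyMeasurable_prod_mul hTF hTG) hΨ,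
    eLpNorm_comp_measurePreserving hprod.aestronglyMeasurable hΨ,
    eLpNorm_prod_mul hTF hTG hp0 hpt,
    eLpNorm_prod_mul hF.aestronglyMeasurable hG.aestronglyMeasurable hp0 hpt] at h
  exact h

/-- Weighted mean value property for antiholomorphic functions and radial weights. -/
theorem integral_radial_mul_conj {t R : ℝ} {h : ℂ → ℂ} (hh : DifferentiableOn ℂ h (ball 0 R))
    {φ : ℝ → ℂ} (hφ : ∀ r, R ≤ r → φ r = 0)
    (hi : Integrable (fun ζ => φ ‖ζ‖) (diskMeasure t))
    (hi' : Integrable (fun ζ => φ ‖ζ‖ * conj (h ζ)) (diskMeasure t)) :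
    ∫ ζ, φ ‖ζ‖ * conj (h ζ) ∂(diskMeasure t)
      = (∫ ζ, φ ‖ζ‖ ∂(diskMeasure t)) * conj (h 0) := by
  rw [integral_diskMeasure_polar hi, integral_diskMeasure_polar hi', ← integral_mul_const]
  refine setIntegral_congr_fun measurableSet_Ioo fun r hr => ?_
  have hn : ∀ θ, ‖circleMap 0 r θ‖ = r := fun θ => by simp [abs_of_pos hr.1]
  have key : ∫ θ in Ioo (-π) π, φ r * conj (h (circleMap 0 r θ)) = 2 * π * (φ r * conj (h 0)) := by
    rw [integral_const_mul]
    by_cases hrR : r < R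
    · have hd : DiffContOnCl ℂ h (ball 0 |r|) := by
        refine DifferentiableOn.diffContOnCl ?_
        rw [abs_of_pos hr.1, closure_ball _ hr.1.ne']
        exact hh.mono (closedBall_subset_ball hrR)
      have h3 := integral_Ioo_circleMap h r
      rw [hd.circleAverage] at h3
      rw [integral_conj, h3]
      simp only [map_mul, Complex.conj_ofReal, Complex.conj_ofNat]
      ring
    · rw [hφ r (not_lt.1 hrR)]; simp
  have key1 : ∫ θ in Ioo (-π) π, φ r = 2 * π * φ r := by
    rw [setIntegral_const, Measure.real, Real.volume_Ioo, ENNReal.toReal_ofReal (by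
      linarith [Real.pi_pos]), Complex.real_smul]
    push_cast; ring
  have e1 := integral_Ioo_circleMap (fun ζ => φ ‖ζ‖ * conj (h ζ)) r
  have e2 := integral_Ioo_circleMap (fun ζ => φ ‖ζ‖) r
  simp only [hn] at e1 e2
  rw [← e1, ← e2, key, key1]
  simp only [Complex.real_smul]
  ring

/-- Away from the origin, raising the exponent costs only a constant; raised to at least -t, it
makes the power integrable on the whole disk. -/
theorem setLIntegral_norm_rpow_lt_top {δ : ℝ} (hδ : 0 < δ) (t e : ℝ) :
    ∫⁻ ζ in {ζ : ℂ | δ < ‖ζ‖}, ENNReal.ofReal (‖ζ‖ ^ e) ∂(diskMeasure t) < ∞ := by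
  set E := max e (-t) with hE
  have hm : MeasurableSet {ζ : ℂ | δ < ‖ζ‖} := measurableSet_lt measurable_const measurable_norm
  calc ∫⁻ ζ in {ζ : ℂ | δ < ‖ζ‖}, ENNReal.ofReal (‖ζ‖ ^ e) ∂(diskMeasure t)
      ≤ ∫⁻ ζ in {ζ : ℂ | δ < ‖ζ‖}, ENNReal.ofReal (δ ^ (e - E)) * ENNReal.ofReal (‖ζ‖ ^ E)
          ∂(diskMeasure t) := by
        refine setLIntegral_mono' hm fun ζ hζ => ?_
        have hζ0 : 0 < ‖ζ‖ := hδ.trans hζ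
        rw [← ENNReal.ofReal_mul (Real.rpow_nonneg hδ.le _)]
        refine ENNReal.ofReal_le_ofReal ?_
        calc ‖ζ‖ ^ e = ‖ζ‖ ^ (e - E) * ‖ζ‖ ^ E := by rw [← Real.rpow_add hζ0]; ring_nf
          _ ≤ δ ^ (e - E) * ‖ζ‖ ^ E := by
            refine mul_le_mul_of_nonneg_right ?_ (Real.rpow_nonneg hζ0.le _)
            exact Real.rpow_le_rpow_of_nonpos hδ (le_of_lt hζ) (by linarith [le_max_left e (-t)])
    _ ≤ ∫⁻ ζ, ENNReal.ofReal (δ ^ (e - E)) * ENNReal.ofReal (‖ζ‖ ^ E) ∂(diskMeasure t) :=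
        setLIntegral_le_lintegral _ _
    _ < ∞ := by
        rw [lintegral_const_mul' _ _ ENNReal.ofReal_ne_top]
        refine ENNReal.mul_lt_top ENNReal.ofReal_lt_top (lintegral_norm_rpow_lt_top_iff.2 ?_)
        linarith [le_max_right e (-t)]

theorem setLIntegral_norm_rpow_pos {δ : ℝ} (hδ0 : 0 < δ) (hδ : δ < 1) (t e : ℝ) :
    0 < ∫⁻ ζ in {ζ : ℂ | δ < ‖ζ‖}, ENNReal.ofReal (‖ζ‖ ^ e) ∂(diskMeasure t) := by
  have hm : MeasurableSet {ζ : ℂ | δ < ‖ζ‖} := measurableSet_lt measurable_const measurable_norm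
  have hφ : Measurable ((Ioi δ).indicator fun r : ℝ => ENNReal.ofReal (r ^ e)) :=
    Measurable.indicator (by fun_prop) measurableSet_Ioi
  have h1 : ∫⁻ ζ in {ζ : ℂ | δ < ‖ζ‖}, ENNReal.ofReal (‖ζ‖ ^ e) ∂(diskMeasure t)
      = ∫⁻ ζ, (Ioi δ).indicator (fun r : ℝ => ENNReal.ofReal (r ^ e)) ‖ζ‖ ∂(diskMeasure t) := by
    rw [← lintegral_indicator hm]
    rfl
  rw [h1, lintegral_radial t hφ]
  refine ENNReal.mul_pos (by simp [Real.pi_pos]) (ne_of_gt ?_)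
  rw [setLIntegral_pos_iff (by fun_prop)]
  refine lt_of_lt_of_le ?_ (measure_mono (s := Ioo δ 1) fun r hr => ?_)
  · simpa using hδ
  · have hr0 : 0 < r := hδ0.trans hr.1
    refine ⟨?_, hr0, hr.2⟩
    rw [Function.mem_support, indicator_of_mem (by exact hr.1)]
    have h3 := Real.rpow_pos_of_pos hr0 (t + 1)
    have h4 := Real.rpow_pos_of_pos hr0 e
    simp [h3, h4]

/-- The functions `ζ^m |ζ|^τ`, cut off near the origin. -/
noncomputable def cutoffPower (m : ℤ) (τ δ : ℝ) : ℂ → ℂ :=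
  {ζ : ℂ | δ < ‖ζ‖}.indicator fun ζ => ζ ^ m * (‖ζ‖ ^ τ : ℝ)

theorem measurable_cutoffPower (m : ℤ) (τ δ : ℝ) : Measurable (cutoffPower m τ δ) := by
  refine Measurable.indicator ?_ (measurableSet_lt measurable_const measurable_norm)
  exact (measurable_id.pow_const m).mul
    (Complex.measurable_ofReal.comp (measurable_norm.pow_const τ))

theorem eLpNorm_cutoffPower (m : ℤ) (τ : ℝ) {δ : ℝ} (hδ : 0 < δ) (t : ℝ) {p : ℝ} (hp : 0 < p) :
    eLpNorm (cutoffPower m τ δ) (ENNReal.ofReal p) (diskMeasure t)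
      = (∫⁻ ζ in {ζ : ℂ | δ < ‖ζ‖}, ENNReal.ofReal (‖ζ‖ ^ ((m + τ) * p)) ∂(diskMeasure t))
          ^ (1 / p) := by
  have hm : MeasurableSet {ζ : ℂ | δ < ‖ζ‖} := measurableSet_lt measurable_const measurable_norm
  rw [eLpNorm_eq_lintegral_rpow_enorm_toReal (by simpa using hp) ENNReal.ofReal_ne_top,
    ENNReal.toReal_ofReal hp.le, ← lintegral_indicator hm]
  congr 1
  refine lintegral_congr fun ζ => ?_
  by_cases h : ζ ∈ {ζ : ℂ | δ < ‖ζ‖}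
  · have hζ0 : 0 < ‖ζ‖ := hδ.trans h
    rw [indicator_of_mem h, cutoffPower, indicator_of_mem h, ← ofReal_norm,
      ENNReal.ofReal_rpow_of_nonneg (norm_nonneg _) hp.le, norm_mul, norm_zpow,
      Complex.norm_of_nonneg (Real.rpow_nonneg hζ0.le _), ← Real.rpow_intCast,
      ← Real.rpow_add hζ0, ← Real.rpow_mul hζ0.le]
  · rw [indicator_of_notMem h, cutoffPower, indicator_of_notMem h, enorm_zero,
      ENNReal.zero_rpow_of_pos hp]

theorem memLp_cutoffPower (m : ℤ) (τ : ℝ) {δ : ℝ} (hδ : 0 < δ) (t : ℝ) {p : ℝ} (hp : 0 < p) :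
    MemLp (cutoffPower m τ δ) (ENNReal.ofReal p) (diskMeasure t) := by
  refine ⟨(measurable_cutoffPower m τ δ).aestronglyMeasurable, ?_⟩
  rw [eLpNorm_cutoffPower m τ hδ t hp]
  exact ENNReal.rpow_lt_top_of_nonneg (by positivity) (setLIntegral_norm_rpow_lt_top hδ _ _).ne

/-- After multiplication by the kernel, ζ^m ζ̄^m = |ζ|^(2m), and what remains is w^m times a radial
function times an antiholomorphic one. The mean value property replaces the symbol by its value c at
0. -/
theorem diskOperator_cutoffPower {c : ℝ} (h0 : 0 < c) (h1 : c ≤ 1) (m : ℤ) (τ : ℝ) {δ : ℝ}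
    (hδ : 0 < δ) (t : ℝ) {w : ℂ} (hw : w ∈ ball (0 : ℂ) 1) :
    diskOperator c m t (cutoffPower m τ δ) w = (c / π * (∫⁻ ζ in {ζ : ℂ | δ < ‖ζ‖},
      ENNReal.ofReal (‖ζ‖ ^ (2 * m + τ)) ∂(diskMeasure t)).toReal : ℝ) * w ^ m := by
  have hm : MeasurableSet {ζ : ℂ | δ < ‖ζ‖} := measurableSet_lt measurable_const measurable_norm
  -- The cutoff at r < 1 changes nothing almost everywhere and supplies the vanishing beyond R = 1
  -- needed by `integral_radial_mul_conj`.
  set φ : ℝ → ℂ := fun r => if δ < r ∧ r < 1 then ((r ^ (2 * m + τ) : ℝ) : ℂ) else 0 with hφ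
  have hae : (fun ζ => φ ‖ζ‖) =ᵐ[diskMeasure t]
      fun ζ => (({ζ : ℂ | δ < ‖ζ‖}.indicator (fun ζ => ‖ζ‖ ^ (2 * m + τ)) ζ : ℝ) : ℂ) := by
    filter_upwards [ae_diskMeasure_mem t] with ζ hζ
    have h1 : ‖ζ‖ < 1 := by simpa using hζ.1
    by_cases h : δ < ‖ζ‖
    · simp [hφ, h, h1]
    · simp [hφ, h]
  have hint : Integrable ({ζ : ℂ | δ < ‖ζ‖}.indicator fun ζ => ‖ζ‖ ^ (2 * m + τ))
      (diskMeasure t) := by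
    rw [integrable_indicator_iff hm]
    refine ⟨(measurable_norm.pow_const _).aestronglyMeasurable, ?_⟩
    refine lt_of_eq_of_lt (lintegral_congr fun ζ => ?_)
      (setLIntegral_norm_rpow_lt_top hδ t (2 * m + τ))
    rw [Real.enorm_of_nonneg (Real.rpow_nonneg (norm_nonneg _) _)]
  have hφi : Integrable (fun ζ => φ ‖ζ‖) (diskMeasure t) := hint.ofReal.congr hae.symm
  have hφint : ∫ ζ, φ ‖ζ‖ ∂(diskMeasure t) = ((∫⁻ ζ in {ζ : ℂ | δ < ‖ζ‖},
      ENNReal.ofReal (‖ζ‖ ^ (2 * m + τ)) ∂(diskMeasure t)).toReal : ℂ) := by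
    rw [integral_congr_ae hae, integral_complex_ofReal, integral_indicator hm,
      integral_eq_lintegral_of_nonneg_ae
        (Eventually.of_forall fun ζ => Real.rpow_nonneg (norm_nonneg _) _)
        (measurable_norm.pow_const _).aestronglyMeasurable]
  have hsc : ∀ ζ, symbol c (w * conj ζ) = conj (symbol c (conj w * ζ)) := fun ζ => by
    simp [symbol]
  have hd : DifferentiableOn ℂ (fun ζ => symbol c (conj w * ζ)) (ball 0 1) := fun ζ hζ => by
    have hlt : ‖conj w * ζ‖ < 1 := by
      have := norm_mul_conj_lt hw hζ
      simpa [norm_mul] using this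
    exact ((differentiableAt_symbol c hlt).comp ζ (by fun_prop)).differentiableWithinAt
  have hi' : Integrable (fun ζ => φ ‖ζ‖ * conj (symbol c (conj w * ζ))) (diskMeasure t) := by
    have := integrable_symbol_mul h0.le h1 hφi hw
    refine this.congr (Eventually.of_forall fun ζ => ?_)
    simp only [hsc]
    ring
  have hmv := integral_radial_mul_conj (R := 1) hd (φ := φ)
    (fun r hr => if_neg (by simp [hr])) hφi hi'
  have hop : diskOperator c m t (cutoffPower m τ δ) w
      = (π : ℂ)⁻¹ * w ^ m * ∫ ζ, φ ‖ζ‖ * conj (symbol c (conj w * ζ)) ∂(diskMeasure t) := by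
    rw [diskOperator, ← integral_const_mul]
    refine integral_congr_ae ?_
    filter_upwards [hae] with ζ hζ
    rw [hζ, ← hsc, diskKernel, cutoffPower]
    by_cases h : ζ ∈ {ζ : ℂ | δ < ‖ζ‖}
    · have hζ0 : 0 < ‖ζ‖ := hδ.trans h
      rw [indicator_of_mem h, indicator_of_mem h, Real.rpow_add hζ0, mul_comm (2 : ℝ) m,
        Real.rpow_mul hζ0.le, Real.rpow_intCast, Real.rpow_two, mul_zpow]
      have hn : ((‖ζ‖ : ℂ) ^ m) ^ 2 = conj ζ ^ m * ζ ^ m := by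
        rw [sq, ← mul_zpow, ← mul_zpow, mul_comm (conj ζ), Complex.mul_conj,
          Complex.normSq_eq_norm_sq, Complex.ofReal_pow, sq]
      push_cast
      rw [hn]
      ring
    · rw [indicator_of_notMem h, indicator_of_notMem h]
      simp
  rw [hop, hmv, hφint]
  simp only [symbol, mul_zero, add_zero, sub_zero, one_pow, div_one, Complex.conj_ofReal]
  push_cast
  ring

theorem eLpNorm_zpow (m : ℤ) (t : ℝ) {p : ℝ} (hp : 0 < p) :
    eLpNorm (fun ζ : ℂ => ζ ^ m) (ENNReal.ofReal p) (diskMeasure t)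
      = (∫⁻ ζ, ENNReal.ofReal (‖ζ‖ ^ (m * p)) ∂(diskMeasure t)) ^ (1 / p) := by
  rw [eLpNorm_eq_lintegral_rpow_enorm_toReal (by simpa using hp) ENNReal.ofReal_ne_top,
    ENNReal.toReal_ofReal hp.le]
  congr 1
  refine lintegral_congr fun ζ => ?_
  rw [← ofReal_norm, ENNReal.ofReal_rpow_of_nonneg (norm_nonneg _) hp.le, norm_zpow,
    ← Real.rpow_intCast, ← Real.rpow_mul (norm_nonneg _)]

theorem eLpNorm_zpow_ne_zero (m : ℤ) (t : ℝ) {p : ℝ} (hp : 0 < p) :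
    eLpNorm (fun ζ : ℂ => ζ ^ m) (ENNReal.ofReal p) (diskMeasure t) ≠ 0 := by
  rw [eLpNorm_zpow m t hp]
  have h := setLIntegral_norm_rpow_pos (δ := 1 / 2) (by norm_num) (by norm_num) t (m * p)
  have h2 := h.trans_le (setLIntegral_le_lintegral _ _)
  rw [Ne, ENNReal.rpow_eq_zero_iff_of_pos (by positivity)]
  exact h2.ne'

theorem eLpNorm_diskOperator_cutoffPower {c : ℝ} (h0 : 0 < c) (h1 : c ≤ 1) (m : ℤ) (τ : ℝ)
    {δ : ℝ} (hδ : 0 < δ) (t : ℝ) (p : ℝ≥0∞) :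
    eLpNorm (diskOperator c m t (cutoffPower m τ δ)) p (diskMeasure t)
      = ENNReal.ofReal (c / π) * (∫⁻ ζ in {ζ : ℂ | δ < ‖ζ‖},
          ENNReal.ofReal (‖ζ‖ ^ (2 * m + τ)) ∂(diskMeasure t))
        * eLpNorm (fun ζ : ℂ => ζ ^ m) p (diskMeasure t) := by
  have hae : diskOperator c m t (cutoffPower m τ δ) =ᵐ[diskMeasure t]
      ((c / π * (∫⁻ ζ in {ζ : ℂ | δ < ‖ζ‖},
        ENNReal.ofReal (‖ζ‖ ^ (2 * m + τ)) ∂(diskMeasure t)).toReal : ℝ) : ℂ) •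
        fun w : ℂ => w ^ m := by
    filter_upwards [ae_diskMeasure_mem t] with w hw
    rw [diskOperator_cutoffPower h0 h1 m τ hδ t hw.1]
    simp
  rw [eLpNorm_congr_ae hae, eLpNorm_const_smul]
  congr 1
  have hpi := Real.pi_pos
  rw [← ofReal_norm, Complex.norm_of_nonneg (by positivity), ENNReal.ofReal_mul (by positivity),
    ENNReal.ofReal_toReal (setLIntegral_norm_rpow_lt_top hδ t _).ne]

theorem diskMeasure_zero : diskMeasure 0 = volume.restrict (ball 0 1) := by
  simp [diskMeasure]

/-- The first factor is the constant 1, which the unweighted kernel reproduces, so its finite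
nonzero norm cancels. The constant C is uniform in τ and δ. -/
theorem cutoff_estimate_of_bounded {c : ℝ} (h0 : 0 < c) (h1 : c ≤ 1) {m : ℤ} {s' : ℝ}
    (hs : s' + 2 = 2 * c - 2 - 2 * m) {p : ℝ} (hp : 0 < p)
    (hB : BergmanProjectionLpBounded hartogsTriangle (hartogsWeight s') p) :
    ∃ C : ℝ≥0, ∀ τ δ : ℝ, 0 < δ →
      ENNReal.ofReal (c / π) * (∫⁻ ζ in {ζ : ℂ | δ < ‖ζ‖},
          ENNReal.ofReal (‖ζ‖ ^ (2 * m + τ)) ∂(diskMeasure (s' + 2)))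
        * eLpNorm (fun ζ : ℂ => ζ ^ m) (ENNReal.ofReal p) (diskMeasure (s' + 2))
      ≤ C * (∫⁻ ζ in {ζ : ℂ | δ < ‖ζ‖},
          ENNReal.ofReal (‖ζ‖ ^ ((m + τ) * p)) ∂(diskMeasure (s' + 2))) ^ (1 / p) := by
  obtain ⟨C, hC⟩ := eLpNorm_diskOperator_mul_le h0 h1 hs hp hB
  refine ⟨C, fun τ δ hδ => ?_⟩
  have := isFiniteMeasure_diskMeasure (t := 0) (by norm_num)
  have h := hC (fun _ => 1) (cutoffPower m τ δ) measurable_const (measurable_cutoffPower m τ δ)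
    (memLp_const 1) (by simpa using memLp_cutoffPower m τ hδ (s' + 2) two_pos) (memLp_const 1)
    (memLp_cutoffPower m τ hδ (s' + 2) hp)
  have hone : diskOperator 1 0 0 (fun _ => 1) =ᵐ[diskMeasure 0] fun _ => (1 : ℂ) := by
    filter_upwards [ae_diskMeasure_mem 0] with w hw
    exact integral_diskKernel_one_zero_mul (differentiableOn_const 1) (integrable_const 1) hw.1
  have hp0 : ENNReal.ofReal p ≠ 0 := by simpa using hp
  have hν : diskMeasure 0 ≠ 0 := by
    rw [diskMeasure_zero, Ne, Measure.restrict_eq_zero]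
    exact (measure_ball_pos volume _ one_pos).ne'
  have hN0 : eLpNorm (fun _ : ℂ => (1 : ℂ)) (ENNReal.ofReal p) (diskMeasure 0) ≠ 0 := by
    rw [Ne, eLpNorm_eq_zero_iff (by fun_prop) hp0]
    intro h
    have : (ae (diskMeasure 0)).NeBot := ae_neBot.2 hν
    obtain ⟨x, hx⟩ := h.exists
    simp at hx
  have hNt : eLpNorm (fun _ : ℂ => (1 : ℂ)) (ENNReal.ofReal p) (diskMeasure 0) ≠ ∞ :=
    (memLp_const (1 : ℂ)).2.ne
  rw [eLpNorm_congr_ae hone, eLpNorm_diskOperator_cutoffPower h0 h1 m τ hδ,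
    eLpNorm_cutoffPower m τ hδ _ hp, mul_left_comm (C : ℝ≥0∞)] at h
  exact (ENNReal.mul_le_mul_iff_right hN0 hNt).1 h

/-- A single truncated power already has a nonzero multiple of w^m as its image, so w^m must lie in
L^p; the inequality expresses this. -/
theorem integrability_of_bounded {c : ℝ} (h0 : 0 < c) (h1 : c ≤ 1) {m : ℤ} {s' : ℝ}
    (hs : s' + 2 = 2 * c - 2 - 2 * m) {p : ℝ} (hp : 0 < p)
    (hB : BergmanProjectionLpBounded hartogsTriangle (hartogsWeight s') p) :
    0 < m * p + (2 * c - 2 * m) := by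
  obtain ⟨C, hC⟩ := cutoff_estimate_of_bounded h0 h1 hs hp hB
  have h := hC 0 (1 / 2) (by norm_num)
  have hA := setLIntegral_norm_rpow_pos (δ := 1 / 2) (by norm_num) (by norm_num) (s' + 2)
    (2 * m + 0)
  have hκ : ENNReal.ofReal (c / π) ≠ 0 := by
    have := Real.pi_pos
    have : 0 < c / π := by positivity
    simpa using this
  have hW : eLpNorm (fun ζ : ℂ => ζ ^ m) (ENNReal.ofReal p) (diskMeasure (s' + 2)) < ∞ := by
    refine ENNReal.lt_top_of_mul_ne_top_right (ne_top_of_le_ne_top ?_ h) (mul_ne_zero hκ hA.ne')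
    refine ENNReal.mul_ne_top ENNReal.coe_ne_top (ENNReal.rpow_ne_top_of_nonneg (by positivity) ?_)
    exact (setLIntegral_norm_rpow_lt_top (by norm_num) _ _).ne
  rw [eLpNorm_zpow m _ hp, ENNReal.rpow_lt_top_iff_of_pos (by positivity),
    lintegral_norm_rpow_lt_top_iff] at hW
  linarith

/-- The test functions are truncations of the extremal function for pairing L^p with w^m. If A(δ) is
the truncated integral of |ζ|^(mq), with q conjugate to p, boundedness gives A ≤ const · A^(1/p). So
A stays bounded as δ → 0 and w^m lies in L^q. -/
theorem dual_integrability_of_bounded {c : ℝ} (h0 : 0 < c) (h1 : c ≤ 1) {m : ℤ} {s' : ℝ}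
    (hs : s' + 2 = 2 * c - 2 - 2 * m) {p : ℝ} (hp : 1 < p)
    (hB : BergmanProjectionLpBounded hartogsTriangle (hartogsWeight s') p) :
    0 < m * p + (2 * c - 2 * m) * (p - 1) := by
  have hp0 : 0 < p := by linarith
  have hp1 : 0 < p - 1 := by linarith
  obtain ⟨C, hC⟩ := cutoff_estimate_of_bounded h0 h1 hs hp0 hB
  -- This τ solves (m + τ)p = 2m + τ, so the same integral appears on both sides of the estimate;
  -- the common exponent is mp/(p-1).
  set τ := -m * (p - 2) / (p - 1) with hτ
  have hτp : τ * (p - 1) = -m * (p - 2) := by rw [hτ]; field_simp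
  have he : (m + τ) * p = 2 * m + τ := by linarith
  set A : ℝ → ℝ≥0∞ := fun δ => ∫⁻ ζ in {ζ : ℂ | δ < ‖ζ‖},
    ENNReal.ofReal (‖ζ‖ ^ (2 * m + τ)) ∂(diskMeasure (s' + 2)) with hA
  set W := eLpNorm (fun ζ : ℂ => ζ ^ m) (ENNReal.ofReal p) (diskMeasure (s' + 2)) with hW
  have hκ : ENNReal.ofReal (c / π) ≠ 0 := by
    have := Real.pi_pos
    have : 0 < c / π := by positivity
    simpa using this
  have hκW : ENNReal.ofReal (c / π) * W ≠ 0 := mul_ne_zero hκ (eLpNorm_zpow_ne_zero m _ hp0)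
  set M : ℝ≥0∞ := C / (ENNReal.ofReal (c / π) * W) with hM
  have hMt : M ≠ ∞ := ENNReal.div_ne_top ENNReal.coe_ne_top hκW
  -- The shift by 2 keeps δ < 1, so that A(δ) is nonzero and A(δ)^(1/p) can be cancelled.
  have hbound : ∀ n : ℕ, A (1 / (n + 2)) ≤ M ^ (p / (p - 1)) := fun n => by
    have hδ0 : (0 : ℝ) < 1 / (n + 2) := by positivity
    have hδ1 : (1 : ℝ) / (n + 2) < 1 := by
      rw [div_lt_one (by positivity)]; linarith [(Nat.cast_nonneg n : (0 : ℝ) ≤ n)]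
    have h := hC τ _ hδ0
    rw [he] at h
    have hA0 : A (1 / (n + 2)) ≠ 0 := (setLIntegral_norm_rpow_pos hδ0 hδ1 _ _).ne'
    have hAt : A (1 / (n + 2)) ≠ ∞ := (setLIntegral_norm_rpow_lt_top hδ0 _ _).ne
    change ENNReal.ofReal (c / π) * A (1 / (n + 2)) * W ≤ C * A (1 / (n + 2)) ^ (1 / p) at h
    set a := A (1 / (n + 2))
    have e : a = a ^ (1 - 1 / p) * a ^ (1 / p) := by
      rw [← ENNReal.rpow_add _ _ hA0 hAt]; simp
    have hr0 : a ^ (1 / p) ≠ 0 := by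
      rw [Ne, ENNReal.rpow_eq_zero_iff_of_pos (by positivity)]; exact hA0
    have hrt : a ^ (1 / p) ≠ ∞ := ENNReal.rpow_ne_top_of_nonneg (by positivity) hAt
    have h2 : a ^ (1 - 1 / p) * (ENNReal.ofReal (c / π) * W) ≤ C := by
      rw [← ENNReal.mul_le_mul_iff_left hr0 hrt]
      calc _ = ENNReal.ofReal (c / π) * (a ^ (1 - 1 / p) * a ^ (1 / p)) * W := by ring
        _ ≤ _ := by rw [← e]; exact h
    have h3 : a ^ (1 - 1 / p) ≤ M :=
      (ENNReal.le_div_iff_mul_le (Or.inl hκW) (Or.inr ENNReal.coe_ne_top)).2 h2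
    calc a = (a ^ (1 - 1 / p)) ^ (p / (p - 1)) := by
          rw [← ENNReal.rpow_mul, show (1 - 1 / p) * (p / (p - 1)) = 1 by field_simp,
            ENNReal.rpow_one]
      _ ≤ M ^ (p / (p - 1)) := by gcongr
  have hfin : ∫⁻ ζ, ENNReal.ofReal (‖ζ‖ ^ (2 * m + τ)) ∂(diskMeasure (s' + 2)) < ∞ := by
    have hmono : Monotone fun n : ℕ => {ζ : ℂ | (1 : ℝ) / (n + 2) < ‖ζ‖} := fun i j hij ζ hζ => by
      change (1 : ℝ) / (i + 2) < ‖ζ‖ at hζ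
      change (1 : ℝ) / (j + 2) < ‖ζ‖
      refine lt_of_le_of_lt ?_ hζ
      have : (i : ℝ) ≤ j := by exact_mod_cast hij
      gcongr
    have hU : ∫⁻ ζ, ENNReal.ofReal (‖ζ‖ ^ (2 * m + τ)) ∂(diskMeasure (s' + 2))
        ≤ ∫⁻ ζ in ⋃ n : ℕ, {ζ : ℂ | (1 : ℝ) / (n + 2) < ‖ζ‖},
          ENNReal.ofReal (‖ζ‖ ^ (2 * m + τ)) ∂(diskMeasure (s' + 2)) := by
      rw [← setLIntegral_univ]
      refine lintegral_mono_set' ?_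
      filter_upwards [ae_diskMeasure_mem (s' + 2)] with ζ hζ _
      have hζ0 : 0 < ‖ζ‖ := norm_pos_iff.2 hζ.2
      obtain ⟨n, hn⟩ := exists_nat_gt (1 / ‖ζ‖)
      refine mem_iUnion.2 ⟨n, ?_⟩
      change (1 : ℝ) / (n + 2) < ‖ζ‖
      rw [div_lt_iff₀ hζ0] at hn
      rw [div_lt_iff₀ (by positivity)]
      nlinarith
    refine hU.trans_lt ?_
    rw [setLIntegral_iUnion_of_directed _ hmono.directed_le]
    refine (iSup_le hbound).trans_lt ?_
    exact ENNReal.rpow_lt_top_of_nonneg (by positivity) hMt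
  rw [lintegral_norm_rpow_lt_top_iff] at hfin
  have hlast : 0 < 2 * c + τ := by linarith
  have := mul_pos hlast hp1
  linarith

/-! ### Failure at p = 1. -/

/-- The kernel is antiholomorphic in ζ. After translating the centre a to 0, the mean value property
gives the area πr² times the kernel at ζ = a. -/
theorem diskOperator_indicator_ball {a : ℂ} {r : ℝ} (hr : 0 < r) (har : ‖a‖ + r ≤ 1) {w : ℂ}
    (hw : w ∈ ball (0 : ℂ) 1) :
    diskOperator 1 0 0 ((ball a r).indicator fun _ => 1) w
      = (r ^ 2 : ℝ) * ((1 - w * conj a) ^ 2)⁻¹ := by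
  have hsub : ∀ u : ℂ, ‖u‖ < r → a + u ∈ ball (0 : ℂ) 1 := fun u hu => by
    rw [mem_ball_zero_iff]
    linarith [norm_add_le a u]
  have hr1 : r ≤ 1 := by linarith [norm_nonneg a]
  set h : ℂ → ℂ := fun u => ((1 - conj w * (a + u)) ^ 2)⁻¹ with hh
  set φ : ℝ → ℂ := fun ρ => if ρ < r then 1 else 0 with hφ
  have hlt : ∀ u : ℂ, ‖u‖ < r → ‖conj w * (a + u)‖ < 1 := fun u hu => by
    have := norm_mul_conj_lt hw (hsub u hu)
    rwa [norm_mul, RCLike.norm_conj, ← RCLike.norm_conj w, ← norm_mul] at this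
  have hd : DifferentiableOn ℂ h (ball 0 r) := fun u hu => by
    refine DifferentiableAt.differentiableWithinAt (DifferentiableAt.inv (by fun_prop) ?_)
    exact pow_ne_zero _ (one_sub_ne_zero (hlt u (by simpa using hu)))
  have := isFiniteMeasure_diskMeasure (t := 0) (by norm_num)
  have hφm : Measurable φ := Measurable.ite measurableSet_Iio measurable_const measurable_const
  have hφi : Integrable (fun ζ : ℂ => φ ‖ζ‖) (diskMeasure 0) := by
    refine Integrable.of_bound (hφm.comp measurable_norm).aestronglyMeasurable 1
      (Eventually.of_forall fun ζ => ?_)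
    simp only [hφ]
    split_ifs <;> simp
  have hw' : ‖w‖ < 1 := by simpa using hw
  have hhm : Measurable h := by fun_prop
  have hi' : Integrable (fun ζ : ℂ => φ ‖ζ‖ * conj (h ζ)) (diskMeasure 0) := by
    refine Integrable.of_bound ((hφm.comp measurable_norm).mul
      (measurable_conj.comp hhm)).aestronglyMeasurable ((1 - ‖w‖)⁻¹ ^ 2)
      (Eventually.of_forall fun u => ?_)
    by_cases hu : ‖u‖ < r
    · have h1 : 1 - ‖w‖ ≤ ‖1 - conj w * (a + u)‖ := by
        have h2 := norm_sub_norm_le (1 : ℂ) (conj w * (a + u))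
        have h3 : ‖a + u‖ < 1 := by simpa using hsub u hu
        have h4 : ‖conj w * (a + u)‖ ≤ ‖w‖ := by
          rw [norm_mul, RCLike.norm_conj]
          exact mul_le_of_le_one_right (norm_nonneg _) h3.le
        rw [norm_one] at h2
        linarith
      have h5 : 0 < 1 - ‖w‖ := by linarith
      simp only [hφ, hh, if_pos hu, one_mul, RCLike.norm_conj, norm_inv, norm_pow, inv_pow]
      gcongr
    · simp only [hφ, if_neg hu, zero_mul, norm_zero]
      positivity
  have hmv := integral_radial_mul_conj hd (φ := φ) (fun ρ hρ => if_neg (not_lt.2 hρ)) hφi hi'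
  have hφe : (fun ζ : ℂ => φ ‖ζ‖) = (ball (0 : ℂ) r).indicator fun _ => 1 := by
    funext ζ
    by_cases hζ : ‖ζ‖ < r
    · rw [indicator_of_mem (by simpa using hζ)]; exact if_pos hζ
    · rw [indicator_of_notMem (by simpa using hζ)]; exact if_neg hζ
  have hφint : ∫ ζ : ℂ, φ ‖ζ‖ ∂(diskMeasure 0) = (r ^ 2 * π : ℝ) := by
    rw [hφe, diskMeasure_zero, integral_indicator measurableSet_ball,
      Measure.restrict_restrict measurableSet_ball,
      inter_eq_self_of_subset_left (ball_subset_ball hr1), setIntegral_const, Measure.real,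
      Complex.volume_ball, ENNReal.toReal_mul, ENNReal.toReal_pow, ENNReal.toReal_ofReal hr.le]
    simp
  have hop : diskOperator 1 0 0 ((ball a r).indicator fun _ => 1) w
      = (π : ℂ)⁻¹ * ∫ ζ, φ ‖ζ‖ * conj (h ζ) ∂(diskMeasure 0) := by
    have e1 : diskOperator 1 0 0 ((ball a r).indicator fun _ => 1) w
        = ∫ ζ, (ball a r).indicator (diskKernel 1 0 w) ζ := by
      have hb : ball a r ⊆ ball 0 1 := fun z hz => by
        have := hsub (z - a) (by rwa [mem_ball, dist_eq_norm] at hz)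
        simpa using this
      rw [diskOperator, diskMeasure_zero, ← integral_indicator measurableSet_ball]
      refine integral_congr_ae (Eventually.of_forall fun ζ => ?_)
      by_cases hζ : ζ ∈ ball a r
      · simp only [indicator_of_mem hζ, indicator_of_mem (hb hζ), mul_one]
      · by_cases hζ1 : ζ ∈ ball (0 : ℂ) 1
        · simp only [indicator_of_notMem hζ, indicator_of_mem hζ1, mul_zero]
        · simp only [indicator_of_notMem hζ, indicator_of_notMem hζ1]
    rw [e1, ← integral_add_left_eq_self _ a, ← integral_const_mul, diskMeasure_zero,
      ← integral_indicator measurableSet_ball]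
    refine integral_congr_ae (Eventually.of_forall fun u => ?_)
    by_cases hu : ‖u‖ < r
    · have hm1 : a + u ∈ ball a r := by simpa using hu
      have hm2 : u ∈ ball (0 : ℂ) 1 := by rw [mem_ball_zero_iff]; linarith
      simp only [indicator_of_mem hm1, indicator_of_mem hm2, hφ, if_pos hu, hh, diskKernel, symbol]
      simp [div_eq_mul_inv]
    · have hm1 : a + u ∉ ball a r := by simpa using hu
      simp only [indicator_of_notMem hm1]
      by_cases hm2 : u ∈ ball (0 : ℂ) 1
      · simp only [indicator_of_mem hm2, hφ, if_neg hu, zero_mul, mul_zero]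
      · simp only [indicator_of_notMem hm2]
  rw [hop, hmv, hφint]
  have := Real.pi_ne_zero
  have h6 : conj (h 0) = ((1 - w * conj a) ^ 2)⁻¹ := by simp [hh]
  rw [h6]
  push_cast
  field_simp

/-- The function -log(1 - a²r²) has derivative 2a²r/(1 - a²r²), which is below the integrand because
a² ≤ π. -/
theorem le_lintegral_div_one_sub {a : ℝ} (ha0 : 0 < a) (ha1 : a < 1) :
    ENNReal.ofReal (-Real.log (1 - a ^ 2))
      ≤ ∫⁻ r in Ioo (0 : ℝ) 1, ENNReal.ofReal (r ^ ((0 : ℝ) + 1)) *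
          ENNReal.ofReal (2 * π / (1 - a ^ 2 * r ^ 2)) := by
  have hpos : ∀ r ∈ Icc (0 : ℝ) 1, 0 < 1 - a ^ 2 * r ^ 2 := fun r hr => by
    have h1 : r ^ 2 ≤ 1 := pow_le_one₀ hr.1 hr.2
    nlinarith
  have hcont : ContinuousOn (fun r : ℝ => 2 * a ^ 2 * r / (1 - a ^ 2 * r ^ 2)) (Icc 0 1) :=
    ContinuousOn.div (by fun_prop) (by fun_prop) fun r hr => (hpos r hr).ne'
  have hftc : ∫ r in (0 : ℝ)..1, 2 * a ^ 2 * r / (1 - a ^ 2 * r ^ 2)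
      = -Real.log (1 - a ^ 2 * 1 ^ 2) - -Real.log (1 - a ^ 2 * 0 ^ 2) := by
    refine intervalIntegral.integral_eq_sub_of_hasDerivAt_of_le
      (f := fun r => -Real.log (1 - a ^ 2 * r ^ 2)) zero_le_one ?_ ?_ ?_
    · exact (ContinuousOn.log (by fun_prop) fun r hr => (hpos r hr).ne').neg
    · intro r hr
      have h1 : HasDerivAt (fun r : ℝ => 1 - a ^ 2 * r ^ 2) (-(a ^ 2 * (2 * r))) r := by
        simpa using (((hasDerivAt_id r).pow 2).const_mul (a ^ 2)).const_sub 1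
      refine (h1.log (hpos r ⟨hr.1.le, hr.2.le⟩).ne').neg.congr_deriv ?_
      ring
    · exact ContinuousOn.intervalIntegrable (by rwa [uIcc_of_le zero_le_one])
  have hftc2 : ∫ r in Ioo (0 : ℝ) 1, 2 * a ^ 2 * r / (1 - a ^ 2 * r ^ 2)
      = -Real.log (1 - a ^ 2) := by
    rw [← integral_Ioc_eq_integral_Ioo, ← intervalIntegral.integral_of_le zero_le_one, hftc]
    simp
  rw [← hftc2, ofReal_integral_eq_lintegral_ofReal]
  · refine setLIntegral_mono' measurableSet_Ioo fun r hr => ?_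
    rw [← ENNReal.ofReal_mul (Real.rpow_nonneg hr.1.le _), zero_add, Real.rpow_one]
    refine ENNReal.ofReal_le_ofReal ?_
    rw [← mul_div_assoc]
    have h1 := hpos r ⟨hr.1.le, hr.2.le⟩
    have h2 : a ^ 2 ≤ π := by nlinarith [Real.pi_gt_three]
    have h3 : 2 * a ^ 2 * r ≤ r * (2 * π) := by nlinarith [hr.1]
    gcongr
  · exact hcont.integrableOn_Icc.mono_set Ioo_subset_Icc_self
  · filter_upwards [ae_restrict_mem measurableSet_Ioo] with r hr
    have h1 := hpos r ⟨hr.1.le, hr.2.le⟩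
    have h2 := hr.1
    positivity

/-- The second factor is a fixed function with nonzero image; the first is the indicator of the disk
of centre a and radius r = 1 - a. Its L¹ norm is at most πr², while its image r²/(1 - aw)² has L¹
norm at least -r² log(1 - a²). The quotient is unbounded as a → 1. -/
theorem not_bounded_one {c : ℝ} (h0 : 0 < c) (h1 : c ≤ 1) {m : ℤ} {s' : ℝ}
    (hs : s' + 2 = 2 * c - 2 - 2 * m) :
    ¬ BergmanProjectionLpBounded hartogsTriangle (hartogsWeight s') 1 := by
  intro hB
  obtain ⟨C, hC⟩ := eLpNorm_diskOperator_mul_le h0 h1 hs one_pos hB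
  have := isFiniteMeasure_diskMeasure (t := 0) (by norm_num)
  have hhalf : (0 : ℝ) < 1 / 2 := by norm_num
  set G := cutoffPower m 0 (1 / 2)
  set U := eLpNorm G (ENNReal.ofReal 1) (diskMeasure (s' + 2)) with hU
  set V := eLpNorm (diskOperator c m (s' + 2) G) (ENNReal.ofReal 1) (diskMeasure (s' + 2)) with hV
  have hG1 : MemLp G (ENNReal.ofReal 1) (diskMeasure (s' + 2)) :=
    memLp_cutoffPower m 0 hhalf (s' + 2) one_pos
  have hG2 : MemLp G 2 (diskMeasure (s' + 2)) := by
    have := memLp_cutoffPower m 0 hhalf (s' + 2) two_pos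
    rwa [ENNReal.ofReal_ofNat] at this
  have hV0 : V ≠ 0 := by
    rw [hV, eLpNorm_diskOperator_cutoffPower h0 h1 m 0 hhalf]
    refine mul_ne_zero (mul_ne_zero ?_ ?_) (eLpNorm_zpow_ne_zero m _ one_pos)
    · have := Real.pi_pos
      have : 0 < c / π := by positivity
      simpa using this
    · exact (setLIntegral_norm_rpow_pos hhalf (by norm_num) _ _).ne'
  have hCU : C * U * NNReal.pi ≠ ∞ :=
    ENNReal.mul_ne_top (ENNReal.mul_ne_top ENNReal.coe_ne_top hG1.2.ne) ENNReal.coe_ne_top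
  have hbound : ∀ a : ℝ, 0 < a → a < 1 →
      ENNReal.ofReal (-Real.log (1 - a ^ 2)) ≤ C * U * NNReal.pi / V := fun a ha0 ha1 => by
    set r := 1 - a with hr
    have hr0 : 0 < r := by linarith
    have hna : ‖(a : ℂ)‖ = a := Complex.norm_of_nonneg ha0.le
    set F : ℂ → ℂ := (ball (a : ℂ) r).indicator fun _ => 1 with hF
    have hFm : Measurable F := measurable_const.indicator measurableSet_ball
    have hFL : ∀ p : ℝ≥0∞, MemLp F p (diskMeasure 0) := fun p =>
      (memLp_const 1).indicator measurableSet_ball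
    have h := hC F G hFm (measurable_cutoffPower m 0 _) (hFL 2) hG2 (hFL _) hG1
    have hFn : eLpNorm F (ENNReal.ofReal 1) (diskMeasure 0)
        ≤ ENNReal.ofReal r ^ 2 * NNReal.pi := by
      rw [ENNReal.ofReal_one, eLpNorm_one_eq_lintegral_enorm, ← Complex.volume_ball (a : ℂ) r,
        ← lintegral_indicator_one measurableSet_ball, diskMeasure_zero]
      refine (setLIntegral_le_lintegral _ _).trans (lintegral_mono fun ζ => ?_)
      rw [hF, enorm_indicator_eq_indicator_enorm]
      simp [indicator]
    have hTF : ENNReal.ofReal r ^ 2 * ENNReal.ofReal (-Real.log (1 - a ^ 2))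
        ≤ eLpNorm (diskOperator 1 0 0 F) (ENNReal.ofReal 1) (diskMeasure 0) := by
      have e : eLpNorm (diskOperator 1 0 0 F) (ENNReal.ofReal 1) (diskMeasure 0)
          = ENNReal.ofReal r ^ 2 * ∫⁻ ζ, 1 * ‖1 - (a : ℂ) * conj ζ‖ₑ⁻¹ ^ 2 ∂(diskMeasure 0) := by
        rw [ENNReal.ofReal_one, eLpNorm_one_eq_lintegral_enorm,
          ← lintegral_const_mul' _ _ (by finiteness)]
        refine lintegral_congr_ae ?_
        filter_upwards [ae_diskMeasure_mem 0] with w hw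
        rw [diskOperator_indicator_ball hr0 (by rw [hna, hr]; linarith) hw.1, enorm_mul, one_mul,
          ← ofReal_norm (((r ^ 2 : ℝ) : ℂ)), Complex.norm_of_nonneg (by positivity),
          ENNReal.ofReal_pow hr0.le]
        have hconj : 1 - (a : ℂ) * conj w = conj (1 - w * conj (a : ℂ)) := by
          simp [mul_comm]
        have hne : (1 - w * conj (a : ℂ)) ≠ 0 :=
          one_sub_ne_zero (norm_mul_conj_lt hw.1 (by simpa [abs_of_pos ha0] using ha1))
        rw [hconj, RCLike.enorm_conj, enorm_inv (pow_ne_zero _ hne), enorm_pow, ENNReal.inv_pow]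
      have e2 := lintegral_radial_mul_kernel 0 (φ := fun _ => 1) measurable_const (w := (a : ℂ))
        (by rw [hna]; exact ha1.le)
      rw [e, e2, lintegral_radialMeasure, hna]
      simp only [one_mul]
      gcongr
      exact le_lintegral_div_one_sub ha0 ha1
    have hr2 : ENNReal.ofReal r ^ 2 ≠ 0 := by simpa using hr0
    have hr2t : ENNReal.ofReal r ^ 2 ≠ ∞ := by finiteness
    rw [ENNReal.le_div_iff_mul_le (Or.inl hV0) (Or.inr hCU),
      ← ENNReal.mul_le_mul_iff_right hr2 hr2t]
    calc ENNReal.ofReal r ^ 2 * (ENNReal.ofReal (-Real.log (1 - a ^ 2)) * V)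
        = ENNReal.ofReal r ^ 2 * ENNReal.ofReal (-Real.log (1 - a ^ 2)) * V := by ring
      _ ≤ _ := by gcongr
      _ ≤ _ := h
      _ ≤ C * ((ENNReal.ofReal r ^ 2 * NNReal.pi) * U) := by gcongr
      _ = _ := by ring
  -- The contradiction comes from a² = 1 - x with x = exp(-(M+1)), for which -log(1 - a²) = M + 1.
  set M := C * U * NNReal.pi / V
  have hM : M ≠ ∞ := ENNReal.div_ne_top hCU hV0
  set x := Real.exp (-(M.toReal + 1)) with hx
  have hx0 : 0 < x := Real.exp_pos _
  have hx1 : x < 1 := by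
    rw [hx, Real.exp_lt_one_iff]
    linarith [ENNReal.toReal_nonneg (a := M)]
  have h := hbound (Real.sqrt (1 - x)) (Real.sqrt_pos.2 (by linarith))
    (by rw [Real.sqrt_lt' one_pos]; linarith)
  rw [Real.sq_sqrt (by linarith), sub_sub_cancel, hx, Real.log_exp, neg_neg,
    ENNReal.ofReal_le_iff_le_toReal hM] at h
  linarith

/-! ### The criterion in terms of c and m. -/

theorem bergmanProjectionLpBounded_iff {c : ℝ} (h0 : 0 < c) (h1 : c ≤ 1) {m : ℤ} {s' : ℝ}
    (hs : s' + 2 = 2 * c - 2 - 2 * m) {p : ℝ} (hp : 1 ≤ p) :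
    BergmanProjectionLpBounded hartogsTriangle (hartogsWeight s') p ↔
      1 < p ∧ 0 < m * p + (2 * c - 2 * m) ∧ 0 < m * p + (2 * c - 2 * m) * (p - 1) := by
  refine ⟨fun hB => ?_, fun h => bergmanProjectionLpBounded_of_lt h0 h1 hs h.1 h.2.1 h.2.2⟩
  have hp1 : 1 < p := by
    refine lt_of_le_of_ne hp fun h => ?_
    rw [← h] at hB
    exact not_bounded_one h0 h1 hs hB
  exact ⟨hp1, integrability_of_bounded h0 h1 hs (by linarith) hB,
    dual_integrability_of_bounded h0 h1 hs hp1 hB⟩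

end HartogsBergman

namespace HartogsBergman

/-! ### Arithmetic of the exponents. -/

theorem existsUnique_remainder (s' : ℝ) :
    ∃! sk : ℝ × ℤ, sk.1 ∈ Set.Ioc (0 : ℝ) 2 ∧ s' = sk.1 + 2 * (sk.2 : ℝ) := by
  -- The interval (0, 2] is closed on the right, so an even integer s' has remainder 2; hence the
  -- ceiling minus one in place of the floor.
  refine ⟨(s' - 2 * ((⌈s' / 2⌉ - 1 : ℤ) : ℝ), ⌈s' / 2⌉ - 1), ⟨⟨?_, ?_⟩, by ring⟩, ?_⟩
  · have := Int.ceil_lt_add_one (s' / 2)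
    push_cast
    linarith
  · have := Int.le_ceil (s' / 2)
    push_cast
    linarith
  · rintro ⟨s, k⟩ ⟨⟨h1, h2⟩, h3⟩
    simp only at h1 h2 h3
    have hk : ⌈s' / 2⌉ = k + 1 := by
      rw [Int.ceil_eq_iff]
      push_cast
      constructor <;> linarith
    rw [hk]
    ext
    · push_cast; linarith
    · simp

/-- The substitution is c = s/2, m = -k-2, so that 2c - 2m = s + 2k + 4. Leaving the inequalities
undivided allows k+2 and s+k+2 to have any sign. -/
theorem bergmanProjectionLpBounded_iff_of_eq {s' s : ℝ} {k : ℤ} (hs : s ∈ Set.Ioc (0 : ℝ) 2)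
    (hk : s' = s + 2 * (k : ℝ)) {p : ℝ} (hp : 1 ≤ p) :
    BergmanProjectionLpBounded hartogsTriangle (hartogsWeight s') p ↔
      1 < p ∧ p * (k + 2) < s + 2 * k + 4 ∧ s + 2 * k + 4 < p * (s + k + 2) := by
  rw [bergmanProjectionLpBounded_iff (c := s / 2) (m := -k - 2) (by linarith [hs.1])
    (by linarith [hs.2]) (by push_cast; linarith) hp]
  push_cast
  refine and_congr Iff.rfl (and_congr ?_ ?_) <;> constructor <;> intro h <;> linarith

end HartogsBergman

theorem theorem1p1 (s' : ℝ) :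
    (∃! sk : ℝ × ℤ, sk.1 ∈ Set.Ioc (0 : ℝ) 2 ∧ s' = sk.1 + 2 * (sk.2 : ℝ)) ∧
    ∀ (s : ℝ) (k : ℤ), s ∈ Set.Ioc (0 : ℝ) 2 → s' = s + 2 * (k : ℝ) →
      (s' ∈ Set.Ioi (-2 : ℝ) → ∀ p : ℝ, 1 ≤ p →
        (HartogsBergman.BergmanProjectionLpBounded HartogsBergman.hartogsTriangle
            (HartogsBergman.hartogsWeight s') p ↔
          p ∈ Set.Ioo ((s + 2 * k + 4) / (s + k + 2)) ((s + 2 * k + 4) / (k + 2)))) ∧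
      (s' ∈ Set.Icc (-5 : ℝ) (-2) → ∀ p : ℝ, 1 ≤ p →
        (HartogsBergman.BergmanProjectionLpBounded HartogsBergman.hartogsTriangle
            (HartogsBergman.hartogsWeight s') p ↔
          p ∈ Set.Ioi (1 : ℝ))) ∧
      (s' ∈ Set.Ioo (-6 : ℝ) (-5) → k = -3 ∧ s ∈ Set.Ioo (0 : ℝ) 1 ∧ ∀ p : ℝ, 1 ≤ p →
        (HartogsBergman.BergmanProjectionLpBounded HartogsBergman.hartogsTriangle
            (HartogsBergman.hartogsWeight s') p ↔
          p ∈ Set.Ioo (2 - s) ((2 - s) / (1 - s)))) ∧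
      (s' = -6 → ∀ p : ℝ, 1 ≤ p →
        (HartogsBergman.BergmanProjectionLpBounded HartogsBergman.hartogsTriangle
            (HartogsBergman.hartogsWeight s') p ↔
          p ∈ Set.Ioi (1 : ℝ))) ∧
      (s' ∈ Set.Iio (-6 : ℝ) → ∀ p : ℝ, 1 ≤ p →
        (HartogsBergman.BergmanProjectionLpBounded HartogsBergman.hartogsTriangle
            (HartogsBergman.hartogsWeight s') p ↔
          p ∈ Set.Ioo ((s + 2 * k + 4) / (k + 2)) ((s + 2 * k + 4) / (s + k + 2)))) := by
  refine ⟨HartogsBergman.existsUnique_remainder s', fun s k hs hk => ?_⟩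
  have key := fun p : ℝ => HartogsBergman.bergmanProjectionLpBounded_iff_of_eq hs hk (p := p)
  obtain ⟨hs0, hs2⟩ := hs
  refine ⟨fun h p hp => ?_, fun h p hp => ?_, fun h => ?_, fun h p hp => ?_, fun h p hp => ?_⟩
  · rw [Set.mem_Ioi] at h
    have hk1 : (-2 : ℝ) < k := by linarith
    have hk2 : (-1 : ℝ) ≤ k := by exact_mod_cast (by exact_mod_cast hk1 : (-2 : ℤ) < k)
    rw [key p hp, Set.mem_Ioo, div_lt_iff₀ (by linarith), lt_div_iff₀ (by linarith)]
    -- Both denominators are positive, and p > 1 is automatic because the left endpoint is 1 +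
    -- (k+2)/(s+k+2).
    exact ⟨fun h => ⟨h.2.2, h.2.1⟩, fun h => ⟨by nlinarith, h.2, h.1⟩⟩
  · rw [key p hp, Set.mem_Ioi]
    refine ⟨fun h => h.1, fun hp1 => ⟨hp1, ?_⟩⟩
    have hk1 : k < -1 := by
      have : (k : ℝ) < -1 := by linarith [h.2]
      exact_mod_cast this
    have hk2 : -4 < k := by
      have : (-4 : ℝ) < k := by linarith [h.1]
      exact_mod_cast this
    -- For k = -2 the two conditions are 0 < s and s < ps. For k = -3 the bound s' ≥ -5 means s ≥ 1,
    -- and then p > 2 - s and s - 2 < p(s - 1) both follow from p > 1.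
    have hk3 : k = -2 ∨ k = -3 := by omega
    rcases hk3 with rfl | rfl
    · push_cast
      constructor <;> nlinarith
    · have := h.1
      push_cast at hk ⊢
      constructor <;> nlinarith
  · have hk3 : k = -3 := by
      have h1 : (k : ℝ) < -2 := by linarith [h.2]
      have h2 : (-4 : ℝ) < k := by linarith [h.1]
      have h3 : k < -2 := by exact_mod_cast h1
      have h4 : -4 < k := by exact_mod_cast h2
      omega
    subst hk3
    push_cast at hk
    have hs1 : s < 1 := by linarith [h.2]
    refine ⟨rfl, ⟨hs0, hs1⟩, fun p hp => ?_⟩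
    rw [key p hp, Set.mem_Ioo, lt_div_iff₀ (by linarith)]
    push_cast
    exact ⟨fun h => ⟨by linarith, by linarith⟩, fun h => ⟨by linarith, by linarith, by linarith⟩⟩
  · have hk4 : k = -4 := by
      have h1 : (k : ℝ) < -3 := by linarith
      have h2 : (-4 : ℝ) ≤ k := by linarith
      have h3 : k < -3 := by exact_mod_cast h1
      have h4 : -4 ≤ k := by exact_mod_cast h2
      omega
    subst hk4
    push_cast at hk
    rw [key p hp, Set.mem_Ioi]
    push_cast
    exact ⟨fun h => h.1, fun h => ⟨h, by linarith, by nlinarith⟩⟩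
  · rw [Set.mem_Iio] at h
    have hk1 : (k : ℝ) < -3 := by linarith
    have hk2 : (k : ℝ) ≤ -4 := by
      have : k < -3 := by exact_mod_cast hk1
      exact_mod_cast (by omega : k ≤ -4)
    -- Both denominators are now negative, so the endpoints change places; p > 1 follows from the
    -- left endpoint 1 + (s+k+2)/(k+2).
    have hsk : s + k + 2 < 0 := by linarith
    rw [key p hp, Set.mem_Ioo, div_lt_iff_of_neg (by linarith), lt_div_iff_of_neg hsk]
    exact ⟨fun h => ⟨h.2.1, h.2.2⟩, fun h => ⟨by nlinarith, h.1, h.2⟩⟩
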